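/- Let $d\ge 3$, $\nu=d/2$, and let Euclidean $AdS_{d+1}$ (radius $1$) be the half-space with coordinates $(z,x^1,\dots,x^d)$, $z>0$, and metric $g_{\mu\nu}=\delta_{\mu\nu}/z^2$ ($x^0=z$). A hook field is a tensor field $\varphi_{\mu\nu,\rho}=\varphi_{\nu\mu,\rho}$ with $\varphi_{\mu\nu,\rho}+\varphi_{\mu\rho,\nu}+\varphi_{\rho\nu,\mu}=0$; put $\varphi_\rho=g^{\mu\nu}\varphi_{\mu\nu,\rho}$. The field equations and constraints are $$\nabla^2\varphi_{\mu\nu,\rho}-\nabla_\mu\nabla^\lambda\varphi_{\lambda\nu,\rho}-\nabla_\nu\nabla^\lambda\varphi_{\lambda\mu,\rho}+\tfrac12(\nabla_\mu\nabla_\nu+\nabla_\nu\nabla_\mu)\varphi_\rho+3\varphi_{\mu\nu,\rho}-(2g_{\mu\nu}\varphi_\rho-g_{\mu\rho}\varphi_\nu-g_{\nu\rho}\varphi_\mu)=0,$$ $$2\nabla^\lambda\varphi_{\mu\nu,\lambda}+\nabla_\mu\varphi_\nu+\nabla_\nu\varphi_\mu=0,\qquad \nabla^\lambda\varphi_\lambda=0,$$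 and the radial gauge is $\varphi_{0\mu,\nu}-\varphi_{0\nu,\mu}=0$. Fix a momentum $\mathbf k\in\mathbb R^d$, $\mathbf k\ne0$, $k=|\mathbf k|$, and a complex tensor $\pi_{ij,l}$ ($i,j,l=1,\dots,d$) of hook symmetry with $\delta^{ij}\pi_{ij,l}=0$. For $\epsilon>0$ the Dirichlet problem is to find a Fourier mode $e^{i\mathbf k\cdot\mathbf x}\varphi_{\mu\nu,\rho}(z)$ of a hook field in the radial gauge, defined for $z\ge\epsilon$, continuous on $[\epsilon,\infty)$ and $C^2$ on $(\epsilon,\infty)$, which satisfies the field equations and constraints for $z>\epsilon$, does not grow exponentially ($\varphi_{\mu\nu,\rho}(z)=o(e^{\eta z})$ as $z\to\infty$ for every $\eta>0$), and has $\varphi_{ij,l}(\epsilon)=\pi_{ij,l}$. Indices $i,j,l,m,n$ are contracted with $\delta$. Write $\varphi_{ij}=\varphi_{ij,0}$, $\varphi_0=\delta^{ij}\varphi_{ij}$ and (rescaled by $z^{2}$ from here on) $\varphi_l=\delta^{ij}\varphi_{ij,l}$. Let $K_\nu$ be the modified Bessel function of the second kind, $\mathcal K_\nu(u)=u^\nu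 K_\nu(u)$, $W(u)=(2\mathcal K_\nu(u)-\mathcal K_{\nu+1}(u))/\mathcal K_\nu(u)$. Put $L_{ij}=k^m\pi_{ij,m}$, $L_i=k^mk^n\pi_{mn,i}$, $S_{ij}=k_iL_j+k_jL_i$, $Y_{ij}=k_iL_j-k_jL_i$, $T_{ij}=k^m\pi_{mi,j}-k^m\pi_{mj,i}$, $M_{ij}=2L_{ij}+S_{ij}/k^2$, $M_{ij,l}=2k_ik_jL_l-k_ik_lL_j-k_jk_lL_i$, $Z_{ij,l}=2\delta_{ij}L_l-\delta_{il}L_j-\delta_{jl}L_i$, $\Pi_{ij}=\delta_{ij}-k_ik_j/k^2$, $a=\epsilon^3/(4(d-2))$. For a hook tensor $\psi_{ij,l}$ with trace $\psi_l=\delta^{ij}\psi_{ij,l}$ and $X_l=\psi_l-k^{-2}k^mk^n\psi_{mn,l}-k^{-2}k_lk^m\psi_m$ let $$\bar\psi_{ij,l}=\psi_{ij,l}-\tfrac1{k^2}(k_ik^m\psi_{mj,l}+k_jk^m\psi_{mi,l}+k_lk^m\psi_{ij,m})+\tfrac1{k^4}\big(k_ik_jk^mk^n\psi_{mn,l}-\tfrac12k_ik_lk^mk^n\psi_{mn,j}-\tfrac12k_jk_lk^mk^n\psi_{mn,i}\big)-\tfrac1{2(d-2)}(2\Pi_{ij}X_l-\Pi_{il}X_j-\Pi_{jl}X_i)$$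 be its transverse traceless (TT) part. **Claim.** (1) For every $\epsilon>0$ the Dirichlet problem has a solution, and it is unique on $[\epsilon,\infty)$ (all components). (2) $\bar\pi_{ij,l}$ has hook symmetry, $k^i\bar\pi_{ij,l}=0$, $k^l\bar\pi_{ij,l}=0$ and $\delta^{ij}\bar\pi_{ij,l}=0$. (3) For all $z\ge\epsilon$ the solution satisfies $$\varphi_0(z)=0,\qquad \varphi_i(z)=\frac{\epsilon^3}{4(d-2)}\Big[\frac1z-\frac{\epsilon^2}{z^3}\Big]L_i,$$ $$\varphi_{ij}(z)=-i\Big(\frac\epsilon z\Big)^2\frac{\epsilon}{W(\epsilon k)}\frac{\mathcal K_\nu(zk)}{\mathcal K_\nu(\epsilon k)}\Big(L_{ij}+\frac{S_{ij}}{2k^2}\Big)-\frac{i\epsilon}{2(d-2)}\Big(\frac\epsilon z\Big)^2\frac{S_{ij}}{k^2},$$ $$\varphi_{ij,l}(z)=\Big(\frac\epsilon z\Big)^3\frac{\mathcal K_\nu(zk)}{\mathcal K_\nu(\epsilon k)}\bar\pi_{ij,l}+\frac1{k^2}\big(k_ik^m\varphi_{mj,l}+k_jk^m\varphi_{mi,l}+k_lk^m\varphi_{ij,m}\big)(z)-\frac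 a{2k^2}\Big(\frac1z+\frac1{z^3}\Big(\frac{4(d-3)}{k^2}-\epsilon^2\Big)\Big)M_{ij,l}-\frac{2}{z^3}\frac a{k^2}Z_{ij,l},$$ where the divergences are given by $$k^m\varphi_{ij,m}(z)=\frac12\Big(\frac\epsilon z\Big)^3\frac{W(zk)}{W(\epsilon k)}\frac{\mathcal K_\nu(zk)}{\mathcal K_\nu(\epsilon k)}M_{ij}-a\Big[\frac{2(d-2)}{z^3k^2}-\frac{\epsilon^2}{2z^3}+\frac1{2z}\Big]S_{ij},$$ $$k^m\varphi_{mi,j}(z)-k^m\varphi_{mj,i}(z)=\Big(\frac\epsilon z\Big)^3T_{ij}+\frac{3a}2\Big(\frac1z-\frac{\epsilon^2}{z^3}\Big)Y_{ij},$$ $$k^m\varphi_{mi,j}=\tfrac12\big(k^m\varphi_{mi,j}-k^m\varphi_{mj,i}\big)-\tfrac12k^m\varphi_{ij,m}.$$ The TT part of the hook component is $\bar\varphi_{ij,l}(z)=(\epsilon/z)^3\,\dfrac{\mathcal K_\nu(zk)}{\mathcal K_\nu(\epsilon k)}\,\bar\pi_{ij,l}$. (4) At the boundary $z=\epsilon$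 the solution has, for every $\epsilon>0$, $\varphi_0(\epsilon)=0$, $\varphi_i(\epsilon)=0$ and $\varphi_{ij,l}(\epsilon)=\pi_{ij,l}$, while as $\epsilon\to0^+$ (with $\mathbf k,\pi$ fixed) $\varphi_{ij}(\epsilon)=\frac{i\epsilon}{d-2}k^m\pi_{ij,m}+o(\epsilon)\to0$. Thus only the hook component survives at the boundary. -/

import Mathlib

noncomputable section

namespace HookAdS

/-! ### Tensor calculus on the Euclidean anti-de Sitter half-space

The coordinates of a point `x` are `x 0 = z` and `x (Fin.succ i)`, `i : Fin d`; the metric is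
`g = (dz² + dx¹² + ⋯ + dxᵈ²) / z²`.  All tensors are covariant and complex valued, and are given by
their components in these coordinates. -/

/-- Coordinates `(z, x¹, …, xᵈ)`. -/
abbrev Point (d : ℕ) := Fin (d + 1) → ℝ

/-- Kronecker's delta. -/
def delta {n : ℕ} (a b : Fin n) : ℝ := if a = b then 1 else 0

/-- The metric `g_{μν} = δ_{μν} / z²`. -/
def metric {d : ℕ} (x : Point d) (μ ν : Fin (d + 1)) : ℝ := delta μ ν / x 0 ^ 2

/-- The inverse metric `g^{μν} = z² δ_{μν}`. -/
def invMetric {d : ℕ} (x : Point d) (μ ν : Fin (d + 1)) : ℝ := x 0 ^ 2 * delta μ ν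

/-- The Christoffel symbols `Γ^ρ_{μν}` of the metric `g_{μν} = δ_{μν} / z²`. -/
def christoffel {d : ℕ} (x : Point d) (ρ μ ν : Fin (d + 1)) : ℝ :=
  -(1 / x 0) * (delta 0 μ * delta ν ρ + delta 0 ν * delta μ ρ - delta 0 ρ * delta μ ν)

/-- The partial derivative `∂_μ f`. -/
def pd {d : ℕ} (μ : Fin (d + 1)) (f : Point d → ℂ) (x : Point d) : ℂ :=
  deriv (fun t : ℝ => f (Function.update x μ t)) (x μ)

/-- `∇_μ T_ν`. -/
def nabla1 {d : ℕ} (T : Fin (d + 1) → Point d → ℂ) (μ ν : Fin (d + 1)) (x : Point d) : ℂ :=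
  pd μ (T ν) x - ∑ σ, (christoffel x σ μ ν : ℂ) * T σ x

/-- `∇_μ T_{νρ}`. -/
def nabla2 {d : ℕ} (T : Fin (d + 1) → Fin (d + 1) → Point d → ℂ)
    (μ ν ρ : Fin (d + 1)) (x : Point d) : ℂ :=
  pd μ (T ν ρ) x - ∑ σ, ((christoffel x σ μ ν : ℂ) * T σ ρ x + (christoffel x σ μ ρ : ℂ) * T ν σ x)

/-- `∇_μ T_{νρτ}`. -/
def nabla3 {d : ℕ} (T : Fin (d + 1) → Fin (d + 1) → Fin (d + 1) → Point d → ℂ)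
    (μ ν ρ τ : Fin (d + 1)) (x : Point d) : ℂ :=
  pd μ (T ν ρ τ) x - ∑ σ, ((christoffel x σ μ ν : ℂ) * T σ ρ τ x
    + (christoffel x σ μ ρ : ℂ) * T ν σ τ x + (christoffel x σ μ τ : ℂ) * T ν ρ σ x)

/-- `∇_μ T_{νρτκ}`. -/
def nabla4 {d : ℕ} (T : Fin (d + 1) → Fin (d + 1) → Fin (d + 1) → Fin (d + 1) → Point d → ℂ)
    (μ ν ρ τ κ : Fin (d + 1)) (x : Point d) : ℂ :=
  pd μ (T ν ρ τ κ) x - ∑ σ, ((christoffel x σ μ ν : ℂ) * T σ ρ τ κ x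
    + (christoffel x σ μ ρ : ℂ) * T ν σ τ κ x + (christoffel x σ μ τ : ℂ) * T ν ρ σ κ x
    + (christoffel x σ μ κ : ℂ) * T ν ρ τ σ x)

/-! ### Field equations and constraints of the hook field -/

/-- A rank three tensor field `φ_{μν,ρ}`. -/
abbrev Field (d : ℕ) := Fin (d + 1) → Fin (d + 1) → Fin (d + 1) → Point d → ℂ

/-- The trace `φ_ρ = g^{μν} φ_{μν,ρ}`. -/
def fieldTrace {d : ℕ} (φ : Field d) (ρ : Fin (d + 1)) (x : Point d) : ℂ :=
  ∑ μ, ∑ ν, (invMetric x μ ν : ℂ) * φ μ ν ρ x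

/-- The divergence `∇^α φ_{αν,ρ}`. -/
def divFirst {d : ℕ} (φ : Field d) (ν ρ : Fin (d + 1)) (x : Point d) : ℂ :=
  ∑ α, ∑ β, (invMetric x α β : ℂ) * nabla3 φ β α ν ρ x

/-- The divergence `∇^α φ_{μν,α}`. -/
def divLast {d : ℕ} (φ : Field d) (μ ν : Fin (d + 1)) (x : Point d) : ℂ :=
  ∑ α, ∑ β, (invMetric x α β : ℂ) * nabla3 φ β μ ν α x

/-- The Laplacian `∇² φ_{μν,ρ} = g^{αβ} ∇_α ∇_β φ_{μν,ρ}`. -/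
def laplacian {d : ℕ} (φ : Field d) (μ ν ρ : Fin (d + 1)) (x : Point d) : ℂ :=
  ∑ α, ∑ β, (invMetric x α β : ℂ) * nabla4 (nabla3 φ) α β μ ν ρ x

/-- The left-hand side of the field equations of the massless hook field
(anti-de Sitter radius one). -/
def fieldEq {d : ℕ} (φ : Field d) (μ ν ρ : Fin (d + 1)) (x : Point d) : ℂ :=
  laplacian φ μ ν ρ x
    - nabla2 (divFirst φ) μ ν ρ x - nabla2 (divFirst φ) ν μ ρ x
    + 1 / 2 * nabla2 (nabla1 (fieldTrace φ)) μ ν ρ x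
    + 1 / 2 * nabla2 (nabla1 (fieldTrace φ)) ν μ ρ x
    + 3 * φ μ ν ρ x
    - (2 * (metric x μ ν : ℂ) * fieldTrace φ ρ x - (metric x μ ρ : ℂ) * fieldTrace φ ν x
        - (metric x ν ρ : ℂ) * fieldTrace φ μ x)

/-- The constraint `2 ∇^α φ_{μν,α} + ∇_μ φ_ν + ∇_ν φ_μ`. -/
def constraintTensor {d : ℕ} (φ : Field d) (μ ν : Fin (d + 1)) (x : Point d) : ℂ :=
  2 * divLast φ μ ν x + nabla1 (fieldTrace φ) μ ν x + nabla1 (fieldTrace φ) ν μ x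

/-- The constraint `∇^α φ_α`. -/
def constraintScalar {d : ℕ} (φ : Field d) (x : Point d) : ℂ :=
  ∑ α, ∑ β, (invMetric x α β : ℂ) * nabla1 (fieldTrace φ) β α x

/-! ### Fourier modes and the Dirichlet problem -/

/-- The components, as functions of `z`, of a Fourier mode of a rank three tensor field. -/
abbrev Mode (d : ℕ) := Fin (d + 1) → Fin (d + 1) → Fin (d + 1) → ℝ → ℂ

/-- The tensor field `φ_{μν,ρ}(z, x) = exp(i k·x) Φ_{μν,ρ}(z)`, so that `∂_m` acts as `i k_m`. -/
def planeWave {d : ℕ} (k : EuclideanSpace ℝ (Fin d)) (Φ : Mode d) : Field d := fun μ ν ρ x =>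
  Complex.exp (Complex.I * ∑ m, (k m : ℂ) * (x m.succ : ℂ)) * Φ μ ν ρ (x 0)

/-- A rank three boundary tensor `π_{ij,k}` (at a fixed momentum). -/
abbrev BTensor (d : ℕ) := Fin d → Fin d → Fin d → ℂ

/-- Hook symmetry and vanishing trace of a boundary tensor. -/
structure IsTracelessHook {d : ℕ} (π : BTensor d) : Prop where
  symm : ∀ i j l, π i j l = π j i l
  young : ∀ i j l, π i j l + π i l j + π l j i = 0
  traceless : ∀ l, ∑ i, π i i l = 0

/-- `Φ` is the mode of momentum `k` of a hook field in the radial gauge which is defined for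
`z ≥ ε`, solves the field equations and the constraints for `z > ε`, does not grow exponentially
as `z → ∞`, and has hook component `π` at the boundary `z = ε`. -/
structure IsDirichletSolution {d : ℕ} (ε : ℝ) (k : EuclideanSpace ℝ (Fin d)) (π : BTensor d)
    (Φ : Mode d) : Prop where
  contDiffOn : ∀ μ ν ρ, ContDiffOn ℝ 2 (Φ μ ν ρ) (Set.Ioi ε)
  continuousOn : ∀ μ ν ρ, ContinuousOn (Φ μ ν ρ) (Set.Ici ε)
  symm : ∀ z, ε ≤ z → ∀ μ ν ρ, Φ μ ν ρ z = Φ ν μ ρ z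
  young : ∀ z, ε ≤ z → ∀ μ ν ρ, Φ μ ν ρ z + Φ μ ρ ν z + Φ ρ ν μ z = 0
  radialGauge : ∀ z, ε ≤ z → ∀ μ ν, Φ 0 μ ν z - Φ 0 ν μ z = 0
  field_eq : ∀ x : Point d, ε < x 0 → ∀ μ ν ρ, fieldEq (planeWave k Φ) μ ν ρ x = 0
  constraint_tensor : ∀ x : Point d, ε < x 0 → ∀ μ ν, constraintTensor (planeWave k Φ) μ ν x = 0
  constraint_scalar : ∀ x : Point d, ε < x 0 → constraintScalar (planeWave k Φ) x = 0
  regular : ∀ μ ν ρ, ∀ η : ℝ, 0 < η →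
    (Φ μ ν ρ) =o[Filter.atTop] (fun z : ℝ => Real.exp (η * z))
  boundary : ∀ i j l : Fin d, Φ i.succ j.succ l.succ ε = π i j l

/-- The hook component `φ_{ij,l}` of a mode. -/
def hookPart {d : ℕ} (Φ : Mode d) (z : ℝ) : BTensor d := fun i j l => Φ i.succ j.succ l.succ z

/-- The symmetric component `φ_{ij} = φ_{ij,0}` of a mode. -/
def symPart {d : ℕ} (Φ : Mode d) (z : ℝ) (i j : Fin d) : ℂ := Φ i.succ j.succ 0 z

/-- The (rescaled) vector trace `φ_l = δ^{ij} φ_{ij,l}` of a mode. -/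
def vecTrace {d : ℕ} (Φ : Mode d) (z : ℝ) (l : Fin d) : ℂ := ∑ i, hookPart Φ z i i l

/-- The (rescaled) scalar trace `φ_0 = δ^{ij} φ_{ij,0}` of a mode. -/
def scalarTrace {d : ℕ} (Φ : Mode d) (z : ℝ) : ℂ := ∑ i, symPart Φ z i i

/-! ### Modified Bessel functions of the second kind -/

/-- The modified Bessel function `K_ν(u) = ∫_0^∞ exp(-u cosh t) cosh(ν t) dt`, `u > 0`. -/
def besselK (ν u : ℝ) : ℝ :=
  ∫ t in Set.Ioi (0 : ℝ), Real.exp (-u * Real.cosh t) * Real.cosh (ν * t)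

/-- `𝒦_ν(u) = u^ν K_ν(u)`. -/
def calK (ν u : ℝ) : ℝ := u ^ ν * besselK ν u

/-- `W(u) = (2 𝒦_ν(u) - 𝒦_{ν+1}(u)) / 𝒦_ν(u)`. -/
def besselW (ν u : ℝ) : ℝ := (2 * calK ν u - calK (ν + 1) u) / calK ν u

/-! ### Tensors built from a momentum `k` and a rank three boundary tensor -/

section Boundary

variable {d : ℕ} (k : EuclideanSpace ℝ (Fin d)) (π : BTensor d)

/-- `k^m π_{mi,j}`. -/
def divA (i j : Fin d) : ℂ := ∑ m, (k m : ℂ) * π m i j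

/-- `L_{ij} = k^m π_{ij,m}`. -/
def divB (i j : Fin d) : ℂ := ∑ m, (k m : ℂ) * π i j m

/-- `L_i = k^m k^n π_{mn,i}`. -/
def divL (i : Fin d) : ℂ := ∑ m, ∑ n, (k m : ℂ) * (k n : ℂ) * π m n i

/-- `S_{ij} = k_i L_j + k_j L_i`. -/
def tensS (i j : Fin d) : ℂ := (k i : ℂ) * divL k π j + (k j : ℂ) * divL k π i

/-- `Y_{ij} = k_i L_j - k_j L_i`. -/
def tensY (i j : Fin d) : ℂ := (k i : ℂ) * divL k π j - (k j : ℂ) * divL k π i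

/-- `T_{ij} = k^m π_{mi,j} - k^m π_{mj,i}`. -/
def tensT (i j : Fin d) : ℂ := divA k π i j - divA k π j i

/-- `M_{ij} = 2 L_{ij} + S_{ij} / k²`. -/
def tensM2 (i j : Fin d) : ℂ := 2 * divB k π i j + tensS k π i j / (‖k‖ : ℂ) ^ 2

/-- `M_{ij,l} = 2 k_i k_j L_l - k_i k_l L_j - k_j k_l L_i`. -/
def tensM3 (i j l : Fin d) : ℂ :=
  2 * (k i : ℂ) * (k j : ℂ) * divL k π l - (k i : ℂ) * (k l : ℂ) * divL k π j
    - (k j : ℂ) * (k l : ℂ) * divL k π i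

/-- `Z_{ij,l} = 2 δ_{ij} L_l - δ_{il} L_j - δ_{jl} L_i`. -/
def tensZ (i j l : Fin d) : ℂ :=
  2 * (delta i j : ℂ) * divL k π l - (delta i l : ℂ) * divL k π j - (delta j l : ℂ) * divL k π i

/-- The projector `Π_{ij} = δ_{ij} - k_i k_j / k²`. -/
def proj (i j : Fin d) : ℂ := (delta i j : ℂ) - (k i : ℂ) * (k j : ℂ) / (‖k‖ : ℂ) ^ 2

/-- `π_l - L_l / k² - k_l (k^m π_m) / k²`, where `π_l = δ^{ij} π_{ij,l}` is the trace. -/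
def auxX (l : Fin d) : ℂ :=
  ∑ i, π i i l - divL k π l / (‖k‖ : ℂ) ^ 2
    - (k l : ℂ) / (‖k‖ : ℂ) ^ 2 * ∑ m, (k m : ℂ) * ∑ i, π i i m

/-- The transverse and traceless part `π̄_{ij,l}` of a tensor `π_{ij,l}` of hook symmetry. -/
def hookTT (i j l : Fin d) : ℂ :=
  π i j l
    - 1 / (‖k‖ : ℂ) ^ 2 *
      ((k i : ℂ) * divA k π j l + (k j : ℂ) * divA k π i l + (k l : ℂ) * divB k π i j)
    + 1 / (‖k‖ : ℂ) ^ 4 *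
      ((k i : ℂ) * (k j : ℂ) * divL k π l - 1 / 2 * ((k i : ℂ) * (k l : ℂ) * divL k π j)
        - 1 / 2 * ((k j : ℂ) * (k l : ℂ) * divL k π i))
    - 1 / (2 * ((d : ℂ) - 2)) *
      (2 * proj k i j * auxX k π l - proj k i l * auxX k π j - proj k j l * auxX k π i)

end Boundary

end HookAdS

end

/-! In the orthonormal frame a rank `n` plane wave has amplitude `z ^ n` times its coordinate
components, and the covariant derivative acts on amplitudes as `θ = z ∂_z` or as multiplication by
`i z k_m`, plus a connection term with constant coefficients. The equations thus become ordinary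
differential equations in `z` (`fieldEq_framed`, `constraintTensor_framed`,
`constraintScalar_framed`). Hook symmetry and the radial gauge leave only `A_{ij,l}` (the hook part)
and the symmetric `B_{ij}` (`IsDirichletSolution.eq_coordMode`).

The resulting system is triangular. The `00` constraint makes `tr B` proportional to `z`, and the
scalar constraint with the traceless boundary data kills it. The `0i` constraint gives `θ tr A = div
B`, and the `00,i` equation then forces `div B = 2 c z²`, hence `tr A = c (z² - ε²)`. Once the `ij`
constraint has eliminated the divergence of `A` in its last index, the `ij,0` equation is a Bessel
equation for `B / z` with source proportional to `z²`, so `B = z (F β + s)` with `F = 𝒦_ν(zk) /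
𝒦_ν(εk)`. The `ij` constraint, read at `z = ε`, ties `β` and `s` to the boundary data: its
contraction with `k` fixes `c`, and the rest fixes `β` because `W < 0`. The antisymmetric part of
the `0i,j` equation integrates to the remaining divergence. At that stage the `ij,l` equation is,
component by component, an inhomogeneous Bessel equation with known source.

The Bessel operator `θ² - d θ - k² z²` is controlled by two facts. A maximum principle against `δ
exp(κ z / 2)` gives uniqueness among functions without exponential growth (`bessel_eq_zero`). The
functions `F`, `H = (2 𝒦_ν - 𝒦_{ν+1})(zk) / 𝒦_ν(εk)`, `z²` and `1` yield exactly the sources that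
occur (`bessel_operator_profile`), which gives explicit solutions.

The predicate `IsReduced` records the values found for the traces, the divergences and `B`. Under it
all other field equations hold identically and the `ij,l` equation is the scalar Bessel equation
(`IsReduced.frameEq_sss`). The same computation serves existence, where the explicit pair `solA`,
`solB` is shown to be reduced, and uniqueness, where every solution is. The closed formulas follow
by inverting the transverse traceless projection, and the cutoff limit from `W(u) → 2 - d` as `u →
0`. -/

noncomputable section

namespace HookAdS

open MeasureTheory Set Filter Topology

/-! ### The modified Bessel function of the second kind -/

/-- The integrand of `besselK`. -/
def besselIntegrand (ν u t : ℝ) : ℝ := Real.exp (-u * Real.cosh t) * Real.cosh (ν * t)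

theorem continuous_besselIntegrand (ν u : ℝ) : Continuous (besselIntegrand ν u) := by
  unfold besselIntegrand; fun_prop

theorem sq_le_four_mul_cosh (t : ℝ) : t ^ 2 ≤ 4 * Real.cosh t := by
  rw [← Real.cosh_abs, Real.cosh_eq, ← sq_abs]
  have h := Real.quadratic_le_exp_of_nonneg (abs_nonneg t)
  have := Real.exp_pos (-|t|)
  have := abs_nonneg t
  linarith

theorem besselIntegrand_pos (ν u t : ℝ) : 0 < besselIntegrand ν u t :=
  mul_pos (Real.exp_pos _) (Real.cosh_pos _)

/-- Since `u cosh t ≥ u t² / 4`, the quadratic beats the linear exponent `(|ν| + 1) t` up to the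
constant `(|ν| + 1)² / u`; the spare `1` leaves an integrable factor `exp (-t)`. -/
theorem exp_mul_exp_le_exp_neg (ν : ℝ) {u : ℝ} (t : ℝ) (hu : 0 < u) :
    Real.exp (-u * Real.cosh t) * Real.exp (|ν| * t)
      ≤ Real.exp ((|ν| + 1) ^ 2 / u) * Real.exp (-1 * t) := by
  rw [← Real.exp_add, ← Real.exp_add, Real.exp_le_exp]
  have h := sq_le_four_mul_cosh t
  have h2 : (|ν| + 1) * t ≤ (|ν| + 1) ^ 2 / u + u * (t ^ 2 / 4) := by
    have : (|ν| + 1) ^ 2 / u + u * (t ^ 2 / 4) - (|ν| + 1) * t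
        = ((|ν| + 1) - u * t / 2) ^ 2 / u := by field_simp; ring
    have h3 : 0 ≤ ((|ν| + 1) - u * t / 2) ^ 2 / u := by positivity
    linarith
  nlinarith

theorem cosh_mul_le_exp (ν : ℝ) {t : ℝ} (ht : 0 ≤ t) :
    Real.cosh (ν * t) ≤ Real.exp (|ν| * t) := by
  rw [← Real.cosh_abs, abs_mul, abs_of_nonneg ht, Real.cosh_eq]
  have : Real.exp (-(|ν| * t)) ≤ Real.exp (|ν| * t) :=
    Real.exp_le_exp.2 (by have := mul_nonneg (abs_nonneg ν) ht; linarith)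
  linarith

theorem besselIntegrand_le (ν : ℝ) {u t : ℝ} (hu : 0 < u) (ht : 0 ≤ t) :
    besselIntegrand ν u t ≤ Real.exp ((|ν| + 1) ^ 2 / u) * Real.exp (-1 * t) :=
  (mul_le_mul_of_nonneg_left (cosh_mul_le_exp ν ht) (Real.exp_pos _).le).trans
    (exp_mul_exp_le_exp_neg ν t hu)

theorem integrableOn_besselIntegrand (ν : ℝ) {u : ℝ} (hu : 0 < u) :
    IntegrableOn (besselIntegrand ν u) (Ioi 0) := by
  refine integrable_of_isBigO_exp_neg one_pos (continuous_besselIntegrand ν u).continuousOn ?_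
  refine Asymptotics.IsBigO.of_bound (Real.exp ((|ν| + 1) ^ 2 / u)) ?_
  filter_upwards [eventually_ge_atTop 0] with t ht
  rw [Real.norm_of_nonneg (besselIntegrand_pos ν u t).le, Real.norm_of_nonneg (Real.exp_pos _).le]
  exact besselIntegrand_le ν hu ht

theorem besselK_def (ν u : ℝ) : besselK ν u = ∫ t in Ioi (0 : ℝ), besselIntegrand ν u t := rfl

theorem besselK_pos (ν : ℝ) {u : ℝ} (hu : 0 < u) : 0 < besselK ν u := by
  rw [besselK_def, integral_pos_iff_support_of_nonneg
    (fun t => (besselIntegrand_pos ν u t).le) (integrableOn_besselIntegrand ν hu)]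
  have : Function.support (besselIntegrand ν u) = univ := by
    ext t; simp [(besselIntegrand_pos ν u t).ne']
  rw [this]
  simp

theorem besselK_le_of_abs_le {μ ν u : ℝ} (h : |μ| ≤ |ν|) (hu : 0 < u) :
    besselK μ u ≤ besselK ν u := by
  refine setIntegral_mono_on (integrableOn_besselIntegrand μ hu)
    (integrableOn_besselIntegrand ν hu) measurableSet_Ioi fun t ht => ?_
  refine mul_le_mul_of_nonneg_left ?_ (Real.exp_pos _).le
  rw [Real.cosh_le_cosh, abs_mul, abs_mul]
  exact mul_le_mul_of_nonneg_right h (abs_nonneg t)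

theorem cosh_mul_besselIntegrand (ν u t : ℝ) :
    Real.cosh t * besselIntegrand ν u t
      = (besselIntegrand (ν + 1) u t + besselIntegrand (ν - 1) u t) / 2 := by
  unfold besselIntegrand
  rw [show (ν + 1) * t = ν * t + t by ring, show (ν - 1) * t = ν * t - t by ring,
    Real.cosh_add, Real.cosh_sub]
  ring

/-- Differentiation under the integral sign. The integrand decreases in the argument, so its
derivative at any `v > u / 2` is dominated by its value at `u / 2`; the factor `cosh t` shifts the
order by `± 1`. -/
theorem hasDerivAt_besselK (ν : ℝ) {u : ℝ} (hu : 0 < u) :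
    HasDerivAt (besselK ν) (-(besselK (ν + 1) u + besselK (ν - 1) u) / 2) u := by
  have key := hasDerivAt_integral_of_dominated_loc_of_deriv_le
    (μ := volume.restrict (Ioi (0 : ℝ))) (F := fun u t => besselIntegrand ν u t)
    (F' := fun u t => -(Real.cosh t * besselIntegrand ν u t)) (x₀ := u)
    (s := Ioi (u / 2))
    (bound := fun t => (besselIntegrand (ν + 1) (u / 2) t + besselIntegrand (ν - 1) (u / 2) t) / 2)
    (Ioi_mem_nhds (by linarith))
    (Eventually.of_forall fun v => (continuous_besselIntegrand ν v).aestronglyMeasurable)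
    (integrableOn_besselIntegrand ν hu)
    ((Real.continuous_cosh.mul (continuous_besselIntegrand ν u)).neg.aestronglyMeasurable)
    (Eventually.of_forall fun t v hv => by
      rw [norm_neg, Real.norm_of_nonneg
        (mul_nonneg (Real.cosh_pos t).le (besselIntegrand_pos ν v t).le),
        ← cosh_mul_besselIntegrand]
      refine mul_le_mul_of_nonneg_left ?_ (Real.cosh_pos t).le
      refine mul_le_mul_of_nonneg_right ?_ (Real.cosh_pos _).le
      rw [Real.exp_le_exp]
      have := Real.cosh_pos t
      have hv' : u / 2 < v := hv
      nlinarith)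
    (((integrableOn_besselIntegrand (ν + 1) (half_pos hu)).add
      (integrableOn_besselIntegrand (ν - 1) (half_pos hu))).div_const 2)
    (Eventually.of_forall fun t v _ => by
      unfold besselIntegrand
      have h := (((hasDerivAt_id v).neg.mul_const (Real.cosh t)).exp).mul_const (Real.cosh (ν * t))
      exact h.congr_deriv (by simp; ring))
  refine key.2.congr_deriv ?_
  simp_rw [cosh_mul_besselIntegrand]
  rw [integral_neg, integral_div, integral_add (integrableOn_besselIntegrand (ν + 1) hu)
    (integrableOn_besselIntegrand (ν - 1) hu)]
  simp only [besselK_def]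
  ring

/-- Integration of a total derivative: `exp (-u cosh t) sinh (ν t)` vanishes at `0` and at infinity,
and the product formulas turn its derivative into the three Bessel integrands. -/
theorem besselK_recurrence (ν : ℝ) {u : ℝ} (hu : 0 < u) :
    u * (besselK (ν + 1) u - besselK (ν - 1) u) = 2 * ν * besselK ν u := by
  have hF : ∀ t ∈ Ici (0 : ℝ), HasDerivAt
      (fun t => Real.exp (-u * Real.cosh t) * Real.sinh (ν * t))
      (ν * besselIntegrand ν u t
        - u / 2 * (besselIntegrand (ν + 1) u t - besselIntegrand (ν - 1) u t)) t := by
    intro t _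
    have h1 := ((Real.hasDerivAt_cosh t).const_mul (-u)).exp
    have h2 := ((hasDerivAt_id t).const_mul ν).sinh
    refine (h1.mul h2).congr_deriv ?_
    unfold besselIntegrand
    rw [show (ν + 1) * t = ν * t + t by ring, show (ν - 1) * t = ν * t - t by ring,
      Real.cosh_add, Real.cosh_sub]
    simp only [id]
    ring
  have hD : IntegrableOn (fun t => u / 2 *
      (besselIntegrand (ν + 1) u t - besselIntegrand (ν - 1) u t)) (Ioi 0) :=
    ((integrableOn_besselIntegrand (ν + 1) hu).sub
      (integrableOn_besselIntegrand (ν - 1) hu)).const_mul (u / 2)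
  have hN : IntegrableOn (fun t => ν * besselIntegrand ν u t) (Ioi 0) :=
    (integrableOn_besselIntegrand ν hu).const_mul ν
  have hlim : Tendsto (fun t => Real.exp (-u * Real.cosh t) * Real.sinh (ν * t)) atTop (𝓝 0) := by
    have h0 : Tendsto (fun t : ℝ => Real.exp ((|ν| + 1) ^ 2 / u) * Real.exp (-1 * t)) atTop
        (𝓝 0) := by
      have := (Real.tendsto_exp_neg_atTop_nhds_zero).const_mul (Real.exp ((|ν| + 1) ^ 2 / u))
      simpa using this
    refine squeeze_zero_norm' ?_ h0
    filter_upwards [eventually_ge_atTop 0] with t ht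
    refine le_trans ?_ (besselIntegrand_le ν hu ht)
    rw [norm_mul, Real.norm_of_nonneg (Real.exp_pos _).le, Real.norm_eq_abs]
    refine mul_le_mul_of_nonneg_left ?_ (Real.exp_pos _).le
    rw [Real.abs_sinh, ← Real.cosh_abs]
    exact (Real.sinh_lt_cosh _).le
  have h := integral_Ioi_of_hasDerivAt_of_tendsto' hF (hN.sub hD) hlim
  rw [integral_sub hN hD,
    integral_const_mul, integral_const_mul,
    integral_sub (integrableOn_besselIntegrand (ν + 1) hu)
      (integrableOn_besselIntegrand (ν - 1) hu)] at h
  simp only [← besselK_def, mul_zero, Real.sinh_zero, sub_zero] at h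
  linarith

theorem contDiffOn_besselK (n : ℕ) (ν : ℝ) : ContDiffOn ℝ n (besselK ν) (Ioi 0) := by
  induction n generalizing ν with
  | zero =>
    exact contDiffOn_zero.2 fun u hu => (hasDerivAt_besselK ν hu).continuousAt.continuousWithinAt
  | succ n ih =>
    rw [show ((n + 1 : ℕ) : WithTop ℕ∞) = (n : WithTop ℕ∞) + 1 by norm_cast,
      contDiffOn_succ_iff_deriv_of_isOpen isOpen_Ioi]
    refine ⟨fun u hu => (hasDerivAt_besselK ν hu).differentiableAt.differentiableWithinAt,
      by simp, ?_⟩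
    refine ContDiffOn.congr (((ih (ν + 1)).add (ih (ν - 1))).neg.div_const 2) fun u hu => ?_
    exact (hasDerivAt_besselK ν hu).deriv

theorem calK_pos (ν : ℝ) {u : ℝ} (hu : 0 < u) : 0 < calK ν u :=
  mul_pos (Real.rpow_pos_of_pos hu ν) (besselK_pos ν hu)

theorem contDiffOn_calK (n : ℕ) (ν : ℝ) : ContDiffOn ℝ n (calK ν) (Ioi 0) :=
  (contDiffOn_id.rpow_const_of_ne fun _ hx => (ne_of_gt hx)).mul (contDiffOn_besselK n ν)

/-- The prefactor `u ^ ν` is what removes the order `ν + 1` from the derivative: the recurrence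
cancels it against the derivative of the power. -/
theorem hasDerivAt_calK (ν : ℝ) {u : ℝ} (hu : 0 < u) :
    HasDerivAt (calK ν) (-(u * calK (ν - 1) u)) u := by
  have h := (Real.hasDerivAt_rpow_const (p := ν) (Or.inl hu.ne')).mul (hasDerivAt_besselK ν hu)
  refine h.congr_deriv ?_
  have h1 := besselK_recurrence ν hu
  have h2 : u ^ ν = u * u ^ (ν - 1) := by
    rw [Real.rpow_sub_one hu.ne']; field_simp
  unfold calK
  rw [h2]
  linear_combination (-1 / 2 * u ^ (ν - 1)) * h1

theorem calK_recurrence (ν : ℝ) {u : ℝ} (hu : 0 < u) :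
    calK (ν + 1) u = u ^ 2 * calK (ν - 1) u + 2 * ν * calK ν u := by
  have h1 := besselK_recurrence ν hu
  have h2 : u ^ ν = u * u ^ (ν - 1) := by
    rw [Real.rpow_sub_one hu.ne']; field_simp
  have h3 : u ^ (ν + 1) = u * u ^ ν := by
    rw [Real.rpow_add_one hu.ne']; ring
  unfold calK
  rw [h3, h2]
  linear_combination u * u ^ (ν - 1) * h1

/-- The derivative `-u 𝒦_{ν-1}` is negative. Monotonicity is all the asymptotic information that is
used: it bounds the Bessel profiles on `[ε, ∞)`. -/
theorem calK_le_of_le (ν : ℝ) {u v : ℝ} (hu : 0 < u) (huv : u ≤ v) : calK ν v ≤ calK ν u := by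
  have h : AntitoneOn (calK ν) (Ioi 0) := by
    refine antitoneOn_of_deriv_nonpos (convex_Ioi 0)
      (fun x hx => (hasDerivAt_calK ν hx).continuousAt.continuousWithinAt)
      (fun x hx => (hasDerivAt_calK ν (by simpa using hx)).differentiableAt.differentiableWithinAt)
      fun x hx => ?_
    have hx' : 0 < x := by simpa using hx
    rw [(hasDerivAt_calK ν hx').deriv]
    have := calK_pos (ν - 1) hx'
    have := mul_pos hx' this
    linarith
  exact h hu (lt_of_lt_of_le hu huv) huv

/-- This form shows both the sign of `W` for `ν ≥ 1` and, as `K_{ν-1} ≤ K_ν` there, its limit `2 -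
2ν` at `0`. -/
theorem besselW_eq (ν : ℝ) {u : ℝ} (hu : 0 < u) :
    besselW ν u = 2 - 2 * ν - u * (besselK (ν - 1) u / besselK ν u) := by
  have h2 : u ^ ν = u * u ^ (ν - 1) := by
    rw [Real.rpow_sub_one hu.ne']; field_simp
  have h3 := (Real.rpow_pos_of_pos hu (ν - 1)).ne'
  have h4 := (besselK_pos ν hu).ne'
  unfold besselW
  rw [calK_recurrence ν hu]
  unfold calK
  rw [h2]
  field_simp
  ring

theorem besselW_neg {ν u : ℝ} (hν : 1 ≤ ν) (hu : 0 < u) : besselW ν u < 0 := by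
  rw [besselW_eq ν hu]
  have := mul_pos hu (div_pos (besselK_pos (ν - 1) hu) (besselK_pos ν hu))
  linarith

theorem tendsto_besselW_zero {ν : ℝ} (hν : 1 ≤ ν) :
    Tendsto (besselW ν) (𝓝[>] 0) (𝓝 (2 - 2 * ν)) := by
  have h : Tendsto (fun u => u * (besselK (ν - 1) u / besselK ν u)) (𝓝[>] 0) (𝓝 0) := by
    refine squeeze_zero_norm' (a := fun u => u) ?_ (tendsto_id.mono_left nhdsWithin_le_nhds)
    filter_upwards [self_mem_nhdsWithin] with u hu
    have hu' : 0 < u := hu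
    have h0 := div_pos (besselK_pos (ν - 1) hu') (besselK_pos ν hu')
    rw [Real.norm_of_nonneg (mul_pos hu' h0).le]
    refine mul_le_of_le_one_right hu'.le ((div_le_one (besselK_pos ν hu')).2 ?_)
    refine besselK_le_of_abs_le ?_ hu'
    rw [abs_of_nonneg (by linarith), abs_of_nonneg (by linarith)]
    linarith
  have h' : Tendsto (fun u => 2 - 2 * ν - u * (besselK (ν - 1) u / besselK ν u)) (𝓝[>] 0)
      (𝓝 (2 - 2 * ν)) := by
    simpa using h.const_sub (2 - 2 * ν)
  refine h'.congr' ?_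
  filter_upwards [self_mem_nhdsWithin] with u hu
  exact (besselW_eq ν hu).symm

end HookAdS
end

noncomputable section

namespace HookAdS

open Set Filter Topology

/-! ### The operator `z ∂_z` -/

/-- The Euler operator `z ∂_z`. -/
def eulerD (f : ℝ → ℂ) (z : ℝ) : ℂ := z * deriv f z

theorem eulerD_eq {f : ℝ → ℂ} {f' : ℂ} {z : ℝ} (h : HasDerivAt f f' z) :
    eulerD f z = z * f' := by rw [eulerD, h.deriv]

theorem differentiableAt_of_contDiffOn {f : ℝ → ℂ} {ε z : ℝ} (hf : ContDiffOn ℝ 2 f (Ioi ε))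
    (hz : ε < z) : DifferentiableAt ℝ f z :=
  (hf.differentiableOn (by norm_num)).differentiableAt (Ioi_mem_nhds hz)

theorem contDiffOn_deriv {f : ℝ → ℂ} {ε : ℝ} (hf : ContDiffOn ℝ 2 f (Ioi ε)) :
    ContDiffOn ℝ 1 (deriv f) (Ioi ε) :=
  ((contDiffOn_succ_iff_deriv_of_isOpen (n := 1) isOpen_Ioi).1
    (by simpa [one_add_one_eq_two] using hf)).2.2

theorem differentiableAt_deriv {f : ℝ → ℂ} {ε z : ℝ} (hf : ContDiffOn ℝ 2 f (Ioi ε))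
    (hz : ε < z) : DifferentiableAt ℝ (deriv f) z :=
  ((contDiffOn_deriv hf).differentiableOn (by norm_num)).differentiableAt (Ioi_mem_nhds hz)

theorem hasDerivAt_ofReal (z : ℝ) : HasDerivAt (fun t : ℝ => (t : ℂ)) 1 z :=
  Complex.ofRealCLM.hasDerivAt

theorem differentiableAt_eulerD {f : ℝ → ℂ} {ε z : ℝ} (hf : ContDiffOn ℝ 2 f (Ioi ε))
    (hz : ε < z) : DifferentiableAt ℝ (eulerD f) z :=
  (hasDerivAt_ofReal z).differentiableAt.mul (differentiableAt_deriv hf hz)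

theorem eulerD_eulerD {f : ℝ → ℂ} {ε z : ℝ} (hf : ContDiffOn ℝ 2 f (Ioi ε)) (hz : ε < z) :
    eulerD (eulerD f) z = z * deriv f z + z ^ 2 * deriv (deriv f) z := by
  rw [eulerD_eq (f := eulerD f)
    ((hasDerivAt_ofReal z).mul (differentiableAt_deriv hf hz).hasDerivAt)]
  ring

theorem eulerD_congr {f g : ℝ → ℂ} {ε z : ℝ} (h : EqOn f g (Ioi ε)) (hz : ε < z) :
    eulerD f z = eulerD g z := by
  rw [eulerD, eulerD, (h.eventuallyEq_of_mem (Ioi_mem_nhds hz)).deriv_eq]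

/-- A continuous function on `[ε, ∞)` with vanishing derivative on `(ε, ∞)` is constant. -/
theorem eq_of_hasDerivAt_zero {f : ℝ → ℂ} {ε : ℝ} (hc : ContinuousOn f (Ici ε))
    (hd : ∀ z, ε < z → HasDerivAt f 0 z) {z : ℝ} (hz : ε ≤ z) : f z = f ε := by
  rcases hz.eq_or_lt with rfl | hz
  · rfl
  have h1 : Tendsto f (𝓝[>] ε) (𝓝 (f ε)) :=
    (hc ε self_mem_Ici).mono_left (nhdsWithin_mono _ Ioi_subset_Ici_self)
  refine tendsto_nhds_unique (tendsto_const_nhds.congr' ?_) h1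
  -- No derivative is assumed at `ε`, so constancy is obtained on `[a, z]` for `a > ε` and carried
  -- to `ε` by continuity.
  filter_upwards [Ioo_mem_nhdsGT hz] with a ha
  exact constant_of_has_deriv_right_zero
    (hc.mono (Icc_subset_Ici_self.trans (Ici_subset_Ici.2 ha.1.le)))
    (fun x hx => (hd x (ha.1.trans_le hx.1)).hasDerivWithinAt) z ⟨ha.2.le, le_rfl⟩

/-! ### A maximum principle for the modified Bessel operator -/

/-- Compare `y` with `δ exp (κ z / 2)`. A positive value of the difference forces an interior
positive maximum, where the equation makes the second derivative positive; then let `δ → 0`. -/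
theorem bessel_nonpos {d : ℕ} (hd : 1 ≤ d) {ε κ : ℝ} (hε : 0 < ε) (hκ : 0 < κ)
    {y y₁ y₂ : ℝ → ℝ} (hc : ContinuousOn y (Ici ε)) (h₁ : ∀ z, ε < z → HasDerivAt y (y₁ z) z)
    (h₂ : ∀ z, ε < z → HasDerivAt y₁ (y₂ z) z)
    (hode : ∀ z, ε < z → z ^ 2 * y₂ z + (1 - d) * z * y₁ z - κ ^ 2 * z ^ 2 * y z = 0)
    (h0 : y ε = 0) (hreg : ∀ η : ℝ, 0 < η → y =o[atTop] fun z : ℝ => Real.exp (η * z))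
    {z : ℝ} (hz : ε ≤ z) : y z ≤ 0 := by
  have key : ∀ δ : ℝ, 0 < δ → ∀ z, ε ≤ z → y z - δ * Real.exp (κ / 2 * z) ≤ 0 := by
    intro δ hδ z₁ hz₁
    by_contra! hpos
    set w : ℝ → ℝ := fun z => Real.exp (κ / 2 * z) with hw
    have hwd : ∀ z, HasDerivAt w (κ / 2 * w z) z := fun z => by
      have := ((hasDerivAt_id z).const_mul (κ / 2)).exp
      exact this.congr_deriv (by simp [hw]; ring)
    set g : ℝ → ℝ := fun z => y z - δ * w z with hg
    have hgc : ContinuousOn g (Ici ε) :=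
      hc.sub (continuousOn_const.mul fun z _ => (hwd z).continuousAt.continuousWithinAt)
    -- Slow growth makes the difference nonpositive far out, so its maximum over a compact interval
    -- containing `z₁` lies strictly inside.
    obtain ⟨R, hR⟩ := eventually_atTop.1 ((hreg (κ / 2) (by positivity)).bound hδ)
    set R' := max R (z₁ + 1)
    have hz₁R : z₁ < R' := lt_of_lt_of_le (by linarith) (le_max_right _ _)
    have hgR : g R' ≤ 0 := by
      have h := hR R' (le_max_left _ _)
      rw [Real.norm_of_nonneg (Real.exp_pos _).le] at h
      have := le_of_abs_le h
      simp only [hg, hw]; linarith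
    obtain ⟨z₀, hz₀, hmax⟩ := isCompact_Icc.exists_isMaxOn (s := Icc ε R')
      ⟨z₁, hz₁, hz₁R.le⟩ (hgc.mono Icc_subset_Ici_self)
    have hg0 : 0 < g z₀ := lt_of_lt_of_le hpos (hmax ⟨hz₁, hz₁R.le⟩)
    have hε₀ : ε < z₀ := by
      refine lt_of_le_of_ne hz₀.1 fun h => ?_
      rw [← h] at hg0
      simp only [hg, h0] at hg0
      have := mul_pos hδ (Real.exp_pos (κ / 2 * ε))
      simp only [hw] at hg0
      linarith
    have hR₀ : z₀ < R' := lt_of_le_of_ne hz₀.2 fun h => by rw [h] at hg0; linarith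
    have hlmax : IsLocalMax g z₀ := hmax.isLocalMax (Icc_mem_nhds hε₀ hR₀)
    have hg₁ : ∀ z, ε < z → HasDerivAt g (y₁ z - δ * (κ / 2 * w z)) z :=
      fun z hz => (h₁ z hz).sub ((hwd z).const_mul δ)
    have hdg : deriv g =ᶠ[𝓝 z₀] fun z => y₁ z - δ * (κ / 2 * w z) := by
      filter_upwards [Ioi_mem_nhds hε₀] with z hz using (hg₁ z hz).deriv
    have hg₂ : deriv (deriv g) z₀ = y₂ z₀ - δ * (κ / 2 * (κ / 2 * w z₀)) := by
      rw [hdg.deriv_eq]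
      exact ((h₂ z₀ hε₀).sub (((hwd z₀).const_mul (κ / 2)).const_mul δ)).deriv
    have hd0 : deriv g z₀ = 0 := hlmax.deriv_eq_zero
    have hy₁ : y₁ z₀ = δ * (κ / 2 * w z₀) := by
      have := (hg₁ z₀ hε₀).deriv
      linarith
    have hz₀p : 0 < z₀ := hε.trans hε₀
    have hwp : 0 < w z₀ := Real.exp_pos _
    have hd' : (1 : ℝ) ≤ d := by exact_mod_cast hd
    have hgp : δ * w z₀ < y z₀ := by simp only [hg] at hg0; linarith
    -- At the maximum `y' = δ (κ/2) w ≥ 0`, so the equation gives `y'' ≥ κ² y > κ² δ w`, more than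
    -- the `(κ/2)² δ w` that is subtracted.
    have hpos2 : 0 < deriv (deriv g) z₀ := by
      rw [hg₂]
      have ho := hode z₀ hε₀
      rw [hy₁] at ho
      have h3 : 0 ≤ (d - 1) * z₀ * (δ * (κ / 2 * w z₀)) := by
        have : (0 : ℝ) ≤ d - 1 := by linarith
        positivity
      have h4 : z₀ ^ 2 * (κ ^ 2 * y z₀) ≤ z₀ ^ 2 * y₂ z₀ := by linarith
      have h5 := le_of_mul_le_mul_left h4 (by positivity)
      have h6 : κ ^ 2 * (δ * w z₀) < κ ^ 2 * y z₀ := by gcongr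
      have h7 : 0 < κ ^ 2 * (δ * w z₀) := by positivity
      linarith
    have hlmin := isLocalMin_of_deriv_deriv_pos hpos2 hd0 (hg₁ z₀ hε₀).continuousAt
    -- A point that is both a local maximum and a local minimum makes `g` locally constant, against
    -- the positive second derivative.
    have hconst : g =ᶠ[𝓝 z₀] fun _ => g z₀ := by
      filter_upwards [hlmax, hlmin] with z ha hb using le_antisymm ha hb
    have : deriv (deriv g) z₀ = 0 := by
      rw [hconst.deriv.deriv_eq]; simp
    linarith
  refine le_of_forall_pos_le_add fun δ hδ => ?_
  have hp := Real.exp_pos (κ / 2 * z)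
  have h := key (δ / Real.exp (κ / 2 * z)) (by positivity) z hz
  rw [div_mul_cancel₀ _ hp.ne'] at h
  linarith

/-- The Dirichlet problem of the modified Bessel operator on `[ε, ∞)` has at most one solution
that does not grow exponentially. -/
theorem bessel_eq_zero {d : ℕ} (hd : 1 ≤ d) {ε κ : ℝ} (hε : 0 < ε) (hκ : 0 < κ)
    {y : ℝ → ℂ} (hc : ContinuousOn y (Ici ε)) (hy : ContDiffOn ℝ 2 y (Ioi ε))
    (hode : ∀ z, ε < z →
      eulerD (eulerD y) z - d * eulerD y z - (κ : ℂ) ^ 2 * (z : ℂ) ^ 2 * y z = 0)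
    (h0 : y ε = 0) (hreg : ∀ η : ℝ, 0 < η → y =o[atTop] fun z : ℝ => Real.exp (η * z))
    {z : ℝ} (hz : ε ≤ z) : y z = 0 := by
  -- The coefficients are real, so any real functional of `y` solves the same equation; `± Re` and
  -- `± Im` then give equality.
  have main : ∀ (L : ℂ →L[ℝ] ℝ) {z : ℝ}, ε ≤ z → L (y z) ≤ 0 := by
    intro L z hz
    refine bessel_nonpos hd hε hκ (y := fun z => L (y z)) (y₁ := fun z => L (deriv y z))
      (y₂ := fun z => L (deriv (deriv y) z)) (L.continuous.comp_continuousOn hc)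
      (fun z hz => ?_) (fun z hz => ?_) (fun z hz => ?_) ?_ (fun η hη => ?_) hz
    · exact L.hasFDerivAt.comp_hasDerivAt z (differentiableAt_of_contDiffOn hy hz).hasDerivAt
    · exact L.hasFDerivAt.comp_hasDerivAt z (differentiableAt_deriv hy hz).hasDerivAt
    · have h := hode z hz
      rw [eulerD_eulerD hy hz, eulerD] at h
      have h2 : (z ^ 2) • deriv (deriv y) z + ((1 - d) * z) • deriv y z - (κ ^ 2 * z ^ 2) • y z
          = 0 := by
        simp only [Complex.real_smul]; push_cast; rw [← h]; ring
      have h3 := congrArg L h2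
      simpa only [map_sub, map_add, map_smul, smul_eq_mul, map_zero] using h3
    · simp [h0]
    · exact (L.isBigO_comp y atTop).trans_isLittleO (hreg η hη)
  have h1 := main Complex.reCLM hz
  have h2 := main (-Complex.reCLM) hz
  have h3 := main Complex.imCLM hz
  have h4 := main (-Complex.imCLM) hz
  simp at h1 h2 h3 h4
  exact Complex.ext (le_antisymm h1 h2) (le_antisymm h3 h4)

end HookAdS
end

noncomputable section

namespace HookAdS

open Set Filter Topology

/-! ### Covariant derivatives of plane waves in the orthonormal frame -/

variable {d : ℕ}

@[simp] theorem delta_self {n : ℕ} (a : Fin n) : delta a a = 1 := by simp [delta]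

@[simp] theorem delta_zero_succ (i : Fin d) : delta (0 : Fin (d + 1)) i.succ = 0 := by
  simp [delta, (Fin.succ_ne_zero i).symm]

@[simp] theorem delta_succ_zero (i : Fin d) : delta i.succ (0 : Fin (d + 1)) = 0 := by
  simp [delta, Fin.succ_ne_zero i]

@[simp] theorem delta_succ_succ (i j : Fin d) : delta i.succ j.succ = delta i j := by
  simp [delta]

theorem delta_comm {n : ℕ} (i j : Fin n) : delta i j = delta j i := by
  simp [delta, eq_comm]

theorem sum_delta_mul {n : ℕ} (j : Fin n) (f : Fin n → ℂ) :
    ∑ i, (delta i j : ℂ) * f i = f j := by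
  simp [delta, Finset.sum_ite_eq', apply_ite]

theorem sum_delta_mul' {n : ℕ} (j : Fin n) (f : Fin n → ℂ) :
    ∑ i, (delta j i : ℂ) * f i = f j := by
  simp_rw [delta_comm j]; exact sum_delta_mul j f

/-- The plane wave factor `exp (i k·x)`. -/
def wave (k : EuclideanSpace ℝ (Fin d)) (x : Point d) : ℂ :=
  Complex.exp (Complex.I * ∑ m, (k m : ℂ) * (x m.succ : ℂ))

theorem wave_ne_zero (k : EuclideanSpace ℝ (Fin d)) (x : Point d) : wave k x ≠ 0 :=
  Complex.exp_ne_zero _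

/-- A component of a rank `n` plane wave, with amplitude `t` in the orthonormal frame. -/
def framed (k : EuclideanSpace ℝ (Fin d)) (n : ℕ) (t : ℝ → ℂ) (x : Point d) : ℂ :=
  wave k x * ((x 0 : ℂ) ^ n)⁻¹ * t (x 0)

/-- The derivative along the orthonormal frame of the amplitude of a plane wave. -/
def frameD (k : EuclideanSpace ℝ (Fin d)) (μ : Fin (d + 1)) (t : ℝ → ℂ) (z : ℝ) : ℂ :=
  Fin.cases (eulerD t z) (fun m => Complex.I * z * k m * t z) μ

@[simp] theorem frameD_zero (k : EuclideanSpace ℝ (Fin d)) (t : ℝ → ℂ) (z : ℝ) :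
    frameD k 0 t z = eulerD t z := rfl

@[simp] theorem frameD_succ (k : EuclideanSpace ℝ (Fin d)) (m : Fin d) (t : ℝ → ℂ) (z : ℝ) :
    frameD k m.succ t z = Complex.I * z * k m * t z := rfl

/-- The action of the connection in the direction `μ` on an index with value `ν`. -/
def conn (μ ν : Fin (d + 1)) (s : Fin (d + 1) → ℂ) : ℂ :=
  (delta 0 ν : ℂ) * s μ - (delta μ ν : ℂ) * s 0

@[simp] theorem conn_zero (ν : Fin (d + 1)) (s : Fin (d + 1) → ℂ) : conn 0 ν s = 0 := by
  simp [conn]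

@[simp] theorem conn_succ_zero (m : Fin d) (s : Fin (d + 1) → ℂ) :
    conn m.succ 0 s = s m.succ := by simp [conn]

@[simp] theorem conn_succ_succ (m n : Fin d) (s : Fin (d + 1) → ℂ) :
    conn m.succ n.succ s = -(delta m n : ℂ) * s 0 := by simp [conn]

/-- The term with `δ_{0μ}` is a pure scaling weight, one for each index. It cancels the derivative
of the factor `z ^ (-n)` in `pd_framed`, so that only `conn` survives in the frame. -/
theorem sum_christoffel (x : Point d) (μ ν : Fin (d + 1)) (f : Fin (d + 1) → ℂ) :
    ∑ σ, (christoffel x σ μ ν : ℂ) * f σ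
      = -(1 / (x 0 : ℂ)) * ((delta 0 μ : ℂ) * f ν + conn μ ν f) := by
  have h : ∀ σ, (christoffel x σ μ ν : ℂ) * f σ = -(1 / (x 0 : ℂ)) *
      ((delta 0 μ : ℂ) * ((delta ν σ : ℂ) * f σ) + ((delta 0 ν : ℂ) * ((delta μ σ : ℂ) * f σ)
        - (delta μ ν : ℂ) * ((delta 0 σ : ℂ) * f σ))) := by
    intro σ; simp only [christoffel]; push_cast; ring
  simp_rw [h, ← Finset.mul_sum, Finset.sum_add_distrib, Finset.sum_sub_distrib, ← Finset.mul_sum,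
    sum_delta_mul']
  rfl

theorem wave_update_zero (k : EuclideanSpace ℝ (Fin d)) (x : Point d) (t : ℝ) :
    wave k (Function.update x 0 t) = wave k x := by
  simp [wave]

theorem wave_update_succ (k : EuclideanSpace ℝ (Fin d)) (x : Point d) (m : Fin d) (t : ℝ) :
    wave k (Function.update x m.succ t)
      = wave k x * Complex.exp (Complex.I * (k m * (t - x m.succ))) := by
  rw [wave, wave, ← Complex.exp_add, ← mul_add]
  congr 2
  rw [← sub_eq_iff_eq_add', ← Finset.sum_sub_distrib, Finset.sum_eq_single m]
  · simp; ring
  · intro b _ hb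
    rw [Function.update_of_ne (by simpa using hb)]; ring
  · simp

/-- The region `x 0 > ε` is open, so identities valid there may be differentiated; this permits
iterating the frame formulas for second derivatives. -/
theorem pd_congr {f g : Point d → ℂ} {ε : ℝ} (h : ∀ x : Point d, ε < x 0 → f x = g x)
    (μ : Fin (d + 1)) {x : Point d} (hx : ε < x 0) : pd μ f x = pd μ g x := by
  unfold pd
  refine Filter.EventuallyEq.deriv_eq ?_
  have hc : ContinuousAt (fun t : ℝ => Function.update x μ t 0) (x μ) := by fun_prop
  have : ∀ᶠ t in 𝓝 (x μ), ε < Function.update x μ t 0 :=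
    hc.eventually (Ioi_mem_nhds (by simpa using hx))
  filter_upwards [this] with t ht using h _ ht

theorem pd_framed (k : EuclideanSpace ℝ (Fin d)) (n : ℕ) {t : ℝ → ℂ} (μ : Fin (d + 1))
    {x : Point d} (hx : 0 < x 0) (ht : DifferentiableAt ℝ t (x 0)) :
    pd μ (framed k n t) x
      = framed k (n + 1) (fun z => frameD k μ t z - n * (delta 0 μ : ℂ) * t z) x := by
  have hx' : (x 0 : ℂ) ≠ 0 := by exact_mod_cast hx.ne'
  unfold pd framed
  refine Fin.cases ?_ (fun m => ?_) μ
  · simp only [wave_update_zero, Function.update_self, frameD_zero, delta_self]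
    have h1 := ((hasDerivAt_ofReal (x 0)).pow n).inv (pow_ne_zero n hx')
    have h2 := (h1.const_mul (wave k x)).mul ht.hasDerivAt
    refine (show deriv (fun r : ℝ => wave k x * ((r : ℂ) ^ n)⁻¹ * t r) (x 0) = _ from
      h2.deriv).trans ?_
    rcases n with _ | n
    · simp [eulerD]; field_simp
    · simp [eulerD]; field_simp; ring
  · have hne : (0 : Fin (d + 1)) ≠ m.succ := (Fin.succ_ne_zero m).symm
    simp only [wave_update_succ, Function.update_of_ne hne, frameD_succ, delta_zero_succ]
    have h1 : HasDerivAt (fun t : ℝ => Complex.exp (Complex.I * ((k m : ℂ) * ((t : ℂ) - x m.succ))))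
        (Complex.I * k m) (x m.succ) := by
      have := ((((hasDerivAt_ofReal (x m.succ)).sub_const (x m.succ : ℂ)).const_mul
        (k m : ℂ)).const_mul Complex.I).cexp
      exact this.congr_deriv (by simp)
    rw [(((h1.const_mul (wave k x)).mul_const _).mul_const _).deriv]
    push_cast
    field_simp
    ring

/-- `∇_μ T_ν` in the orthonormal frame. -/
def frame1 (k : EuclideanSpace ℝ (Fin d)) (t : Fin (d + 1) → ℝ → ℂ)
    (μ ν : Fin (d + 1)) (z : ℝ) : ℂ :=
  frameD k μ (t ν) z + conn μ ν (fun σ => t σ z)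

/-- `∇_μ T_{νρ}` in the orthonormal frame. -/
def frame2 (k : EuclideanSpace ℝ (Fin d)) (t : Fin (d + 1) → Fin (d + 1) → ℝ → ℂ)
    (μ ν ρ : Fin (d + 1)) (z : ℝ) : ℂ :=
  frameD k μ (t ν ρ) z + conn μ ν (fun σ => t σ ρ z) + conn μ ρ (fun σ => t ν σ z)

/-- `∇_μ T_{νρτ}` in the orthonormal frame. -/
def frame3 (k : EuclideanSpace ℝ (Fin d)) (t : Mode d) (μ ν ρ τ : Fin (d + 1)) (z : ℝ) : ℂ :=
  frameD k μ (t ν ρ τ) z + conn μ ν (fun σ => t σ ρ τ z) + conn μ ρ (fun σ => t ν σ τ z)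
    + conn μ τ (fun σ => t ν ρ σ z)

/-- `∇_μ T_{νρτκ}` in the orthonormal frame. -/
def frame4 (k : EuclideanSpace ℝ (Fin d))
    (t : Fin (d + 1) → Fin (d + 1) → Fin (d + 1) → Fin (d + 1) → ℝ → ℂ)
    (μ ν ρ τ κ : Fin (d + 1)) (z : ℝ) : ℂ :=
  frameD k μ (t ν ρ τ κ) z + conn μ ν (fun σ => t σ ρ τ κ z) + conn μ ρ (fun σ => t ν σ τ κ z)
    + conn μ τ (fun σ => t ν ρ σ κ z) + conn μ κ (fun σ => t ν ρ τ σ z)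

theorem framed_conn (k : EuclideanSpace ℝ (Fin d)) (n : ℕ) (μ ν : Fin (d + 1))
    (s : Fin (d + 1) → ℝ → ℂ) (x : Point d) :
    conn μ ν (fun σ => framed k n (s σ) x) = framed k n (fun z => conn μ ν fun σ => s σ z) x := by
  simp only [conn, framed]; ring

theorem framed_succ (k : EuclideanSpace ℝ (Fin d)) (n : ℕ) (t : ℝ → ℂ) (x : Point d) :
    framed k (n + 1) t x = 1 / (x 0 : ℂ) * framed k n t x := by
  simp only [framed, pow_succ, mul_inv]; ring

section Nabla

variable {k : EuclideanSpace ℝ (Fin d)} {ε : ℝ}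

theorem nabla1_framed (hε : 0 ≤ ε) {T : Fin (d + 1) → Point d → ℂ} {t : Fin (d + 1) → ℝ → ℂ}
    (hT : ∀ ν x, ε < x 0 → T ν x = framed k 1 (t ν) x)
    (ht : ∀ ν z, ε < z → DifferentiableAt ℝ (t ν) z) (μ ν : Fin (d + 1)) {x : Point d}
    (hx : ε < x 0) : nabla1 T μ ν x = framed k 2 (frame1 k t μ ν) x := by
  unfold nabla1
  rw [pd_congr (hT ν) μ hx, pd_framed k 1 μ (hε.trans_lt hx) (ht ν _ hx), sum_christoffel]
  simp only [fun ν => hT ν x hx, framed_conn, framed_succ k 1]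
  simp only [framed, frame1]
  push_cast
  ring

theorem nabla2_framed (hε : 0 ≤ ε) {T : Fin (d + 1) → Fin (d + 1) → Point d → ℂ}
    {t : Fin (d + 1) → Fin (d + 1) → ℝ → ℂ}
    (hT : ∀ ν ρ x, ε < x 0 → T ν ρ x = framed k 2 (t ν ρ) x)
    (ht : ∀ ν ρ z, ε < z → DifferentiableAt ℝ (t ν ρ) z) (μ ν ρ : Fin (d + 1)) {x : Point d}
    (hx : ε < x 0) : nabla2 T μ ν ρ x = framed k 3 (frame2 k t μ ν ρ) x := by
  unfold nabla2
  rw [pd_congr (hT ν ρ) μ hx, pd_framed k 2 μ (hε.trans_lt hx) (ht ν ρ _ hx)]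
  simp only [Finset.sum_add_distrib, sum_christoffel]
  simp only [fun ν ρ => hT ν ρ x hx, framed_conn, framed_succ k 2]
  simp only [framed, frame2]
  push_cast
  ring

theorem nabla3_framed (hε : 0 ≤ ε) {T : Field d} {t : Mode d}
    (hT : ∀ ν ρ τ x, ε < x 0 → T ν ρ τ x = framed k 3 (t ν ρ τ) x)
    (ht : ∀ ν ρ τ z, ε < z → DifferentiableAt ℝ (t ν ρ τ) z) (μ ν ρ τ : Fin (d + 1)) {x : Point d}
    (hx : ε < x 0) : nabla3 T μ ν ρ τ x = framed k 4 (frame3 k t μ ν ρ τ) x := by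
  unfold nabla3
  rw [pd_congr (hT ν ρ τ) μ hx, pd_framed k 3 μ (hε.trans_lt hx) (ht ν ρ τ _ hx)]
  simp only [Finset.sum_add_distrib, sum_christoffel]
  simp only [fun ν ρ τ => hT ν ρ τ x hx, framed_conn, framed_succ k 3]
  simp only [framed, frame3]
  push_cast
  ring

theorem nabla4_framed (hε : 0 ≤ ε)
    {T : Fin (d + 1) → Fin (d + 1) → Fin (d + 1) → Fin (d + 1) → Point d → ℂ}
    {t : Fin (d + 1) → Fin (d + 1) → Fin (d + 1) → Fin (d + 1) → ℝ → ℂ}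
    (hT : ∀ ν ρ τ κ x, ε < x 0 → T ν ρ τ κ x = framed k 4 (t ν ρ τ κ) x)
    (ht : ∀ ν ρ τ κ z, ε < z → DifferentiableAt ℝ (t ν ρ τ κ) z) (μ ν ρ τ κ : Fin (d + 1))
    {x : Point d} (hx : ε < x 0) :
    nabla4 T μ ν ρ τ κ x = framed k 5 (frame4 k t μ ν ρ τ κ) x := by
  unfold nabla4
  rw [pd_congr (hT ν ρ τ κ) μ hx, pd_framed k 4 μ (hε.trans_lt hx) (ht ν ρ τ κ _ hx)]
  simp only [Finset.sum_add_distrib, sum_christoffel]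
  simp only [fun ν ρ τ κ => hT ν ρ τ κ x hx, framed_conn, framed_succ k 4]
  simp only [framed, frame4]
  push_cast
  ring

end Nabla

theorem sum_invMetric (x : Point d) (f : Fin (d + 1) → Fin (d + 1) → ℂ) :
    ∑ α, ∑ β, (invMetric x α β : ℂ) * f α β = (x 0 : ℂ) ^ 2 * ∑ α, f α α := by
  rw [Finset.mul_sum]
  refine Finset.sum_congr rfl fun α _ => ?_
  have : ∀ β, (invMetric x α β : ℂ) * f α β = (x 0 : ℂ) ^ 2 * ((delta α β : ℂ) * f α β) := by
    intro β; simp only [invMetric]; push_cast; ring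
  simp_rw [this, ← Finset.mul_sum, sum_delta_mul']

/-- Contraction with `g^{αβ} = z² δ` removes two indices and exactly two powers of `z`, so traces in
the frame are plain sums. -/
theorem sq_mul_sum_framed (k : EuclideanSpace ℝ (Fin d)) (n : ℕ) (t : Fin (d + 1) → ℝ → ℂ)
    {x : Point d} (hx : 0 < x 0) :
    (x 0 : ℂ) ^ 2 * ∑ α, framed k (n + 2) (t α) x = framed k n (fun z => ∑ α, t α z) x := by
  have hx' : (x 0 : ℂ) ≠ 0 := by exact_mod_cast hx.ne'
  simp only [framed, ← Finset.mul_sum, pow_add]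
  field_simp

/-- The trace `φ_ρ` in the orthonormal frame. -/
def frameTrace (t : Mode d) (ρ : Fin (d + 1)) (z : ℝ) : ℂ := ∑ α, t α α ρ z

/-- The divergence `∇^α φ_{αν,ρ}` in the orthonormal frame. -/
def frameDivFirst (k : EuclideanSpace ℝ (Fin d)) (t : Mode d) (ν ρ : Fin (d + 1)) (z : ℝ) : ℂ :=
  ∑ α, frame3 k t α α ν ρ z

/-- The divergence `∇^α φ_{μν,α}` in the orthonormal frame. -/
def frameDivLast (k : EuclideanSpace ℝ (Fin d)) (t : Mode d) (μ ν : Fin (d + 1)) (z : ℝ) : ℂ :=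
  ∑ α, frame3 k t α μ ν α z

/-- The Laplacian in the orthonormal frame. -/
def frameLaplacian (k : EuclideanSpace ℝ (Fin d)) (t : Mode d) (μ ν ρ : Fin (d + 1))
    (z : ℝ) : ℂ :=
  ∑ α, frame4 k (frame3 k t) α α μ ν ρ z

/-- The left-hand side of the field equations in the orthonormal frame. -/
def frameEq (k : EuclideanSpace ℝ (Fin d)) (t : Mode d) (μ ν ρ : Fin (d + 1)) (z : ℝ) : ℂ :=
  frameLaplacian k t μ ν ρ z
    - frame2 k (frameDivFirst k t) μ ν ρ z - frame2 k (frameDivFirst k t) ν μ ρ z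
    + 1 / 2 * frame2 k (frame1 k (frameTrace t)) μ ν ρ z
    + 1 / 2 * frame2 k (frame1 k (frameTrace t)) ν μ ρ z
    + 3 * t μ ν ρ z
    - (2 * (delta μ ν : ℂ) * frameTrace t ρ z - (delta μ ρ : ℂ) * frameTrace t ν z
        - (delta ν ρ : ℂ) * frameTrace t μ z)

/-! ### Differentiability of frame derivatives of amplitudes of class `C²` -/

section Regularity

variable {ε : ℝ} {t : Mode d}

theorem contDiffOn_frameTrace (ht : ∀ μ ν ρ, ContDiffOn ℝ 2 (t μ ν ρ) (Ioi ε))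
    (ρ : Fin (d + 1)) : ContDiffOn ℝ 2 (frameTrace t ρ) (Ioi ε) :=
  ContDiffOn.sum fun α _ => ht α α ρ

theorem differentiableAt_frameD (k : EuclideanSpace ℝ (Fin d)) {f : ℝ → ℂ}
    (hf : ContDiffOn ℝ 2 f (Ioi ε)) (μ : Fin (d + 1)) {z : ℝ} (hz : ε < z) :
    DifferentiableAt ℝ (frameD k μ f) z := by
  refine Fin.cases ?_ (fun m => ?_) μ
  · exact differentiableAt_eulerD hf hz
  · exact (((hasDerivAt_ofReal z).differentiableAt.const_mul Complex.I).mul_const (k m : ℂ)).mul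
      (differentiableAt_of_contDiffOn hf hz)

theorem differentiableAt_conn (μ ν : Fin (d + 1)) {s : Fin (d + 1) → ℝ → ℂ} {z : ℝ}
    (hs : ∀ σ, DifferentiableAt ℝ (s σ) z) :
    DifferentiableAt ℝ (fun z => conn μ ν fun σ => s σ z) z :=
  ((hs μ).const_mul _).sub ((hs 0).const_mul _)

theorem differentiableAt_frame1 (k : EuclideanSpace ℝ (Fin d)) {t : Fin (d + 1) → ℝ → ℂ}
    (ht : ∀ μ, ContDiffOn ℝ 2 (t μ) (Ioi ε)) (μ ν : Fin (d + 1)) {z : ℝ} (hz : ε < z) :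
    DifferentiableAt ℝ (frame1 k t μ ν) z :=
  (differentiableAt_frameD k (ht ν) μ hz).add
    (differentiableAt_conn μ ν fun σ => differentiableAt_of_contDiffOn (ht σ) hz)

theorem differentiableAt_frame3 (k : EuclideanSpace ℝ (Fin d))
    (ht : ∀ μ ν ρ, ContDiffOn ℝ 2 (t μ ν ρ) (Ioi ε)) (μ ν ρ τ : Fin (d + 1)) {z : ℝ}
    (hz : ε < z) : DifferentiableAt ℝ (frame3 k t μ ν ρ τ) z :=
  (((differentiableAt_frameD k (ht ν ρ τ) μ hz).add
    (differentiableAt_conn μ ν fun σ => differentiableAt_of_contDiffOn (ht σ ρ τ) hz)).add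
    (differentiableAt_conn μ ρ fun σ => differentiableAt_of_contDiffOn (ht ν σ τ) hz)).add
    (differentiableAt_conn μ τ fun σ => differentiableAt_of_contDiffOn (ht ν ρ σ) hz)

end Regularity

/-! ### Reduction of the tensor equations to ordinary differential equations -/

section Reduction

variable {k : EuclideanSpace ℝ (Fin d)} {ε : ℝ} {φ : Field d} {t : Mode d}

theorem fieldTrace_framed (hε : 0 ≤ ε)
    (hφ : ∀ μ ν ρ x, ε < x 0 → φ μ ν ρ x = framed k 3 (t μ ν ρ) x)
    (ρ : Fin (d + 1)) (x : Point d) (hx : ε < x 0) :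
    fieldTrace φ ρ x = framed k 1 (frameTrace t ρ) x := by
  unfold fieldTrace
  rw [sum_invMetric]
  simp only [fun μ ν ρ => hφ μ ν ρ x hx]
  exact sq_mul_sum_framed k 1 (fun α => t α α ρ) (hε.trans_lt hx)

theorem nabla1_fieldTrace (hε : 0 ≤ ε)
    (hφ : ∀ μ ν ρ x, ε < x 0 → φ μ ν ρ x = framed k 3 (t μ ν ρ) x)
    (ht : ∀ μ ν ρ, ContDiffOn ℝ 2 (t μ ν ρ) (Ioi ε))
    (μ ν : Fin (d + 1)) (x : Point d) (hx : ε < x 0) :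
    nabla1 (fieldTrace φ) μ ν x = framed k 2 (frame1 k (frameTrace t) μ ν) x :=
  nabla1_framed hε (fieldTrace_framed hε hφ)
    (fun ρ _ hz => differentiableAt_of_contDiffOn (contDiffOn_frameTrace ht ρ) hz) μ ν hx

theorem nabla3_field (hε : 0 ≤ ε)
    (hφ : ∀ μ ν ρ x, ε < x 0 → φ μ ν ρ x = framed k 3 (t μ ν ρ) x)
    (ht : ∀ μ ν ρ, ContDiffOn ℝ 2 (t μ ν ρ) (Ioi ε))
    (μ ν ρ τ : Fin (d + 1)) (x : Point d) (hx : ε < x 0) :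
    nabla3 φ μ ν ρ τ x = framed k 4 (frame3 k t μ ν ρ τ) x :=
  nabla3_framed hε hφ (fun μ ν ρ _ hz => differentiableAt_of_contDiffOn (ht μ ν ρ) hz) μ ν ρ τ hx

theorem divFirst_framed (hε : 0 ≤ ε)
    (hφ : ∀ μ ν ρ x, ε < x 0 → φ μ ν ρ x = framed k 3 (t μ ν ρ) x)
    (ht : ∀ μ ν ρ, ContDiffOn ℝ 2 (t μ ν ρ) (Ioi ε))
    (ν ρ : Fin (d + 1)) (x : Point d) (hx : ε < x 0) :
    divFirst φ ν ρ x = framed k 2 (frameDivFirst k t ν ρ) x := by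
  unfold divFirst
  rw [sum_invMetric x (fun α β => nabla3 φ β α ν ρ x)]
  simp only [fun μ ν ρ τ => nabla3_field hε hφ ht μ ν ρ τ x hx]
  exact sq_mul_sum_framed k 2 (fun α => frame3 k t α α ν ρ) (hε.trans_lt hx)

theorem divLast_framed (hε : 0 ≤ ε)
    (hφ : ∀ μ ν ρ x, ε < x 0 → φ μ ν ρ x = framed k 3 (t μ ν ρ) x)
    (ht : ∀ μ ν ρ, ContDiffOn ℝ 2 (t μ ν ρ) (Ioi ε))
    (μ ν : Fin (d + 1)) (x : Point d) (hx : ε < x 0) :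
    divLast φ μ ν x = framed k 2 (frameDivLast k t μ ν) x := by
  unfold divLast
  rw [sum_invMetric x (fun α β => nabla3 φ β μ ν α x)]
  simp only [fun μ ν ρ τ => nabla3_field hε hφ ht μ ν ρ τ x hx]
  exact sq_mul_sum_framed k 2 (fun α => frame3 k t α μ ν α) (hε.trans_lt hx)

theorem laplacian_framed (hε : 0 ≤ ε)
    (hφ : ∀ μ ν ρ x, ε < x 0 → φ μ ν ρ x = framed k 3 (t μ ν ρ) x)
    (ht : ∀ μ ν ρ, ContDiffOn ℝ 2 (t μ ν ρ) (Ioi ε))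
    (μ ν ρ : Fin (d + 1)) (x : Point d) (hx : ε < x 0) :
    laplacian φ μ ν ρ x = framed k 3 (frameLaplacian k t μ ν ρ) x := by
  unfold laplacian
  rw [sum_invMetric x (fun α β => nabla4 (nabla3 φ) α β μ ν ρ x)]
  simp only [fun μ ν ρ τ κ => nabla4_framed hε (nabla3_field hε hφ ht)
    (fun μ ν ρ τ _ hz => differentiableAt_frame3 k ht μ ν ρ τ hz) μ ν ρ τ κ hx]
  exact sq_mul_sum_framed k 3 (fun α => frame4 k (frame3 k t) α α μ ν ρ) (hε.trans_lt hx)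

theorem differentiableAt_frameDivFirst (ht : ∀ μ ν ρ, ContDiffOn ℝ 2 (t μ ν ρ) (Ioi ε))
    (ν ρ : Fin (d + 1)) (z : ℝ) (hz : ε < z) :
    DifferentiableAt ℝ (frameDivFirst k t ν ρ) z :=
  DifferentiableAt.fun_sum fun α _ => differentiableAt_frame3 k ht α α ν ρ hz

theorem fieldEq_framed (hε : 0 ≤ ε)
    (hφ : ∀ μ ν ρ x, ε < x 0 → φ μ ν ρ x = framed k 3 (t μ ν ρ) x)
    (ht : ∀ μ ν ρ, ContDiffOn ℝ 2 (t μ ν ρ) (Ioi ε))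
    (μ ν ρ : Fin (d + 1)) (x : Point d) (hx : ε < x 0) :
    fieldEq φ μ ν ρ x = framed k 3 (frameEq k t μ ν ρ) x := by
  have hx' : (x 0 : ℂ) ≠ 0 := by exact_mod_cast (hε.trans_lt hx).ne'
  have hD := fun μ ν ρ => nabla2_framed hε (divFirst_framed hε hφ ht)
    (differentiableAt_frameDivFirst ht) μ ν ρ hx
  have hU := fun μ ν ρ => nabla2_framed hε (nabla1_fieldTrace hε hφ ht)
    (fun μ ν _ hz => differentiableAt_frame1 k (contDiffOn_frameTrace ht) μ ν hz) μ ν ρ hx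
  unfold fieldEq
  simp only [hD, hU, laplacian_framed hε hφ ht _ _ _ x hx, hφ _ _ _ x hx,
    fieldTrace_framed hε hφ _ x hx]
  simp only [framed, frameEq, metric]
  push_cast
  field_simp

theorem constraintTensor_framed (hε : 0 ≤ ε)
    (hφ : ∀ μ ν ρ x, ε < x 0 → φ μ ν ρ x = framed k 3 (t μ ν ρ) x)
    (ht : ∀ μ ν ρ, ContDiffOn ℝ 2 (t μ ν ρ) (Ioi ε))
    (μ ν : Fin (d + 1)) (x : Point d) (hx : ε < x 0) :
    constraintTensor φ μ ν x = framed k 2 (fun z => 2 * frameDivLast k t μ ν z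
      + frame1 k (frameTrace t) μ ν z + frame1 k (frameTrace t) ν μ z) x := by
  unfold constraintTensor
  simp only [divLast_framed hε hφ ht _ _ x hx, nabla1_fieldTrace hε hφ ht _ _ x hx, framed]
  ring

theorem constraintScalar_framed (hε : 0 ≤ ε)
    (hφ : ∀ μ ν ρ x, ε < x 0 → φ μ ν ρ x = framed k 3 (t μ ν ρ) x)
    (ht : ∀ μ ν ρ, ContDiffOn ℝ 2 (t μ ν ρ) (Ioi ε)) (x : Point d) (hx : ε < x 0) :
    constraintScalar φ x = framed k 0 (fun z => ∑ α, frame1 k (frameTrace t) α α z) x := by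
  unfold constraintScalar
  rw [sum_invMetric x (fun α β => nabla1 (fieldTrace φ) β α x)]
  simp only [nabla1_fieldTrace hε hφ ht _ _ x hx]
  exact sq_mul_sum_framed k 0 (fun α => frame1 k (frameTrace t) α α) (hε.trans_lt hx)

/-- The exponential and the power of `z` never vanish, so an equation for the field at a point is an
equation for the amplitude at its height. -/
theorem framed_eq_zero_iff (n : ℕ) (f : ℝ → ℂ) {x : Point d} (hx : 0 < x 0) :
    framed k n f x = 0 ↔ f (x 0) = 0 := by
  have hx' : (x 0 : ℂ) ≠ 0 := by exact_mod_cast hx.ne'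
  simp [framed, wave_ne_zero, hx']

end Reduction

end HookAdS
end

noncomputable section

namespace HookAdS

open Set Filter Topology

/-! ### Hook fields in the radial gauge -/

variable {d : ℕ}

/-- The mode in the radial gauge with frame components `φ_{ij,l} = A_{ij,l}`, `φ_{ij,0} = B_{ij}`. -/
def gaugeMode (A : Fin d → Fin d → Fin d → ℝ → ℂ) (B : Fin d → Fin d → ℝ → ℂ) : Mode d :=
  fun μ ν ρ => Fin.cases
    (Fin.cases (fun _ => 0) (fun j => Fin.cases (fun _ => 0) (fun l z => -(1 / 2) * B j l z) ρ) ν)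
    (fun i => Fin.cases (Fin.cases (fun _ => 0) (fun l z => -(1 / 2) * B i l z) ρ)
      (fun j => Fin.cases (B i j) (fun l => A i j l) ρ) ν) μ

section Components

variable (A : Fin d → Fin d → Fin d → ℝ → ℂ) (B : Fin d → Fin d → ℝ → ℂ)

@[simp] theorem gaugeMode_zz (ρ : Fin (d + 1)) : gaugeMode A B 0 0 ρ = fun _ => 0 := rfl
@[simp] theorem gaugeMode_zsz (j : Fin d) : gaugeMode A B 0 j.succ 0 = fun _ => 0 := rfl
@[simp] theorem gaugeMode_szz (j : Fin d) : gaugeMode A B j.succ 0 0 = fun _ => 0 := rfl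
@[simp] theorem gaugeMode_zss (j l : Fin d) :
    gaugeMode A B 0 j.succ l.succ = fun z => -(1 / 2) * B j l z := rfl
@[simp] theorem gaugeMode_szs (j l : Fin d) :
    gaugeMode A B j.succ 0 l.succ = fun z => -(1 / 2) * B j l z := rfl
@[simp] theorem gaugeMode_ssz (i j : Fin d) : gaugeMode A B i.succ j.succ 0 = B i j := rfl
@[simp] theorem gaugeMode_sss (i j l : Fin d) :
    gaugeMode A B i.succ j.succ l.succ = A i j l := rfl

end Components

@[simp] theorem eulerD_zero : eulerD (fun _ => 0) = fun _ => 0 := by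
  funext z; simp [eulerD]

@[simp] theorem eulerD_const_mul (c : ℂ) (f : ℝ → ℂ) :
    eulerD (fun z => c * f z) = fun z => c * eulerD f z := by
  funext z
  rw [eulerD, eulerD, deriv_const_mul_field]; ring

@[simp] theorem eulerD_neg (f : ℝ → ℂ) : eulerD (fun z => -f z) = fun z => -eulerD f z := by
  funext z; simp [eulerD]

theorem eulerD_add {f g : ℝ → ℂ} {z : ℝ} (hf : DifferentiableAt ℝ f z)
    (hg : DifferentiableAt ℝ g z) :
    eulerD (fun z => f z + g z) z = eulerD f z + eulerD g z := by
  rw [eulerD, eulerD, eulerD, deriv_fun_add hf hg]; ring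

theorem eulerD_ofReal_mul {f : ℝ → ℂ} {z : ℝ} (hf : DifferentiableAt ℝ f z) :
    eulerD (fun z => (z : ℂ) * f z) z = z * (f z + eulerD f z) := by
  rw [eulerD_eq (f := fun z : ℝ => (z : ℂ) * f z)
    ((hasDerivAt_ofReal z).mul hf.hasDerivAt), eulerD]; ring

@[simp] theorem frame3_zero (k : EuclideanSpace ℝ (Fin d)) (t : Mode d) (ν ρ τ : Fin (d + 1)) :
    frame3 k t 0 ν ρ τ = eulerD (t ν ρ τ) := by
  funext z; simp [frame3]

/-- The trace `δ^{ij} A_{ij,l}`. -/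
def trFst (A : Fin d → Fin d → Fin d → ℝ → ℂ) (l : Fin d) (z : ℝ) : ℂ := ∑ i, A i i l z

/-- The divergence of a symmetric tensor, with `i z k` for the derivative. -/
def divSym (k : EuclideanSpace ℝ (Fin d)) (B : Fin d → Fin d → ℝ → ℂ) (i : Fin d) (z : ℝ) : ℂ :=
  ∑ m, Complex.I * z * k m * B m i z

/-- The divergence of a hook tensor in its first index, with `i z k` for the derivative. -/
def divFst (k : EuclideanSpace ℝ (Fin d)) (A : Fin d → Fin d → Fin d → ℝ → ℂ) (i j : Fin d)
    (z : ℝ) : ℂ :=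
  ∑ m, Complex.I * z * k m * A m i j z

/-- The divergence of a hook tensor in its last index, with `i z k` for the derivative. -/
def divLst (k : EuclideanSpace ℝ (Fin d)) (A : Fin d → Fin d → Fin d → ℝ → ℂ) (i j : Fin d)
    (z : ℝ) : ℂ :=
  ∑ m, Complex.I * z * k m * A i j m z

theorem sum_sq_eq_norm_sq (k : EuclideanSpace ℝ (Fin d)) :
    ∑ m, (k m : ℂ) * k m = (‖k‖ : ℂ) ^ 2 := by
  rw [← Complex.ofReal_pow, EuclideanSpace.norm_sq_eq]
  push_cast
  refine Finset.sum_congr rfl fun m _ => ?_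
  rw [← Complex.ofReal_pow, Real.norm_eq_abs, sq_abs]; push_cast; ring

theorem sum_wave_wave (k : EuclideanSpace ℝ (Fin d)) (z : ℝ) (c : ℂ) :
    ∑ m, Complex.I * z * k m * (Complex.I * z * k m * c) = -((‖k‖ : ℂ) ^ 2 * (z : ℂ) ^ 2 * c) := by
  have : ∀ m, Complex.I * z * k m * (Complex.I * z * k m * c)
      = Complex.I ^ 2 * (z : ℂ) ^ 2 * c * ((k m : ℂ) * k m) := fun m => by ring
  simp_rw [this, ← Finset.mul_sum, sum_sq_eq_norm_sq, Complex.I_sq]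
  ring

theorem sum_wave_delta (k : EuclideanSpace ℝ (Fin d)) (z : ℝ) (i : Fin d) (c : ℂ) :
    ∑ m, Complex.I * z * k m * ((delta m i : ℂ) * c) = Complex.I * z * k i * c := by
  have : ∀ m, Complex.I * z * k m * ((delta m i : ℂ) * c)
      = (delta m i : ℂ) * (Complex.I * z * k m * c) := fun m => by ring
  simp_rw [this, sum_delta_mul]

theorem sum_eq_trFst (A : Fin d → Fin d → Fin d → ℝ → ℂ) (l : Fin d) (z : ℝ) :
    ∑ i, A i i l z = trFst A l z := rfl

theorem sum_eq_divFst (k : EuclideanSpace ℝ (Fin d)) (A : Fin d → Fin d → Fin d → ℝ → ℂ)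
    (i j : Fin d) (z : ℝ) : ∑ m, Complex.I * z * k m * A m i j z = divFst k A i j z := rfl

theorem sum_eq_divLst (k : EuclideanSpace ℝ (Fin d)) (A : Fin d → Fin d → Fin d → ℝ → ℂ)
    (i j : Fin d) (z : ℝ) : ∑ m, Complex.I * z * k m * A i j m z = divLst k A i j z := rfl

theorem sum_eq_divSym (k : EuclideanSpace ℝ (Fin d)) (B : Fin d → Fin d → ℝ → ℂ)
    (i : Fin d) (z : ℝ) : ∑ m, Complex.I * z * k m * B m i z = divSym k B i z := rfl

theorem sum_eq_half_divSym (k : EuclideanSpace ℝ (Fin d)) (B : Fin d → Fin d → ℝ → ℂ)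
    (i : Fin d) (z : ℝ) :
    ∑ m, Complex.I * z * k m * (2⁻¹ * B m i z) = 2⁻¹ * divSym k B i z := by
  rw [divSym, Finset.mul_sum]
  exact Finset.sum_congr rfl fun m _ => by ring

/-- Symmetries and regularity of the frame components of a hook field in the radial gauge. -/
structure IsHookPair (ε : ℝ) (A : Fin d → Fin d → Fin d → ℝ → ℂ) (B : Fin d → Fin d → ℝ → ℂ) :
    Prop where
  symm : ∀ z, ε < z → ∀ i j l, A i j l z = A j i l z
  young : ∀ z, ε < z → ∀ i j l, A i j l z + A i l j z + A l j i z = 0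
  symmB : ∀ z, ε < z → ∀ i j, B i j z = B j i z
  contDiffOn : ∀ i j l, ContDiffOn ℝ 2 (A i j l) (Ioi ε)
  contDiffOnB : ∀ i j, ContDiffOn ℝ 2 (B i j) (Ioi ε)

/-! ### Traces, divergences and Laplacian of a hook field in the radial gauge -/

section Constraints

variable {k : EuclideanSpace ℝ (Fin d)} {ε : ℝ} {A : Fin d → Fin d → Fin d → ℝ → ℂ}
  {B : Fin d → Fin d → ℝ → ℂ}

theorem frameTrace_zero (A : Fin d → Fin d → Fin d → ℝ → ℂ) (B : Fin d → Fin d → ℝ → ℂ) :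
    frameTrace (gaugeMode A B) 0 = fun z => ∑ i, B i i z := by
  funext z; simp [frameTrace, Fin.sum_univ_succ]

theorem frameTrace_succ (A : Fin d → Fin d → Fin d → ℝ → ℂ) (B : Fin d → Fin d → ℝ → ℂ)
    (l : Fin d) : frameTrace (gaugeMode A B) l.succ = trFst A l := by
  funext z; simp [frameTrace, Fin.sum_univ_succ, trFst]

theorem IsHookPair.contDiffOn_gaugeMode (h : IsHookPair ε A B) (μ ν ρ : Fin (d + 1)) :
    ContDiffOn ℝ 2 (gaugeMode A B μ ν ρ) (Ioi ε) := by
  have hB := fun i j => contDiffOn_const (c := (-(1 / 2) : ℂ)).mul (h.contDiffOnB i j)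
  induction μ using Fin.cases <;> induction ν using Fin.cases <;> induction ρ using Fin.cases <;>
    first
    | exact contDiffOn_const
    | exact hB _ _
    | exact h.contDiffOn _ _ _
    | exact h.contDiffOnB _ _

theorem IsHookPair.sum_mid (h : IsHookPair ε A B) {z : ℝ} (hz : ε < z) (i : Fin d) :
    ∑ m, A m i m z = -(1 / 2) * trFst A i z := by
  rw [trFst, Finset.mul_sum]
  refine Finset.sum_congr rfl fun m _ => ?_
  linear_combination 1 / 2 * h.young z hz m i m + (0 : ℂ) * h.symm z hz m i m

theorem IsHookPair.sum_right (h : IsHookPair ε A B) {z : ℝ} (hz : ε < z) (i : Fin d) :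
    ∑ m, A i m m z = -(1 / 2) * trFst A i z := by
  rw [← h.sum_mid hz]
  exact Finset.sum_congr rfl fun m _ => h.symm z hz i m m

/-- The cyclic identity ties the symmetric part of the first-index divergence to the last-index one;
only the antisymmetric part is independent data. -/
theorem IsHookPair.divFst_add (h : IsHookPair ε A B) {z : ℝ} (hz : ε < z) (i j : Fin d) :
    divFst k A i j z + divFst k A j i z = -divLst k A i j z := by
  rw [divFst, divFst, divLst, ← Finset.sum_add_distrib, ← Finset.sum_neg_distrib]
  refine Finset.sum_congr rfl fun m _ => ?_
  linear_combination Complex.I * z * k m * (h.young z hz i j m - h.symm z hz i m j)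

theorem IsHookPair.sum_eq_half_divSym' (h : IsHookPair ε A B) {z : ℝ} (hz : ε < z) (i : Fin d) :
    ∑ m, Complex.I * z * k m * (2⁻¹ * B i m z) = 2⁻¹ * divSym k B i z := by
  simp_rw [fun m => h.symmB z hz i m]
  exact sum_eq_half_divSym k B i z

theorem frameDivLast_zz (k : EuclideanSpace ℝ (Fin d)) (A : Fin d → Fin d → Fin d → ℝ → ℂ)
    (B : Fin d → Fin d → ℝ → ℂ) (z : ℝ) :
    frameDivLast k (gaugeMode A B) 0 0 z = -∑ i, B i i z := by
  rw [frameDivLast, Fin.sum_univ_succ]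
  simp [frame3, Finset.sum_add_distrib, ← Finset.mul_sum]
  ring

theorem IsHookPair.frameDivLast_zs (h : IsHookPair ε A B) {z : ℝ} (hz : ε < z) (i : Fin d) :
    frameDivLast k (gaugeMode A B) 0 i.succ z
      = -(1 / 2) * divSym k B i z - 1 / 2 * trFst A i z := by
  rw [frameDivLast, Fin.sum_univ_succ]
  simp [frame3, Finset.sum_add_distrib, h.sum_mid hz, h.sum_eq_half_divSym' hz]
  ring

theorem IsHookPair.frameDivLast_sz (h : IsHookPair ε A B) {z : ℝ} (hz : ε < z) (i : Fin d) :
    frameDivLast k (gaugeMode A B) i.succ 0 z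
      = -(1 / 2) * divSym k B i z - 1 / 2 * trFst A i z := by
  rw [frameDivLast, Fin.sum_univ_succ]
  simp [frame3, Finset.sum_add_distrib, h.sum_right hz, h.sum_eq_half_divSym' hz]
  ring

theorem IsHookPair.frameDivLast_ss (h : IsHookPair ε A B) {z : ℝ} (hz : ε < z) (i j : Fin d) :
    frameDivLast k (gaugeMode A B) i.succ j.succ z
      = eulerD (B i j) z + divLst k A i j z + (1 - d) * B i j z := by
  rw [frameDivLast, Fin.sum_univ_succ]
  simp [frame3, Finset.sum_add_distrib, sum_delta_mul, sum_eq_divLst]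
  rw [h.symmB z hz j i]
  ring

theorem frameDivFirst_zs (k : EuclideanSpace ℝ (Fin d)) (A : Fin d → Fin d → Fin d → ℝ → ℂ)
    (B : Fin d → Fin d → ℝ → ℂ) (i : Fin d) (z : ℝ) :
    frameDivFirst k (gaugeMode A B) 0 i.succ z = -(1 / 2) * divSym k B i z + trFst A i z := by
  rw [frameDivFirst, Fin.sum_univ_succ]
  simp [frame3, Finset.sum_add_distrib, sum_eq_half_divSym, sum_eq_trFst]

theorem frameDivFirst_zz (k : EuclideanSpace ℝ (Fin d)) (A : Fin d → Fin d → Fin d → ℝ → ℂ)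
    (B : Fin d → Fin d → ℝ → ℂ) (z : ℝ) :
    frameDivFirst k (gaugeMode A B) 0 0 z = 1 / 2 * ∑ i, B i i z := by
  rw [frameDivFirst, Fin.sum_univ_succ]
  simp [frame3, Finset.sum_add_distrib, ← Finset.mul_sum]
  ring

theorem IsHookPair.frameDivFirst_sz (h : IsHookPair ε A B) {z : ℝ} (hz : ε < z) (i : Fin d) :
    frameDivFirst k (gaugeMode A B) i.succ 0 z = divSym k B i z - 1 / 2 * trFst A i z := by
  rw [frameDivFirst, Fin.sum_univ_succ]
  simp [frame3, Finset.sum_add_distrib, h.sum_mid hz, sum_eq_divSym]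
  ring

theorem IsHookPair.frameDivFirst_ss (h : IsHookPair ε A B) {z : ℝ} (hz : ε < z) (i j : Fin d) :
    frameDivFirst k (gaugeMode A B) i.succ j.succ z
      = -(1 / 2) * eulerD (B i j) z + divFst k A i j z + (d - 1) / 2 * B i j z := by
  rw [frameDivFirst, Fin.sum_univ_succ]
  simp [frame3, Finset.sum_add_distrib, sum_delta_mul, sum_eq_divFst]
  rw [h.symmB z hz j i]
  ring

theorem frameLaplacian_sss (k : EuclideanSpace ℝ (Fin d)) (A : Fin d → Fin d → Fin d → ℝ → ℂ)
    (B : Fin d → Fin d → ℝ → ℂ) (i j l : Fin d) (z : ℝ) :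
    frameLaplacian k (gaugeMode A B) i.succ j.succ l.succ z
      = eulerD (eulerD (A i j l)) z - d * eulerD (A i j l) z
        - ((‖k‖ : ℂ) ^ 2 * (z : ℂ) ^ 2 + 3) * A i j l z
        + Complex.I * z * (k i * B j l z + k j * B i l z - 2 * k l * B i j z) := by
  rw [frameLaplacian, Fin.sum_univ_succ]
  simp [frame4, frame3, Finset.sum_add_distrib, sum_delta_mul, mul_add, sum_wave_wave,
    sum_wave_delta]
  ring

theorem IsHookPair.frameLaplacian_ssz (h : IsHookPair ε A B) {z : ℝ} (hz : ε < z) (i j : Fin d) :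
    frameLaplacian k (gaugeMode A B) i.succ j.succ 0 z
      = eulerD (eulerD (B i j)) z - d * eulerD (B i j) z
        - ((‖k‖ : ℂ) ^ 2 * (z : ℂ) ^ 2 + d) * B i j z + 2 * divLst k A i j z := by
  rw [frameLaplacian, Fin.sum_univ_succ]
  simp [frame4, frame3, Finset.sum_add_distrib, sum_delta_mul, mul_add, sum_wave_wave,
    sum_eq_divLst]
  rw [h.symmB z hz j i]
  ring

theorem IsHookPair.frameLaplacian_zss (h : IsHookPair ε A B) {z : ℝ} (hz : ε < z) (i j : Fin d) :
    frameLaplacian k (gaugeMode A B) 0 i.succ j.succ z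
      = -(1 / 2) * (eulerD (eulerD (B i j)) z - d * eulerD (B i j) z
        - ((‖k‖ : ℂ) ^ 2 * (z : ℂ) ^ 2 + d) * B i j z) + 2 * divFst k A i j z := by
  rw [frameLaplacian, Fin.sum_univ_succ]
  simp [frame4, frame3, Finset.sum_add_distrib, sum_delta_mul, mul_add, sum_wave_wave,
    sum_eq_divFst]
  rw [h.symmB z hz j i]
  ring

theorem frameLaplacian_zzs (k : EuclideanSpace ℝ (Fin d)) (A : Fin d → Fin d → Fin d → ℝ → ℂ)
    (B : Fin d → Fin d → ℝ → ℂ) (i : Fin d) (z : ℝ) :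
    frameLaplacian k (gaugeMode A B) 0 0 i.succ z = -2 * divSym k B i z + 2 * trFst A i z := by
  rw [frameLaplacian, Fin.sum_univ_succ]
  simp [frame4, frame3, Finset.sum_add_distrib, mul_add, sum_eq_half_divSym,
    sum_eq_trFst]
  ring

theorem IsHookPair.frameLaplacian_zsz (h : IsHookPair ε A B) {z : ℝ} (hz : ε < z) (i : Fin d) :
    frameLaplacian k (gaugeMode A B) 0 i.succ 0 z = divSym k B i z - trFst A i z := by
  rw [frameLaplacian, Fin.sum_univ_succ]
  simp [frame4, frame3, Finset.sum_add_distrib, mul_add, sum_eq_divSym,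
    h.sum_eq_half_divSym' hz, h.sum_mid hz]
  ring

theorem frameLaplacian_zzz (k : EuclideanSpace ℝ (Fin d)) (A : Fin d → Fin d → Fin d → ℝ → ℂ)
    (B : Fin d → Fin d → ℝ → ℂ) (z : ℝ) :
    frameLaplacian k (gaugeMode A B) 0 0 0 z = 0 := by
  rw [frameLaplacian, Fin.sum_univ_succ]
  simp [frame4, frame3, Finset.sum_add_distrib, ← Finset.mul_sum]
  ring

end Constraints

end HookAdS
end

noncomputable section

namespace HookAdS

open Set Filter Topology

variable {d : ℕ}

/-! ### The field equations in the radial gauge -/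

section FieldEquations

variable {k : EuclideanSpace ℝ (Fin d)} {ε : ℝ} {A : Fin d → Fin d → Fin d → ℝ → ℂ}
  {B : Fin d → Fin d → ℝ → ℂ}

theorem IsHookPair.contDiffOn_trFst (h : IsHookPair ε A B) (l : Fin d) :
    ContDiffOn ℝ 2 (trFst A l) (Ioi ε) :=
  ContDiffOn.sum fun i _ => h.contDiffOn i i l

theorem contDiffOn_wave (k : EuclideanSpace ℝ (Fin d)) (m : Fin d) {s : Set ℝ} {n : WithTop ℕ∞} :
    ContDiffOn ℝ n (fun z : ℝ => Complex.I * z * k m) s :=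
  ((contDiff_const.mul Complex.ofRealCLM.contDiff).mul contDiff_const).contDiffOn

theorem IsHookPair.contDiffOn_divSym (h : IsHookPair ε A B) (i : Fin d) :
    ContDiffOn ℝ 2 (divSym k B i) (Ioi ε) :=
  ContDiffOn.sum fun m _ => (contDiffOn_wave k m).mul (h.contDiffOnB m i)

theorem IsHookPair.contDiffOn_divFst (h : IsHookPair ε A B) (i j : Fin d) :
    ContDiffOn ℝ 2 (divFst k A i j) (Ioi ε) :=
  ContDiffOn.sum fun m _ => (contDiffOn_wave k m).mul (h.contDiffOn m i j)

theorem frame1_trace_zz (k : EuclideanSpace ℝ (Fin d)) (A : Fin d → Fin d → Fin d → ℝ → ℂ)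
    (B : Fin d → Fin d → ℝ → ℂ) (z : ℝ) :
    frame1 k (frameTrace (gaugeMode A B)) 0 0 z = eulerD (fun z => ∑ i, B i i z) z := by
  simp [frame1, frameTrace_zero]

theorem frame1_trace_zs (k : EuclideanSpace ℝ (Fin d)) (A : Fin d → Fin d → Fin d → ℝ → ℂ)
    (B : Fin d → Fin d → ℝ → ℂ) (l : Fin d) :
    frame1 k (frameTrace (gaugeMode A B)) 0 l.succ = eulerD (trFst A l) := by
  funext z; simp [frame1, frameTrace_succ]

theorem frame1_trace_sz (k : EuclideanSpace ℝ (Fin d)) (A : Fin d → Fin d → Fin d → ℝ → ℂ)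
    (B : Fin d → Fin d → ℝ → ℂ) (l : Fin d) (z : ℝ) :
    frame1 k (frameTrace (gaugeMode A B)) l.succ 0 z
      = Complex.I * z * k l * (∑ i, B i i z) + trFst A l z := by
  simp [frame1, frameTrace_zero, frameTrace_succ]

theorem frame1_trace_ss (k : EuclideanSpace ℝ (Fin d)) (A : Fin d → Fin d → Fin d → ℝ → ℂ)
    (B : Fin d → Fin d → ℝ → ℂ) (i j : Fin d) (z : ℝ) :
    frame1 k (frameTrace (gaugeMode A B)) i.succ j.succ z
      = Complex.I * z * k i * trFst A j z - (delta i j : ℂ) * ∑ i, B i i z := by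
  simp [frame1, frameTrace_zero, frameTrace_succ]; ring

theorem frame2_zero (k : EuclideanSpace ℝ (Fin d)) (t : Fin (d + 1) → Fin (d + 1) → ℝ → ℂ)
    (ν ρ : Fin (d + 1)) (z : ℝ) : frame2 k t 0 ν ρ z = eulerD (t ν ρ) z := by
  simp [frame2]

theorem frame2_szz (k : EuclideanSpace ℝ (Fin d)) (t : Fin (d + 1) → Fin (d + 1) → ℝ → ℂ)
    (i : Fin d) (z : ℝ) :
    frame2 k t i.succ 0 0 z = Complex.I * z * k i * t 0 0 z + t i.succ 0 z + t 0 i.succ z := by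
  simp [frame2]

theorem frame2_szs (k : EuclideanSpace ℝ (Fin d)) (t : Fin (d + 1) → Fin (d + 1) → ℝ → ℂ)
    (i j : Fin d) (z : ℝ) :
    frame2 k t i.succ 0 j.succ z
      = Complex.I * z * k i * t 0 j.succ z + t i.succ j.succ z - (delta i j : ℂ) * t 0 0 z := by
  simp [frame2]; ring

theorem frame2_ssz (k : EuclideanSpace ℝ (Fin d)) (t : Fin (d + 1) → Fin (d + 1) → ℝ → ℂ)
    (i j : Fin d) (z : ℝ) :
    frame2 k t i.succ j.succ 0 z
      = Complex.I * z * k i * t j.succ 0 z - (delta i j : ℂ) * t 0 0 z + t j.succ i.succ z := by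
  simp [frame2]; ring

theorem frame2_sss (k : EuclideanSpace ℝ (Fin d)) (t : Fin (d + 1) → Fin (d + 1) → ℝ → ℂ)
    (i j l : Fin d) (z : ℝ) :
    frame2 k t i.succ j.succ l.succ z
      = Complex.I * z * k i * t j.succ l.succ z - (delta i j : ℂ) * t 0 l.succ z
        - (delta i l : ℂ) * t j.succ 0 z := by
  simp [frame2]; ring

theorem IsHookPair.eulerD_divFirst_zs (h : IsHookPair ε A B) {z : ℝ} (hz : ε < z) (i : Fin d) :
    eulerD (frameDivFirst k (gaugeMode A B) 0 i.succ) z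
      = -(1 / 2) * eulerD (divSym k B i) z + eulerD (trFst A i) z := by
  have h1 : frameDivFirst k (gaugeMode A B) 0 i.succ
      = fun z => -(1 / 2) * divSym k B i z + trFst A i z :=
    funext fun z => frameDivFirst_zs k A B i z
  rw [h1, eulerD_add ((differentiableAt_of_contDiffOn (h.contDiffOn_divSym i) hz).const_mul _)
    (differentiableAt_of_contDiffOn (h.contDiffOn_trFst i) hz), eulerD_const_mul]

theorem IsHookPair.eulerD_divFirst_sz (h : IsHookPair ε A B) {z : ℝ} (hz : ε < z) (i : Fin d) :
    eulerD (frameDivFirst k (gaugeMode A B) i.succ 0) z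
      = eulerD (divSym k B i) z - 1 / 2 * eulerD (trFst A i) z := by
  have h1 : EqOn (frameDivFirst k (gaugeMode A B) i.succ 0)
      (fun z => divSym k B i z + -(1 / 2) * trFst A i z) (Ioi ε) := fun z hz => by
    simp only [h.frameDivFirst_sz hz]; ring
  rw [eulerD_congr h1 hz, eulerD_add (differentiableAt_of_contDiffOn (h.contDiffOn_divSym i) hz)
    ((differentiableAt_of_contDiffOn (h.contDiffOn_trFst i) hz).const_mul _), eulerD_const_mul]
  ring

theorem IsHookPair.eulerD_divFirst_ss (h : IsHookPair ε A B) {z : ℝ} (hz : ε < z) (i j : Fin d) :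
    eulerD (frameDivFirst k (gaugeMode A B) i.succ j.succ) z
      = -(1 / 2) * eulerD (eulerD (B i j)) z + eulerD (divFst k A i j) z
        + (d - 1) / 2 * eulerD (B i j) z := by
  have h1 : EqOn (frameDivFirst k (gaugeMode A B) i.succ j.succ)
      (fun z => -(1 / 2) * eulerD (B i j) z + divFst k A i j z + (d - 1) / 2 * B i j z)
      (Ioi ε) := fun z hz => h.frameDivFirst_ss hz i j
  have h2 := (differentiableAt_eulerD (h.contDiffOnB i j) hz).const_mul (-(1 / 2) : ℂ)
  have h3 := differentiableAt_of_contDiffOn (h.contDiffOn_divFst (k := k) i j) hz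
  rw [eulerD_congr h1 hz, eulerD_add (h2.fun_add h3)
    ((differentiableAt_of_contDiffOn (h.contDiffOnB i j) hz).const_mul _), eulerD_add h2 h3,
    eulerD_const_mul, eulerD_const_mul]

theorem IsHookPair.eulerD_trace_ss (h : IsHookPair ε A B) (htr : ∀ z, ε < z → ∑ i, B i i z = 0)
    {z : ℝ} (hz : ε < z) (i j : Fin d) :
    eulerD (frame1 k (frameTrace (gaugeMode A B)) i.succ j.succ) z
      = Complex.I * z * k i * (trFst A j z + eulerD (trFst A j) z) := by
  have h1 : EqOn (frame1 k (frameTrace (gaugeMode A B)) i.succ j.succ)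
      (fun z => Complex.I * k i * (z * trFst A j z)) (Ioi ε) := fun z hz => by
    simp only [frame1_trace_ss, htr z hz]; ring
  rw [eulerD_congr h1 hz, eulerD_const_mul]
  beta_reduce
  rw [eulerD_ofReal_mul (differentiableAt_of_contDiffOn (h.contDiffOn_trFst j) hz)]
  ring

theorem IsHookPair.eulerD_trace_sz (htr : ∀ z, ε < z → ∑ i, B i i z = 0)
    {z : ℝ} (hz : ε < z) (j : Fin d) :
    eulerD (frame1 k (frameTrace (gaugeMode A B)) j.succ 0) z = eulerD (trFst A j) z := by
  refine eulerD_congr (fun z hz => ?_) hz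
  simp only [frame1_trace_sz, htr z hz]; ring

theorem eulerD_sum_eq_zero (htr : ∀ z, ε < z → ∑ i, B i i z = 0) {z : ℝ} (hz : ε < z) :
    eulerD (fun z => ∑ i, B i i z) z = 0 := by
  rw [eulerD_congr (g := fun _ => 0) (fun z hz => htr z hz) hz, eulerD_zero]

theorem eulerD_divFirst_zz (k : EuclideanSpace ℝ (Fin d)) (A : Fin d → Fin d → Fin d → ℝ → ℂ)
    (htr : ∀ z, ε < z → ∑ i, B i i z = 0) {z : ℝ} (hz : ε < z) :
    eulerD (frameDivFirst k (gaugeMode A B) 0 0) z = 0 := by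
  rw [eulerD_congr (g := fun _ => 0) (fun z hz => by rw [frameDivFirst_zz, htr z hz, mul_zero]) hz,
    eulerD_zero]

theorem eulerD_trace_zz (k : EuclideanSpace ℝ (Fin d)) (A : Fin d → Fin d → Fin d → ℝ → ℂ)
    (htr : ∀ z, ε < z → ∑ i, B i i z = 0) {z : ℝ} (hz : ε < z) :
    eulerD (frame1 k (frameTrace (gaugeMode A B)) 0 0) z = 0 := by
  rw [eulerD_congr (g := fun _ => 0)
    (fun z hz => by rw [frame1_trace_zz, eulerD_sum_eq_zero htr hz]) hz, eulerD_zero]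

theorem IsHookPair.frameEq_zzz (htr : ∀ z, ε < z → ∑ i, B i i z = 0)
    {z : ℝ} (hz : ε < z) : frameEq k (gaugeMode A B) 0 0 0 z = 0 := by
  simp only [frameEq, frameLaplacian_zzz, frame2_zero, eulerD_divFirst_zz k A htr hz,
    eulerD_trace_zz k A htr hz, frameTrace_zero, htr z hz, gaugeMode_zz]
  ring

theorem IsHookPair.frameEq_zzs (h : IsHookPair ε A B) {z : ℝ} (hz : ε < z) (i : Fin d) :
    frameEq k (gaugeMode A B) 0 0 i.succ z
      = eulerD (divSym k B i) z - 2 * divSym k B i z - 2 * eulerD (trFst A i) z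
        + eulerD (eulerD (trFst A i)) z := by
  simp only [frameEq, frameLaplacian_zzs, frame2_zero, h.eulerD_divFirst_zs hz, frame1_trace_zs,
    gaugeMode_zz, frameTrace_succ, delta_self, delta_zero_succ]
  push_cast
  ring

theorem IsHookPair.frameEq_zsz (h : IsHookPair ε A B) (htr : ∀ z, ε < z → ∑ i, B i i z = 0)
    {z : ℝ} (hz : ε < z) (i : Fin d) :
    frameEq k (gaugeMode A B) 0 i.succ 0 z
      = 1 / 2 * divSym k B i z - eulerD (divSym k B i) z + 3 / 2 * eulerD (trFst A i) z := by
  simp only [frameEq, h.frameLaplacian_zsz hz, frame2_zero, frame2_szz, h.eulerD_divFirst_sz hz,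
    frameDivFirst_zz, frameDivFirst_zs, h.frameDivFirst_sz hz, frame1_trace_zs, frame1_trace_sz,
    frame1_trace_zz, IsHookPair.eulerD_trace_sz htr hz, eulerD_sum_eq_zero htr hz, htr z hz,
    gaugeMode_zsz, frameTrace_succ, delta_self, delta_zero_succ, delta_succ_zero]
  push_cast
  ring

theorem IsHookPair.frameEq_zss (h : IsHookPair ε A B) (htr : ∀ z, ε < z → ∑ i, B i i z = 0)
    {z : ℝ} (hz : ε < z) (i j : Fin d) :
    frameEq k (gaugeMode A B) 0 i.succ j.succ z
      = eulerD (B i j) z - B i j z + 1 / 2 * (‖k‖ : ℂ) ^ 2 * (z : ℂ) ^ 2 * B i j z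
        + divFst k A i j z - eulerD (divFst k A i j) z
        + Complex.I * z * k i * (1 / 2 * divSym k B j z + eulerD (trFst A j) z) := by
  simp only [frameEq, h.frameLaplacian_zss hz, frame2_zero, frame2_szs, h.eulerD_divFirst_ss hz,
    frameDivFirst_zz, frameDivFirst_zs, h.frameDivFirst_ss hz, frame1_trace_zs, frame1_trace_ss,
    frame1_trace_zz, h.eulerD_trace_ss htr hz, eulerD_sum_eq_zero htr hz, htr z hz,
    gaugeMode_zss, frameTrace_succ, frameTrace_zero, delta_zero_succ, delta_succ_succ]
  push_cast
  ring

/-- The first-index divergences enter symmetrically, so by the cyclic identity `A` appears only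
through its trace and its last-index divergence, which the constraints give in terms of `B`. -/
theorem IsHookPair.frameEq_ssz (h : IsHookPair ε A B) (htr : ∀ z, ε < z → ∑ i, B i i z = 0)
    {z : ℝ} (hz : ε < z) (i j : Fin d) :
    frameEq k (gaugeMode A B) i.succ j.succ 0 z
      = eulerD (eulerD (B i j)) z - (d - 1) * eulerD (B i j) z
        - (‖k‖ : ℂ) ^ 2 * (z : ℂ) ^ 2 * B i j z + (4 - 2 * d) * B i j z + 3 * divLst k A i j z
        - Complex.I * z * (k i * divSym k B j z + k j * divSym k B i z)
        + 3 / 2 * (Complex.I * z * (k i * trFst A j z + k j * trFst A i z)) := by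
  have hd := h.divFst_add (k := k) hz i j
  have hB : eulerD (B j i) z = eulerD (B i j) z :=
    eulerD_congr (fun z hz => h.symmB z hz j i) hz
  simp only [frameEq, h.frameLaplacian_ssz hz, frame2_ssz,
    frameDivFirst_zz, h.frameDivFirst_sz hz, h.frameDivFirst_ss hz, frame1_trace_sz,
    frame1_trace_ss, frame1_trace_zz, eulerD_sum_eq_zero htr hz, htr z hz, hB, h.symmB z hz j i,
    gaugeMode_ssz, frameTrace_succ, frameTrace_zero, delta_succ_zero, delta_succ_succ]
  push_cast
  linear_combination -hd

/-- The second derivatives of `A` sit in the diagonal Bessel operator alone; everything else is a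
divergence, a trace or `B`. -/
theorem IsHookPair.frameEq_sss (h : IsHookPair ε A B) (htr : ∀ z, ε < z → ∑ i, B i i z = 0)
    {z : ℝ} (hz : ε < z) (i j l : Fin d) :
    frameEq k (gaugeMode A B) i.succ j.succ l.succ z
      = eulerD (eulerD (A i j l)) z - d * eulerD (A i j l) z
        - (‖k‖ : ℂ) ^ 2 * (z : ℂ) ^ 2 * A i j l z
        + Complex.I * z * (k i * B j l z + k j * B i l z - 2 * k l * B i j z)
        - Complex.I * z * k i *
          (-(1 / 2) * eulerD (B j l) z + divFst k A j l z + (d - 1) / 2 * B j l z)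
        - Complex.I * z * k j *
          (-(1 / 2) * eulerD (B i l) z + divFst k A i l z + (d - 1) / 2 * B i l z)
        - (z : ℂ) ^ 2 * k i * k j * trFst A l z
        - (delta i j : ℂ) * (eulerD (trFst A l) z + divSym k B l z)
        + (delta i l : ℂ) * divSym k B j z + (delta j l : ℂ) * divSym k B i z := by
  simp only [frameEq, frameLaplacian_sss, frame2_sss, frameDivFirst_zs, h.frameDivFirst_sz hz,
    h.frameDivFirst_ss hz, frame1_trace_sz, frame1_trace_zs,
    frame1_trace_ss, htr z hz, gaugeMode_sss, frameTrace_succ, delta_succ_succ, delta_comm j i]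
  linear_combination (z : ℂ) ^ 2 * k i * k j * trFst A l z * Complex.I_sq

/-- Disposes of the components whose first two indices are `i, 0` in favour of `0, i`. -/
theorem frameEq_symm (k : EuclideanSpace ℝ (Fin d)) {t : Mode d}
    (ht : ∀ μ ν ρ, t μ ν ρ = t ν μ ρ) (μ ν ρ : Fin (d + 1)) (z : ℝ) :
    frameEq k t μ ν ρ z = frameEq k t ν μ ρ z := by
  have h3 : ∀ α μ ν ρ, frame3 k t α μ ν ρ = frame3 k t α ν μ ρ := fun α μ ν ρ => by
    funext z
    simp only [frame3, ht μ ν ρ, fun σ => ht σ ν ρ, fun σ => ht μ σ ρ, fun σ => ht μ ν σ]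
    ring
  have h4 : frameLaplacian k t μ ν ρ z = frameLaplacian k t ν μ ρ z := by
    refine Finset.sum_congr rfl fun α _ => ?_
    simp only [frame4, h3 _ μ ν, fun σ => h3 α σ ν, fun σ => h3 α μ σ]
    ring
  simp only [frameEq, h4, ht μ ν ρ, delta_comm μ ν]
  ring

end FieldEquations

end HookAdS
end

noncomputable section

namespace HookAdS

open Set Filter Topology

variable {d : ℕ}

/-! ### Algebra of boundary tensors -/

section Algebra

variable (k : EuclideanSpace ℝ (Fin d))

/-- Contraction with the momentum. -/
def contract (v : Fin d → ℂ) : ℂ := ∑ m, (k m : ℂ) * v m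

/-- The hook tensor `2 k_i k_j v_l - k_i k_l v_j - k_j k_l v_i`. -/
def hookM (v : Fin d → ℂ) : BTensor d := fun i j l =>
  2 * (k i : ℂ) * (k j : ℂ) * v l - (k i : ℂ) * (k l : ℂ) * v j - (k j : ℂ) * (k l : ℂ) * v i

/-- The hook tensor `2 δ_{ij} v_l - δ_{il} v_j - δ_{jl} v_i`. -/
def hookZ (v : Fin d → ℂ) : BTensor d := fun i j l =>
  2 * (delta i j : ℂ) * v l - (delta i l : ℂ) * v j - (delta j l : ℂ) * v i

/-- The hook tensor `k_i s_{jl} + k_j s_{il} - 2 k_l s_{ij}`. -/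
def hookS (s : Fin d → Fin d → ℂ) : BTensor d := fun i j l =>
  (k i : ℂ) * s j l + (k j : ℂ) * s i l - 2 * (k l : ℂ) * s i j

/-- The hook tensor `k_i t_{jl} + k_j t_{il}`. -/
def hookA (t : Fin d → Fin d → ℂ) : BTensor d := fun i j l =>
  (k i : ℂ) * t j l + (k j : ℂ) * t i l

/-- The tensor `k_i k^m π_{mj,l} + k_j k^m π_{mi,l} + k_l k^m π_{ij,m}`. -/
def longitudinal (π : BTensor d) : BTensor d := fun i j l =>
  (k i : ℂ) * divA k π j l + (k j : ℂ) * divA k π i l + (k l : ℂ) * divB k π i j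

variable {k}

theorem contract_add (v w : Fin d → ℂ) :
    contract k (fun m => v m + w m) = contract k v + contract k w := by
  simp [contract, mul_add, Finset.sum_add_distrib]

theorem contract_sub (v w : Fin d → ℂ) :
    contract k (fun m => v m - w m) = contract k v - contract k w := by
  simp [contract, mul_sub, Finset.sum_sub_distrib]

theorem contract_mul_left (c : ℂ) (v : Fin d → ℂ) :
    contract k (fun m => c * v m) = c * contract k v := by
  rw [contract, contract, Finset.mul_sum]; exact Finset.sum_congr rfl fun m _ => by ring

theorem contract_mul_right (c : ℂ) (v : Fin d → ℂ) :
    contract k (fun m => v m * c) = contract k v * c := by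
  rw [contract, contract, Finset.sum_mul]; exact Finset.sum_congr rfl fun m _ => by ring

theorem contract_self : contract k (fun m => (k m : ℂ)) = (‖k‖ : ℂ) ^ 2 := sum_sq_eq_norm_sq k

theorem contract_delta (i : Fin d) : contract k (fun m => (delta m i : ℂ)) = k i := by
  simp_rw [contract, mul_comm]; exact sum_delta_mul i _

theorem contract_delta' (i : Fin d) : contract k (fun m => (delta i m : ℂ)) = k i := by
  simp_rw [delta_comm i]; exact contract_delta i

theorem divA_eq (π : BTensor d) (i j : Fin d) : divA k π i j = contract k fun m => π m i j := rfl

theorem divB_eq (π : BTensor d) (i j : Fin d) : divB k π i j = contract k fun m => π i j m := rfl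

theorem divL_eq (π : BTensor d) (i : Fin d) : divL k π i = contract k fun n => divA k π n i := by
  rw [divL, Finset.sum_comm]
  simp only [contract, divA, Finset.mul_sum]
  exact Finset.sum_congr rfl fun m _ => Finset.sum_congr rfl fun n _ => by ring

theorem norm_ne_zero' (hk : k ≠ 0) : (‖k‖ : ℂ) ≠ 0 := by exact_mod_cast norm_ne_zero_iff.2 hk

/-! #### Linearity of the transverse traceless part -/

theorem divA_mul_add (c : ℂ) (X Y : BTensor d) (i j : Fin d) :
    divA k (fun i j l => c * X i j l + Y i j l) i j = c * divA k X i j + divA k Y i j := by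
  simp only [divA_eq, contract_add, contract_mul_left]

theorem divB_mul_add (c : ℂ) (X Y : BTensor d) (i j : Fin d) :
    divB k (fun i j l => c * X i j l + Y i j l) i j = c * divB k X i j + divB k Y i j := by
  simp only [divB_eq, contract_add, contract_mul_left]

theorem divL_mul_add (c : ℂ) (X Y : BTensor d) (i : Fin d) :
    divL k (fun i j l => c * X i j l + Y i j l) i = c * divL k X i + divL k Y i := by
  simp only [divL_eq, divA_mul_add, contract_add, contract_mul_left]

theorem auxX_eq (X : BTensor d) (l : Fin d) :
    auxX k X l = ∑ i, X i i l - divL k X l / (‖k‖ : ℂ) ^ 2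
      - (k l : ℂ) / (‖k‖ : ℂ) ^ 2 * contract k (fun m => ∑ i, X i i m) := rfl

theorem auxX_mul_add (c : ℂ) (X Y : BTensor d) (l : Fin d) :
    auxX k (fun i j l => c * X i j l + Y i j l) l = c * auxX k X l + auxX k Y l := by
  simp only [auxX_eq, divL_mul_add, Finset.sum_add_distrib, ← Finset.mul_sum, contract_add,
    contract_mul_left]
  ring

/-- Linearity reduces the transverse traceless part of the solution to that of `π` and of four
elementary hook tensors, on each of which it vanishes. -/
theorem hookTT_mul_add (c : ℂ) (X Y : BTensor d) (i j l : Fin d) :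
    hookTT k (fun i j l => c * X i j l + Y i j l) i j l
      = c * hookTT k X i j l + hookTT k Y i j l := by
  simp only [hookTT, divA_mul_add, divB_mul_add, divL_mul_add, auxX_mul_add]
  ring

theorem divA_mul (c : ℂ) (X : BTensor d) (i j : Fin d) :
    divA k (fun i j l => c * X i j l) i j = c * divA k X i j := by
  simp only [divA_eq, contract_mul_left]

theorem divB_mul (c : ℂ) (X : BTensor d) (i j : Fin d) :
    divB k (fun i j l => c * X i j l) i j = c * divB k X i j := by
  simp only [divB_eq, contract_mul_left]

theorem hookTT_mul (c : ℂ) (X : BTensor d) (i j l : Fin d) :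
    hookTT k (fun i j l => c * X i j l) i j l = c * hookTT k X i j l := by
  simp only [hookTT, divA_mul, divB_mul, divL_eq, auxX_eq, contract_mul_left, ← Finset.mul_sum]
  ring

/-! #### Contractions of the elementary hook tensors -/

section HookM

variable {v : Fin d → ℂ}

theorem divA_hookM (hv : contract k v = 0) (i j : Fin d) :
    divA k (hookM k v) i j = (‖k‖ : ℂ) ^ 2 * (2 * k i * v j - k j * v i) := by
  simp only [divA_eq, hookM, contract_sub, contract_mul_left, contract_mul_right, contract_self, hv]
  ring

theorem divB_hookM (hv : contract k v = 0) (i j : Fin d) :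
    divB k (hookM k v) i j = -(‖k‖ : ℂ) ^ 2 * (k i * v j + k j * v i) := by
  simp only [divB_eq, hookM, contract_sub, contract_mul_left, contract_mul_right, contract_self, hv]
  ring

theorem divL_hookM (hv : contract k v = 0) (i : Fin d) :
    divL k (hookM k v) i = 2 * (‖k‖ : ℂ) ^ 4 * v i := by
  simp only [divL_eq, divA_hookM hv, contract_sub, contract_mul_left, contract_mul_right,
    contract_self, hv]
  ring

theorem trace_hookM (hv : contract k v = 0) (l : Fin d) :
    ∑ i, hookM k v i i l = 2 * (‖k‖ : ℂ) ^ 2 * v l := by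
  have : ∀ i, hookM k v i i l
      = 2 * v l * ((k i : ℂ) * k i) - 2 * (k l : ℂ) * ((k i : ℂ) * v i) := fun i => by
    simp only [hookM]; ring
  have hv' : ∑ i, (k i : ℂ) * v i = 0 := hv
  simp_rw [this, Finset.sum_sub_distrib, ← Finset.mul_sum, sum_sq_eq_norm_sq, hv']
  ring

theorem divA_hookZ (hv : contract k v = 0) (i j : Fin d) :
    divA k (hookZ v) i j = 2 * k i * v j - k j * v i := by
  simp only [divA_eq, hookZ, contract_sub, contract_mul_left, contract_mul_right, contract_delta,
    hv]
  ring

theorem divB_hookZ (hv : contract k v = 0) (i j : Fin d) :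
    divB k (hookZ v) i j = -(k i * v j + k j * v i) := by
  simp only [divB_eq, hookZ, contract_sub, contract_mul_left, contract_mul_right, contract_delta',
    hv]
  ring

theorem divL_hookZ (hv : contract k v = 0) (i : Fin d) :
    divL k (hookZ v) i = 2 * (‖k‖ : ℂ) ^ 2 * v i := by
  simp only [divL_eq, divA_hookZ hv, contract_sub, contract_mul_left, contract_mul_right,
    contract_self, hv]
  ring

theorem trace_hookZ (v : Fin d → ℂ) (l : Fin d) :
    ∑ i, hookZ v i i l = (2 * d - 2) * v l := by
  have : ∀ i, hookZ v i i l = 2 * v l - 2 * ((delta i l : ℂ) * v i) := fun i => by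
    simp only [hookZ, delta_self]; push_cast; ring
  simp_rw [this, Finset.sum_sub_distrib, ← Finset.mul_sum, sum_delta_mul]
  simp
  ring

theorem auxX_hookM (hk : k ≠ 0) (hv : contract k v = 0) (l : Fin d) :
    auxX k (hookM k v) l = 0 := by
  have hk' := norm_ne_zero' hk
  simp only [auxX_eq, trace_hookM hv, divL_hookM hv, contract_mul_left, hv]
  field_simp
  ring

/-- This value is the origin of the normalisation `1 / (2 (d - 2))` of the trace subtraction in
`hookTT`, and of the need for `d ≠ 2`. -/
theorem auxX_hookZ (hk : k ≠ 0) (hv : contract k v = 0) (l : Fin d) :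
    auxX k (hookZ v) l = 2 * ((d : ℂ) - 2) * v l := by
  have hk' := norm_ne_zero' hk
  simp only [auxX_eq, trace_hookZ, divL_hookZ hv, contract_mul_left, hv]
  field_simp
  ring

theorem hookTT_hookM (hk : k ≠ 0) (hv : contract k v = 0) (i j l : Fin d) :
    hookTT k (hookM k v) i j l = 0 := by
  have hk' := norm_ne_zero' hk
  simp only [hookTT, divA_hookM hv, divB_hookM hv, divL_hookM hv, auxX_hookM hk hv]
  simp only [hookM]
  field_simp
  ring

theorem hookTT_hookZ (hk : k ≠ 0) (hd : (d : ℂ) - 2 ≠ 0) (hv : contract k v = 0)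
    (i j l : Fin d) : hookTT k (hookZ v) i j l = 0 := by
  have hk' := norm_ne_zero' hk
  simp only [hookTT, divA_hookZ hv, divB_hookZ hv, divL_hookZ hv, auxX_hookZ hk hv]
  simp only [hookZ, proj]
  field_simp
  ring

theorem hookM_symm (v : Fin d → ℂ) (i j l : Fin d) : hookM k v i j l = hookM k v j i l := by
  simp only [hookM]; ring

theorem hookM_young (v : Fin d → ℂ) (i j l : Fin d) :
    hookM k v i j l + hookM k v i l j + hookM k v l j i = 0 := by
  simp only [hookM]; ring

theorem hookZ_symm (v : Fin d → ℂ) (i j l : Fin d) : hookZ v i j l = hookZ v j i l := by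
  simp only [hookZ, delta_comm j i]; ring

theorem hookZ_young (v : Fin d → ℂ) (i j l : Fin d) :
    hookZ v i j l + hookZ v i l j + hookZ v l j i = 0 := by
  simp only [hookZ, delta_comm l j, delta_comm l i, delta_comm j i]; ring

end HookM

/-! ### Hook tensors built from a transverse traceless symmetric tensor -/

section HookS

variable {s : Fin d → Fin d → ℂ}

theorem divA_hookS (h : ∀ i, contract k (fun m => s m i) = 0)
    (i j : Fin d) : divA k (hookS k s) i j = (‖k‖ : ℂ) ^ 2 * s i j := by
  simp only [divA_eq, hookS, contract_sub, contract_add, contract_mul_left, contract_mul_right,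
    contract_self, h]
  ring

theorem divB_hookS (h' : ∀ i, contract k (s i) = 0) (i j : Fin d) :
    divB k (hookS k s) i j = -2 * (‖k‖ : ℂ) ^ 2 * s i j := by
  simp only [divB_eq, hookS, contract_sub, contract_add, contract_mul_left, contract_mul_right,
    contract_self, h']
  ring

theorem divL_hookS (h : ∀ i, contract k (fun m => s m i) = 0)
    (i : Fin d) : divL k (hookS k s) i = 0 := by
  simp only [divL_eq, divA_hookS h, contract_mul_left, h, mul_zero]

theorem trace_hookS (h : ∀ i, contract k (fun m => s m i) = 0) (htr : ∑ i, s i i = 0)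
    (l : Fin d) : ∑ i, hookS k s i i l = 0 := by
  have : ∀ i, hookS k s i i l = 2 * ((k i : ℂ) * s i l) - 2 * k l * s i i := fun i => by
    simp only [hookS]; ring
  have h0 : ∑ i, (k i : ℂ) * s i l = 0 := h l
  simp_rw [this, Finset.sum_sub_distrib, ← Finset.mul_sum, htr, h0]
  ring

theorem hookTT_hookS (hk : k ≠ 0) (h : ∀ i, contract k (fun m => s m i) = 0)
    (h' : ∀ i, contract k (s i) = 0) (htr : ∑ i, s i i = 0) (i j l : Fin d) :
    hookTT k (hookS k s) i j l = 0 := by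
  have hk' := norm_ne_zero' hk
  have h0 : ∀ l, auxX k (hookS k s) l = 0 := fun l => by
    simp [auxX_eq, trace_hookS h htr, divL_hookS h, contract]
  simp only [hookTT, divA_hookS h, divB_hookS h', divL_hookS h, h0]
  simp only [hookS]
  field_simp
  ring

theorem hookS_symm (hs : ∀ i j, s i j = s j i) (i j l : Fin d) :
    hookS k s i j l = hookS k s j i l := by
  simp only [hookS, hs j i]; ring

theorem hookS_young (hs : ∀ i j, s i j = s j i) (i j l : Fin d) :
    hookS k s i j l + hookS k s i l j + hookS k s l j i = 0 := by
  simp only [hookS, hs l j, hs j i, hs l i]; ring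

end HookS

/-! ### Hook tensors built from an antisymmetric tensor -/

section HookA

variable {t : Fin d → Fin d → ℂ} {w : Fin d → ℂ}

theorem divA_hookA (h : ∀ i, contract k (fun m => t m i) = w i) (i j : Fin d) :
    divA k (hookA k t) i j = (‖k‖ : ℂ) ^ 2 * t i j + k i * w j := by
  simp only [divA_eq, hookA, contract_add, contract_mul_left, contract_mul_right,
    contract_self, h]

theorem contract_right_of_antisymm (ht : ∀ i j, t i j = -t j i)
    (h : ∀ i, contract k (fun m => t m i) = w i) (i : Fin d) : contract k (t i) = -w i := by
  rw [← h, show t i = fun m => -1 * t m i from funext fun m => by rw [ht]; ring,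
    contract_mul_left]
  ring

theorem divB_hookA (ht : ∀ i j, t i j = -t j i) (h : ∀ i, contract k (fun m => t m i) = w i)
    (i j : Fin d) : divB k (hookA k t) i j = -(k i * w j + k j * w i) := by
  simp only [divB_eq, hookA, contract_add, contract_mul_left, contract_right_of_antisymm ht h]
  ring

theorem divL_hookA (h : ∀ i, contract k (fun m => t m i) = w i) (i : Fin d) :
    divL k (hookA k t) i = 2 * (‖k‖ : ℂ) ^ 2 * w i := by
  simp only [divL_eq, divA_hookA h, contract_add, contract_mul_left, contract_mul_right,
    contract_self, h]
  ring

theorem trace_hookA (h : ∀ i, contract k (fun m => t m i) = w i) (l : Fin d) :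
    ∑ i, hookA k t i i l = 2 * w l := by
  have : ∀ i, hookA k t i i l = 2 * ((k i : ℂ) * t i l) := fun i => by
    simp only [hookA]; ring
  simp_rw [this, ← Finset.mul_sum, ← h]
  rfl

theorem hookTT_hookA (hk : k ≠ 0) (ht : ∀ i j, t i j = -t j i)
    (h : ∀ i, contract k (fun m => t m i) = w i) (hw : contract k w = 0) (i j l : Fin d) :
    hookTT k (hookA k t) i j l = 0 := by
  have hk' := norm_ne_zero' hk
  have h0 : ∀ l, auxX k (hookA k t) l = 0 := fun l => by
    simp only [auxX_eq, trace_hookA h, divL_hookA h, contract_mul_left, hw]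
    field_simp
    ring
  simp only [hookTT, divA_hookA h, divB_hookA ht h, divL_hookA h, h0]
  simp only [hookA]
  field_simp
  ring

theorem hookA_symm (t : Fin d → Fin d → ℂ) (i j l : Fin d) :
    hookA k t i j l = hookA k t j i l := by
  simp only [hookA]; ring

theorem hookA_young (ht : ∀ i j, t i j = -t j i) (i j l : Fin d) :
    hookA k t i j l + hookA k t i l j + hookA k t l j i = 0 := by
  simp only [hookA, ht l j, ht j i, ht l i]; ring

end HookA

/-! #### Contractions of a traceless hook tensor -/

section Hook

variable {π : BTensor d}

theorem IsTracelessHook.divB_symm (h : IsTracelessHook π) (i j : Fin d) :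
    divB k π i j = divB k π j i := by
  simp only [divB, h.symm i j]

theorem IsTracelessHook.divA_add (h : IsTracelessHook π) (i j : Fin d) :
    divA k π i j + divA k π j i = -divB k π i j := by
  simp only [divA, divB]
  rw [← Finset.sum_add_distrib, ← Finset.sum_neg_distrib]
  refine Finset.sum_congr rfl fun m _ => ?_
  linear_combination (k m : ℂ) * (h.young i j m - h.symm i m j)

theorem contract_contract_swap (f : Fin d → Fin d → ℂ) :
    contract k (fun m => contract k fun n => f m n)
      = contract k (fun n => contract k fun m => f m n) := by
  simp only [contract, Finset.mul_sum]
  rw [Finset.sum_comm]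
  exact Finset.sum_congr rfl fun m _ => Finset.sum_congr rfl fun n _ => by ring

theorem contract_divA_left (π : BTensor d) (j : Fin d) :
    contract k (fun m => divA k π m j) = divL k π j := (divL_eq π j).symm

theorem contract_neg (v : Fin d → ℂ) : contract k (fun m => -v m) = -contract k v := by
  simp [contract]

/-- Of the three ways of contracting two slots with `k`, symmetry makes two equal, and the cyclic
identity makes the sum of all three vanish. -/
theorem IsTracelessHook.contract_divA (h : IsTracelessHook π) (i : Fin d) :
    contract k (divA k π i) = -(1 / 2) * divL k π i := by
  have h1 : contract k (divA k π i) = contract k (fun m => divB k π m i) := by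
    simp only [divB_eq]
    rw [contract_contract_swap]
    rfl
  have h2 : contract k (divA k π i) + contract k (fun m => divA k π m i)
      = -contract k (fun m => divB k π m i) := by
    rw [← contract_add, ← contract_neg]
    congr 1
    funext m
    rw [h.divA_add, h.divB_symm]
  rw [← h1, contract_divA_left] at h2
  linear_combination 1 / 2 * h2

theorem IsTracelessHook.contract_divB (h : IsTracelessHook π) (i : Fin d) :
    contract k (divB k π i) = -(1 / 2) * divL k π i := by
  have h2 : contract k (divA k π i) + contract k (fun m => divA k π m i)
      = -contract k (divB k π i) := by
    rw [← contract_add, ← contract_neg]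
    congr 1
    funext m
    rw [h.divA_add]
  rw [h.contract_divA, contract_divA_left] at h2
  linear_combination h2

theorem IsTracelessHook.contract_divB' (h : IsTracelessHook π) (i : Fin d) :
    contract k (fun m => divB k π m i) = -(1 / 2) * divL k π i := by
  rw [← h.contract_divB i]
  congr 1
  funext m
  rw [h.divB_symm]

/-- A hook tensor has no totally symmetric part: exchanging the order of the contractions shows that
the scalar equals `-1/2` times itself. -/
theorem IsTracelessHook.contract_divL (h : IsTracelessHook π) : contract k (divL k π) = 0 := by
  have h1 : contract k (divL k π) = contract k (fun i => contract k fun m => divA k π m i) := by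
    simp only [contract_divA_left]
  rw [contract_contract_swap] at h1
  have h2 : contract k (fun m => contract k fun i => divA k π m i)
      = -(1 / 2) * contract k (divL k π) := by
    rw [← contract_mul_left]
    congr 1
    funext m
    exact h.contract_divA m
  rw [h2] at h1
  linear_combination 2 / 3 * h1

theorem IsTracelessHook.trace_divB (h : IsTracelessHook π) : ∑ i, divB k π i i = 0 := by
  simp only [divB]
  rw [Finset.sum_comm]
  simp [← Finset.mul_sum, h.traceless]

theorem IsTracelessHook.contract_tensT (h : IsTracelessHook π) (j : Fin d) :
    contract k (fun m => tensT k π m j) = 3 / 2 * divL k π j := by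
  simp only [tensT, contract_sub, contract_divA_left, h.contract_divA]
  ring

theorem tensT_antisymm (π : BTensor d) (i j : Fin d) : tensT k π i j = -tensT k π j i := by
  simp only [tensT]; ring

theorem tensS_symm (π : BTensor d) (i j : Fin d) : tensS k π i j = tensS k π j i := by
  simp only [tensS]; ring

theorem IsTracelessHook.contract_tensS (h : IsTracelessHook π) (i : Fin d) :
    contract k (tensS k π i) = (‖k‖ : ℂ) ^ 2 * divL k π i := by
  have : tensS k π i = fun j => (k i : ℂ) * divL k π j + k j * divL k π i := rfl
  rw [this, contract_add, contract_mul_left, contract_mul_right, contract_self,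
    h.contract_divL]
  ring

theorem IsTracelessHook.trace_tensS (h : IsTracelessHook π) : ∑ i, tensS k π i i = 0 := by
  have h1 : ∀ i, tensS k π i i = 2 * ((k i : ℂ) * divL k π i) := fun i => by
    simp only [tensS]; ring
  have h2 : ∑ i, (k i : ℂ) * divL k π i = 0 := h.contract_divL
  simp_rw [h1, ← Finset.mul_sum, h2, mul_zero]

theorem IsTracelessHook.divA_longitudinal (h : IsTracelessHook π) (i j : Fin d) :
    divA k (longitudinal k π) i j
      = (‖k‖ : ℂ) ^ 2 * divA k π i j + k i * divL k π j - 1 / 2 * k j * divL k π i := by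
  simp only [divA_eq (longitudinal k π), longitudinal, contract_add, contract_mul_left,
    contract_mul_right, contract_self, contract_divA_left, h.contract_divB']
  ring

theorem IsTracelessHook.divB_longitudinal (h : IsTracelessHook π) (i j : Fin d) :
    divB k (longitudinal k π) i j
      = (‖k‖ : ℂ) ^ 2 * divB k π i j - 1 / 2 * (k i * divL k π j + k j * divL k π i) := by
  simp only [divB_eq (longitudinal k π), longitudinal, contract_add, contract_mul_left,
    contract_mul_right, contract_self, h.contract_divA]
  ring

theorem IsTracelessHook.trace_longitudinal (h : IsTracelessHook π) (l : Fin d) :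
    ∑ i, longitudinal k π i i l = 2 * divL k π l := by
  have h1 : ∀ i, longitudinal k π i i l
      = 2 * ((k i : ℂ) * divA k π i l) + k l * divB k π i i := fun i => by
    simp only [longitudinal]; ring
  have h2 : ∑ i, (k i : ℂ) * divA k π i l = divL k π l := contract_divA_left π l
  simp_rw [h1, Finset.sum_add_distrib, ← Finset.mul_sum, h2, h.trace_divB]
  ring

/-- With vanishing traces the auxiliary vector is just `-L / k²`, so the projector terms regroup
into the two elementary tensors built from `L`. -/
theorem IsTracelessHook.hookTT_eq (h : IsTracelessHook π) (i j l : Fin d) :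
    hookTT k π i j l = π i j l - 1 / (‖k‖ : ℂ) ^ 2 * longitudinal k π i j l
      + (1 / (2 * (‖k‖ : ℂ) ^ 4) - 1 / (2 * ((d : ℂ) - 2)) / (‖k‖ : ℂ) ^ 4)
        * hookM k (divL k π) i j l
      + 1 / (2 * ((d : ℂ) - 2)) / (‖k‖ : ℂ) ^ 2 * hookZ (divL k π) i j l := by
  have h0 : ∀ l, auxX k π l = -(divL k π l / (‖k‖ : ℂ) ^ 2) := fun l => by
    simp only [auxX_eq, h.traceless, contract]; simp
  rw [hookTT, h0, h0, h0]
  simp only [hookM, hookZ, longitudinal, proj]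
  ring

theorem IsTracelessHook.hookTT_symm (h : IsTracelessHook π) (i j l : Fin d) :
    hookTT k π i j l = hookTT k π j i l := by
  rw [h.hookTT_eq, h.hookTT_eq, h.symm i j, hookM_symm _ i j, hookZ_symm _ i j]
  simp only [longitudinal, h.divB_symm i j]
  ring

theorem IsTracelessHook.hookTT_young (h : IsTracelessHook π) (i j l : Fin d) :
    hookTT k π i j l + hookTT k π i l j + hookTT k π l j i = 0 := by
  have hl : longitudinal k π i j l + longitudinal k π i l j + longitudinal k π l j i = 0 := by
    simp only [longitudinal]
    linear_combination (k i : ℂ) * (h.divA_add (k := k) j l - h.divB_symm (k := k) j l)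
      + (k j : ℂ) * h.divA_add (k := k) i l + (k l : ℂ) * h.divA_add (k := k) i j
  rw [h.hookTT_eq, h.hookTT_eq, h.hookTT_eq]
  linear_combination h.young i j l - 1 / (‖k‖ : ℂ) ^ 2 * hl
    + (1 / (2 * (‖k‖ : ℂ) ^ 4) - 1 / (2 * ((d : ℂ) - 2)) / (‖k‖ : ℂ) ^ 4)
        * hookM_young (k := k) (divL k π) i j l
      + 1 / (2 * ((d : ℂ) - 2)) / (‖k‖ : ℂ) ^ 2 * hookZ_young (divL k π) i j l

theorem IsTracelessHook.hookTT_eq_fun (h : IsTracelessHook π) :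
    hookTT k π = fun i j l => -(1 / (‖k‖ : ℂ) ^ 2) * longitudinal k π i j l
      + ((1 / (2 * (‖k‖ : ℂ) ^ 4) - 1 / (2 * ((d : ℂ) - 2)) / (‖k‖ : ℂ) ^ 4)
        * hookM k (divL k π) i j l
      + (1 / (2 * ((d : ℂ) - 2)) / (‖k‖ : ℂ) ^ 2 * hookZ (divL k π) i j l + π i j l)) := by
  funext i j l; rw [h.hookTT_eq]; ring

theorem IsTracelessHook.divA_hookTT (h : IsTracelessHook π) (hk : k ≠ 0)
    (hd : (d : ℂ) - 2 ≠ 0) (i j : Fin d) : divA k (hookTT k π) i j = 0 := by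
  have hk' := norm_ne_zero' hk
  rw [h.hookTT_eq_fun, divA_mul_add, divA_mul_add, divA_mul_add, h.divA_longitudinal,
    divA_hookM h.contract_divL, divA_hookZ h.contract_divL]
  field_simp
  ring

theorem IsTracelessHook.divB_hookTT (h : IsTracelessHook π) (hk : k ≠ 0)
    (hd : (d : ℂ) - 2 ≠ 0) (i j : Fin d) : divB k (hookTT k π) i j = 0 := by
  have hk' := norm_ne_zero' hk
  rw [h.hookTT_eq_fun, divB_mul_add, divB_mul_add, divB_mul_add, h.divB_longitudinal,
    divB_hookM h.contract_divL, divB_hookZ h.contract_divL]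
  field_simp
  ring

theorem IsTracelessHook.trace_hookTT (h : IsTracelessHook π) (hk : k ≠ 0)
    (hd : (d : ℂ) - 2 ≠ 0) (l : Fin d) : ∑ i, hookTT k π i i l = 0 := by
  have hk' := norm_ne_zero' hk
  rw [h.hookTT_eq_fun]
  simp only [Finset.sum_add_distrib, ← Finset.mul_sum, h.trace_longitudinal,
    trace_hookM h.contract_divL, trace_hookZ, h.traceless]
  field_simp
  ring

end Hook

end Algebra

end HookAdS
end

noncomputable section

namespace HookAdS

open Set Filter Topology

variable {d : ℕ}

/-! ### The Bessel profiles -/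

section Profile

/-- The profile `𝒦_ν(zk) / 𝒦_ν(εk)`, `ν = d/2`. -/
def besselF (k : EuclideanSpace ℝ (Fin d)) (ε z : ℝ) : ℂ :=
  (calK (d / 2) (z * ‖k‖) : ℂ) / (calK (d / 2) (ε * ‖k‖) : ℂ)

/-- The profile `(2 𝒦_ν(zk) - 𝒦_{ν+1}(zk)) / 𝒦_ν(εk)`, `ν = d/2`. -/
def besselH (k : EuclideanSpace ℝ (Fin d)) (ε z : ℝ) : ℂ :=
  (2 * (calK (d / 2) (z * ‖k‖) : ℂ) - (calK (d / 2 + 1) (z * ‖k‖) : ℂ))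
    / (calK (d / 2) (ε * ‖k‖) : ℂ)

variable {k : EuclideanSpace ℝ (Fin d)} {ε z : ℝ}

theorem ofReal_calK_ne_zero (hk : k ≠ 0) (ν : ℝ) (hz : 0 < z) :
    (calK ν (z * ‖k‖) : ℂ) ≠ 0 := by
  exact_mod_cast (calK_pos ν (mul_pos hz (norm_pos_iff.2 hk))).ne'

theorem besselF_self (hk : k ≠ 0) (hε : 0 < ε) : besselF k ε ε = 1 :=
  div_self (ofReal_calK_ne_zero hk _ hε)

theorem besselH_eq (hk : k ≠ 0) (ε : ℝ) (hz : 0 < z) :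
    besselH k ε z = (besselW (d / 2) (z * ‖k‖) : ℂ) * besselF k ε z := by
  have h := ofReal_calK_ne_zero hk (d / 2) hz
  unfold besselH besselF besselW
  push_cast
  field_simp

theorem hasDerivAt_calK_comp (hk : k ≠ 0) (ν : ℝ) (hz : 0 < z) :
    HasDerivAt (fun z : ℝ => (calK ν (z * ‖k‖) : ℂ))
      (-((‖k‖ : ℂ) ^ 2 * z * (calK (ν - 1) (z * ‖k‖) : ℂ))) z := by
  have h1 := hasDerivAt_calK ν (mul_pos hz (norm_pos_iff.2 hk))
  have h2 : HasDerivAt (fun z : ℝ => z * ‖k‖) ‖k‖ z := by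
    simpa using (hasDerivAt_id z).mul_const ‖k‖
  have h3 := (h1.comp z h2).ofReal_comp
  refine h3.congr_deriv ?_
  push_cast
  ring

theorem ofReal_calK_recurrence (hk : k ≠ 0) (ν : ℝ) (hz : 0 < z) :
    (calK (ν + 1) (z * ‖k‖) : ℂ)
      = (z : ℂ) ^ 2 * (‖k‖ : ℂ) ^ 2 * (calK (ν - 1) (z * ‖k‖) : ℂ)
        + 2 * ν * (calK ν (z * ‖k‖) : ℂ) := by
  rw [calK_recurrence ν (mul_pos hz (norm_pos_iff.2 hk))]
  push_cast
  ring

/-- The choice `2 𝒦_ν - 𝒦_{ν+1}` makes `H = θF - (d - 2) F`, the combination that the `ij`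
constraint produces from `B = z (F β + s)`. -/
theorem hasDerivAt_besselF (hk : k ≠ 0) (ε : ℝ) (hz : 0 < z) :
    HasDerivAt (besselF k ε) ((besselH k ε z + (d - 2) * besselF k ε z) / z) z := by
  have hz' : (z : ℂ) ≠ 0 := by exact_mod_cast hz.ne'
  refine ((hasDerivAt_calK_comp hk (d / 2) hz).div_const _).congr_deriv ?_
  rw [besselH, besselF, ofReal_calK_recurrence hk (d / 2) hz]
  push_cast
  field_simp
  ring

theorem hasDerivAt_besselH (hk : k ≠ 0) (ε : ℝ) (hz : 0 < z) :
    HasDerivAt (besselH k ε) ((2 * besselH k ε z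
      + (2 * (d - 2) + (‖k‖ : ℂ) ^ 2 * (z : ℂ) ^ 2) * besselF k ε z) / z) z := by
  have hz' : (z : ℂ) ≠ 0 := by exact_mod_cast hz.ne'
  refine ((((hasDerivAt_calK_comp hk (d / 2) hz).const_mul 2).sub
    (hasDerivAt_calK_comp hk (d / 2 + 1) hz)).div_const _).congr_deriv ?_
  rw [besselH, besselF, ofReal_calK_recurrence hk (d / 2) hz, add_sub_cancel_right]
  push_cast
  field_simp
  ring

theorem contDiffOn_calK_comp (hk : k ≠ 0) (ν : ℝ) (n : ℕ) :
    ContDiffOn ℝ n (fun z : ℝ => (calK ν (z * ‖k‖) : ℂ)) (Ioi 0) := by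
  refine Complex.ofRealCLM.contDiff.comp_contDiffOn
    (f := fun z : ℝ => calK ν (z * ‖k‖)) ((contDiffOn_calK n ν).comp
      (contDiff_id.mul contDiff_const).contDiffOn fun z hz => ?_)
  exact mul_pos hz (norm_pos_iff.2 hk)

theorem contDiffOn_besselF (hk : k ≠ 0) (ε : ℝ) (n : ℕ) :
    ContDiffOn ℝ n (besselF k ε) (Ioi 0) :=
  (contDiffOn_calK_comp hk _ n).div_const _

theorem contDiffOn_besselH (hk : k ≠ 0) (ε : ℝ) (n : ℕ) :
    ContDiffOn ℝ n (besselH k ε) (Ioi 0) :=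
  ((contDiffOn_const.mul (contDiffOn_calK_comp hk _ n)).sub
    (contDiffOn_calK_comp hk _ n)).div_const _

theorem norm_ofReal_calK_le (hk : k ≠ 0) (ν : ℝ) (hε : 0 < ε) (hz : ε ≤ z) :
    ‖(calK ν (z * ‖k‖) : ℂ)‖ ≤ calK ν (ε * ‖k‖) := by
  have hk' := norm_pos_iff.2 hk
  rw [Complex.norm_real, Real.norm_of_nonneg (calK_pos ν (mul_pos (hε.trans_le hz) hk')).le]
  exact calK_le_of_le ν (mul_pos hε hk') (by gcongr)

theorem besselF_isBigO (hk : k ≠ 0) (hε : 0 < ε) :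
    besselF k ε =O[atTop] fun _ : ℝ => (1 : ℝ) := by
  refine Asymptotics.IsBigO.of_bound
    (calK (d / 2) (ε * ‖k‖) / ‖(calK (d / 2) (ε * ‖k‖) : ℂ)‖) ?_
  filter_upwards [eventually_ge_atTop ε] with z hz
  rw [besselF, norm_div, norm_one, mul_one]
  gcongr
  exact norm_ofReal_calK_le hk _ hε hz

theorem besselH_isBigO (hk : k ≠ 0) (hε : 0 < ε) :
    besselH k ε =O[atTop] fun _ : ℝ => (1 : ℝ) := by
  refine Asymptotics.IsBigO.of_bound
    ((2 * calK (d / 2) (ε * ‖k‖) + calK (d / 2 + 1) (ε * ‖k‖))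
      / ‖(calK (d / 2) (ε * ‖k‖) : ℂ)‖) ?_
  filter_upwards [eventually_ge_atTop ε] with z hz
  rw [besselH, norm_div, norm_one, mul_one]
  gcongr
  refine (norm_sub_le _ _).trans ?_
  rw [norm_mul, Complex.norm_two]
  gcongr <;> exact norm_ofReal_calK_le hk _ hε hz

/-- The operator `(z ∂_z)² - d z ∂_z - z² k²` on combinations of the profiles and powers of `z`. -/
theorem eulerD_profile (hk : k ≠ 0) (ε : ℝ) (c₁ c₂ c₃ c₄ : ℂ) (hz : 0 < z) :
    eulerD (fun z => besselF k ε z * c₁ + besselH k ε z * c₂ + (z : ℂ) ^ 2 * c₃ + c₄) z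
      = (besselH k ε z + (d - 2) * besselF k ε z) * c₁
        + (2 * besselH k ε z
          + (2 * (d - 2) + (‖k‖ : ℂ) ^ 2 * (z : ℂ) ^ 2) * besselF k ε z) * c₂
        + 2 * (z : ℂ) ^ 2 * c₃ := by
  have hz' : (z : ℂ) ≠ 0 := by exact_mod_cast hz.ne'
  rw [eulerD_eq (f := fun z => besselF k ε z * c₁ + besselH k ε z * c₂ + (z : ℂ) ^ 2 * c₃ + c₄)
    (((((hasDerivAt_besselF hk ε hz).mul_const c₁).add
    ((hasDerivAt_besselH hk ε hz).mul_const c₂)).add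
    (((hasDerivAt_ofReal z).pow 2).mul_const c₃)).add_const c₄)]
  field_simp
  push_cast
  ring

/-- The operator annihilates `F`, so `c₁` is free for fitting boundary values, while `c₂`, `c₃`,
`c₄` are determined by the three kinds of source. -/
theorem bessel_operator_profile (hk : k ≠ 0) (ε : ℝ) (c₁ c₂ c₃ c₄ : ℂ) (hz : 0 < z) :
    eulerD (eulerD fun z =>
        besselF k ε z * c₁ + besselH k ε z * c₂ + (z : ℂ) ^ 2 * c₃ + c₄) z
      - d * eulerD (fun z =>
        besselF k ε z * c₁ + besselH k ε z * c₂ + (z : ℂ) ^ 2 * c₃ + c₄) z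
      - (‖k‖ : ℂ) ^ 2 * (z : ℂ) ^ 2
        * (besselF k ε z * c₁ + besselH k ε z * c₂ + (z : ℂ) ^ 2 * c₃ + c₄)
      = (z : ℂ) ^ 2 * (2 * (‖k‖ : ℂ) ^ 2 * besselF k ε z * c₂
        + (4 - 2 * d - (‖k‖ : ℂ) ^ 2 * (z : ℂ) ^ 2) * c₃ - (‖k‖ : ℂ) ^ 2 * c₄) := by
  have hz' : (z : ℂ) ≠ 0 := by exact_mod_cast hz.ne'
  -- One application of `θ` leaves the span of the profiles only by the term `z² F` coming from `H`;
  -- it is split off as `z (z F)` and differentiated separately.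
  have h1 : EqOn (eulerD fun z =>
        besselF k ε z * c₁ + besselH k ε z * c₂ + (z : ℂ) ^ 2 * c₃ + c₄)
      (fun z => (besselF k ε z * ((d - 2) * c₁ + 2 * (d - 2) * c₂)
        + besselH k ε z * (c₁ + 2 * c₂) + (z : ℂ) ^ 2 * (2 * c₃) + 0)
        + (‖k‖ : ℂ) ^ 2 * c₂ * ((z : ℂ) * (z * besselF k ε z))) (Ioi 0) := fun z hz => by
    simp only [eulerD_profile hk ε c₁ c₂ c₃ c₄ hz]; ring
  have hF := (hasDerivAt_besselF hk ε hz).differentiableAt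
  have hH := (hasDerivAt_besselH hk ε hz).differentiableAt
  have hz1 := (hasDerivAt_ofReal z).differentiableAt
  have hzF := hz1.fun_mul hF
  rw [eulerD_congr h1 hz, eulerD_add (((((hF.mul_const _).fun_add (hH.mul_const _)).fun_add
    ((hz1.fun_pow 2).mul_const _))).add_const _) ((hz1.fun_mul hzF).const_mul _),
    eulerD_profile hk ε _ _ _ _ hz, eulerD_const_mul, eulerD_profile hk ε _ _ _ _ hz]
  beta_reduce
  rw [eulerD_ofReal_mul hzF, eulerD_ofReal_mul hF, eulerD_eq (hasDerivAt_besselF hk ε hz)]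
  field_simp
  ring

end Profile

/-! ### The solution of the Dirichlet problem -/

section Solution

variable (k : EuclideanSpace ℝ (Fin d)) (ε : ℝ) (π : BTensor d)

/-- The constant `ε³ / (4 (d - 2))`. -/
def solC (d : ℕ) (ε : ℝ) : ℂ := (ε : ℂ) ^ 3 / (4 * ((d : ℂ) - 2))

/-- The amplitude of the Bessel profile in the symmetric component. -/
def solBeta (i j : Fin d) : ℂ :=
  -Complex.I * (ε : ℂ) ^ 3 / (besselW (d / 2) (ε * ‖k‖) : ℂ)
    * (divB k π i j + 1 / (2 * (‖k‖ : ℂ) ^ 2) * tensS k π i j)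

/-- The amplitude of the power in the symmetric component. -/
def solS (i j : Fin d) : ℂ := -2 * Complex.I * solC d ε / (‖k‖ : ℂ) ^ 2 * tensS k π i j

/-- The symmetric component of the solution, in the orthonormal frame. -/
def solB (i j : Fin d) (z : ℝ) : ℂ := z * (besselF k ε z * solBeta k ε π i j + solS k ε π i j)

/-- The coefficient of `Z` and of the constant part of the hook component. -/
def solX4 : BTensor d := fun i j l => 1 / (‖k‖ : ℂ) ^ 2 *
  (solC d ε * ((4 - d) / (‖k‖ : ℂ) ^ 2 - (ε : ℂ) ^ 2 / 2) * hookM k (divL k π) i j l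
    + (ε : ℂ) ^ 3 / 2 * hookA k (tensT k π) i j l - 2 * solC d ε * hookZ (divL k π) i j l)

/-- The coefficient of the second Bessel profile in the hook component. -/
def solX2 : BTensor d := fun i j l =>
  -Complex.I / (2 * (‖k‖ : ℂ) ^ 2) * hookS k (solBeta k ε π) i j l

/-- The coefficient of `z²` in the hook component. -/
def solX3 : BTensor d := fun i j l =>
  solC d ε / (2 * (‖k‖ : ℂ) ^ 2) * hookM k (divL k π) i j l

/-- The coefficient of the first Bessel profile in the hook component. -/
def solX1 : BTensor d := fun i j l =>
  (ε : ℂ) ^ 3 * π i j l - (besselW (d / 2) (ε * ‖k‖) : ℂ) * solX2 k ε π i j l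
    - (ε : ℂ) ^ 2 * solX3 k ε π i j l - solX4 k ε π i j l

/-- The hook component of the solution, in the orthonormal frame. -/
def solA (i j l : Fin d) (z : ℝ) : ℂ :=
  besselF k ε z * solX1 k ε π i j l + besselH k ε z * solX2 k ε π i j l
    + (z : ℂ) ^ 2 * solX3 k ε π i j l + solX4 k ε π i j l

variable {k ε π}

/-- Regrouped by tensor structure instead of by radial profile. At `z = ε`, where `F = 1` and `H =
W`, every coefficient except that of `π` vanishes. -/
theorem solA_expand (z : ℝ) : (fun i j l => solA k ε π i j l z) = fun i j l =>
    (besselF k ε z * (ε : ℂ) ^ 3) * π i j l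
    + ((-Complex.I / (2 * (‖k‖ : ℂ) ^ 2)
      * (besselH k ε z - (besselW (d / 2) (ε * ‖k‖) : ℂ) * besselF k ε z))
        * hookS k (solBeta k ε π) i j l
    + ((solC d ε / (2 * (‖k‖ : ℂ) ^ 2) * ((z : ℂ) ^ 2 - (ε : ℂ) ^ 2 * besselF k ε z)
      + (1 - besselF k ε z) / (‖k‖ : ℂ) ^ 2 * solC d ε
        * ((4 - d) / (‖k‖ : ℂ) ^ 2 - (ε : ℂ) ^ 2 / 2)) * hookM k (divL k π) i j l
    + (((1 - besselF k ε z) / (‖k‖ : ℂ) ^ 2 * ((ε : ℂ) ^ 3 / 2)) * hookA k (tensT k π) i j l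
    + ((1 - besselF k ε z) / (‖k‖ : ℂ) ^ 2 * (-2 * solC d ε)) * hookZ (divL k π) i j l))) := by
  funext i j l
  simp only [solA, solX1, solX2, solX3, solX4]
  ring

theorem solA_self (hk : k ≠ 0) (hε : 0 < ε) (i j l : Fin d) :
    solA k ε π i j l ε = (ε : ℂ) ^ 3 * π i j l := by
  rw [solA, besselH_eq hk ε hε, besselF_self hk hε, solX1]; ring

theorem solBeta_symm (h : IsTracelessHook π) (i j : Fin d) :
    solBeta k ε π i j = solBeta k ε π j i := by
  rw [solBeta, solBeta, h.divB_symm, tensS_symm]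

/-- The term `S / (2 k²)` is exactly what makes the amplitude transverse: its contraction `L / 2`
cancels the `-L / 2` of `k^m π_{ij,m}`. -/
theorem contract_solBeta (h : IsTracelessHook π) (hk : k ≠ 0) (i : Fin d) :
    contract k (solBeta k ε π i) = 0 := by
  have hk' := norm_ne_zero' hk
  have h1 : solBeta k ε π i = fun j => -Complex.I * (ε : ℂ) ^ 3
      / (besselW (d / 2) (ε * ‖k‖) : ℂ)
      * (divB k π i j + 1 / (2 * (‖k‖ : ℂ) ^ 2) * tensS k π i j) := rfl
  rw [h1, contract_mul_left, contract_add, contract_mul_left, h.contract_divB, h.contract_tensS]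
  field_simp
  ring

theorem contract_solBeta' (h : IsTracelessHook π) (hk : k ≠ 0) (i : Fin d) :
    contract k (fun m => solBeta k ε π m i) = 0 := by
  rw [← contract_solBeta h hk i]
  congr 1
  funext m
  exact solBeta_symm h m i

theorem trace_solBeta (h : IsTracelessHook π) : ∑ i, solBeta k ε π i i = 0 := by
  simp only [solBeta, ← Finset.mul_sum, Finset.sum_add_distrib, h.trace_divB, h.trace_tensS]
  ring

theorem besselW_ne_zero (hd : 3 ≤ d) (hk : k ≠ 0) (hε : 0 < ε) :
    (besselW (d / 2) (ε * ‖k‖) : ℂ) ≠ 0 := by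
  have hd' : (3 : ℝ) ≤ d := by exact_mod_cast hd
  exact_mod_cast (besselW_neg (by linarith) (mul_pos hε (norm_pos_iff.2 hk))).ne

theorem cast_sub_two_ne_zero (hd : 3 ≤ d) : (d : ℂ) - 2 ≠ 0 := by
  rw [sub_ne_zero]; exact_mod_cast (by omega : d ≠ 2)

theorem solA_trace (hd : 3 ≤ d) (h : IsTracelessHook π) (hk : k ≠ 0) (l : Fin d) (z : ℝ) :
    ∑ i, solA k ε π i i l z = solC d ε * ((z : ℂ) ^ 2 - (ε : ℂ) ^ 2) * divL k π l := by
  have hk' := norm_ne_zero' hk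
  have hd' := cast_sub_two_ne_zero hd
  have h1 := fun i => congrFun (congrFun (congrFun (solA_expand (k := k) (ε := ε) (π := π) z) i) i) l
  simp only [h1, Finset.sum_add_distrib, ← Finset.mul_sum, h.traceless,
    trace_hookS (contract_solBeta' h hk) (trace_solBeta h), trace_hookM h.contract_divL,
    trace_hookA h.contract_tensT, trace_hookZ]
  simp only [solC]
  field_simp
  ring

theorem divB_solA (hd : 3 ≤ d) (h : IsTracelessHook π) (hk : k ≠ 0) (hε : 0 < ε)
    (i j : Fin d) (z : ℝ) :
    divB k (fun i j l => solA k ε π i j l z) i j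
      = Complex.I * besselH k ε z * solBeta k ε π i j
        - Complex.I * (d - 2) * solS k ε π i j
        - 1 / 2 * solC d ε * ((z : ℂ) ^ 2 - (ε : ℂ) ^ 2) * tensS k π i j := by
  have hk' := norm_ne_zero' hk
  have hd' := cast_sub_two_ne_zero hd
  have hW := besselW_ne_zero hd hk hε
  -- The product `W β` contains no Bessel function, so the part proportional to `F` can cancel
  -- algebraically; only `H β` keeps its amplitude.
  have hβ : (besselW (d / 2) (ε * ‖k‖) : ℂ) * solBeta k ε π i j = -Complex.I * (ε : ℂ) ^ 3
      * (divB k π i j + 1 / (2 * (‖k‖ : ℂ) ^ 2) * tensS k π i j) := by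
    rw [solBeta]; field_simp
  rw [solA_expand, divB_mul_add, divB_mul_add, divB_mul_add, divB_mul_add, divB_mul,
    divB_hookS (contract_solBeta h hk), divB_hookM h.contract_divL,
    divB_hookA (tensT_antisymm π) h.contract_tensT, divB_hookZ h.contract_divL]
  rw [show (-Complex.I / (2 * (‖k‖ : ℂ) ^ 2)
      * (besselH k ε z - (besselW (d / 2) (ε * ‖k‖) : ℂ) * besselF k ε z))
      * (-2 * (‖k‖ : ℂ) ^ 2 * solBeta k ε π i j)
      = Complex.I * besselH k ε z * solBeta k ε π i j - Complex.I * besselF k ε z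
        * ((besselW (d / 2) (ε * ‖k‖) : ℂ) * solBeta k ε π i j) by field_simp, hβ]
  simp only [solC, solS, tensS]
  field_simp
  ring_nf
  simp only [Complex.I_sq]
  ring

theorem divA_solA_sub (hd : 3 ≤ d) (h : IsTracelessHook π) (hk : k ≠ 0)
    (i j : Fin d) (z : ℝ) :
    divA k (fun i j l => solA k ε π i j l z) i j - divA k (fun i j l => solA k ε π i j l z) j i
      = (ε : ℂ) ^ 3 * tensT k π i j
        + 3 / 2 * solC d ε * ((z : ℂ) ^ 2 - (ε : ℂ) ^ 2) * tensY k π i j := by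
  have hk' := norm_ne_zero' hk
  have hd' := cast_sub_two_ne_zero hd
  rw [solA_expand]
  simp only [divA_mul_add, divA_mul, divA_hookS (contract_solBeta' h hk), divA_hookM h.contract_divL,
    divA_hookA h.contract_tensT, divA_hookZ h.contract_divL]
  rw [solBeta_symm h j i, tensT_antisymm π j i]
  simp only [solC, tensY]
  have hT : divA k π i j = tensT k π i j + divA k π j i := by rw [tensT]; ring
  rw [hT]
  field_simp
  ring

/-- All the elementary tensors in `solA_expand` project to zero, so the transverse traceless part
keeps only the term in `π`. -/
theorem hookTT_solA (hd : 3 ≤ d) (h : IsTracelessHook π) (hk : k ≠ 0) (i j l : Fin d) (z : ℝ) :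
    hookTT k (fun i j l => solA k ε π i j l z) i j l
      = besselF k ε z * (ε : ℂ) ^ 3 * hookTT k π i j l := by
  have hd' := cast_sub_two_ne_zero hd
  have hL : contract k (fun i => 3 / 2 * divL k π i) = 0 := by
    rw [contract_mul_left, h.contract_divL, mul_zero]
  rw [solA_expand, hookTT_mul_add, hookTT_mul_add, hookTT_mul_add, hookTT_mul_add,
    hookTT_hookS hk (contract_solBeta' h hk) (contract_solBeta h hk) (trace_solBeta h),
    hookTT_hookM hk h.contract_divL,
    hookTT_hookA hk (tensT_antisymm π) h.contract_tensT hL, hookTT_mul,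
    hookTT_hookZ hk hd' h.contract_divL]
  ring

end Solution

end HookAdS
end

noncomputable section

namespace HookAdS

open Set Filter Topology

variable {d : ℕ}

/-! ### Reduction of the field equations to the Bessel equation -/

section Reduced

/-- The values of the traces, of the divergences and of the symmetric component which determine a
hook field in the radial gauge up to its transverse traceless part. -/
structure IsReduced (k : EuclideanSpace ℝ (Fin d)) (ε : ℝ) (π : BTensor d)
    (A : Fin d → Fin d → Fin d → ℝ → ℂ) (B : Fin d → Fin d → ℝ → ℂ) : Prop where
  trFst_eq : ∀ z, ε < z → ∀ l,
    trFst A l z = solC d ε * ((z : ℂ) ^ 2 - (ε : ℂ) ^ 2) * divL k π l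
  sym_eq : ∀ z, ε < z → ∀ i j, B i j z = solB k ε π i j z
  divLst_eq : ∀ z, ε < z → ∀ i j, divLst k A i j z
    = Complex.I * z * (Complex.I * besselH k ε z * solBeta k ε π i j
        - Complex.I * (d - 2) * solS k ε π i j
        - 1 / 2 * solC d ε * ((z : ℂ) ^ 2 - (ε : ℂ) ^ 2) * tensS k π i j)
  divFst_sub : ∀ z, ε < z → ∀ i j, divFst k A i j z - divFst k A j i z
    = Complex.I * z * ((ε : ℂ) ^ 3 * tensT k π i j
        + 3 / 2 * solC d ε * ((z : ℂ) ^ 2 - (ε : ℂ) ^ 2) * tensY k π i j)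

variable {k : EuclideanSpace ℝ (Fin d)} {ε : ℝ} {π : BTensor d}
  {A : Fin d → Fin d → Fin d → ℝ → ℂ} {B : Fin d → Fin d → ℝ → ℂ}

theorem divLst_eq_divB (k : EuclideanSpace ℝ (Fin d)) (A : Fin d → Fin d → Fin d → ℝ → ℂ)
    (i j : Fin d) (z : ℝ) :
    divLst k A i j z = Complex.I * z * divB k (fun i j l => A i j l z) i j := by
  rw [divLst, divB, Finset.mul_sum]; exact Finset.sum_congr rfl fun m _ => by ring

theorem divFst_eq_divA (k : EuclideanSpace ℝ (Fin d)) (A : Fin d → Fin d → Fin d → ℝ → ℂ)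
    (i j : Fin d) (z : ℝ) :
    divFst k A i j z = Complex.I * z * divA k (fun i j l => A i j l z) i j := by
  rw [divFst, divA, Finset.mul_sum]; exact Finset.sum_congr rfl fun m _ => by ring

theorem divSym_eq_contract (k : EuclideanSpace ℝ (Fin d)) (B : Fin d → Fin d → ℝ → ℂ)
    (i : Fin d) (z : ℝ) :
    divSym k B i z = Complex.I * z * contract k (fun m => B m i z) := by
  rw [divSym, contract, Finset.mul_sum]; exact Finset.sum_congr rfl fun m _ => by ring

theorem solB_symm (hπ : IsTracelessHook π) (i j : Fin d) : solB k ε π i j = solB k ε π j i := by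
  funext z
  rw [solB, solB, solBeta_symm hπ, solS, solS, tensS_symm]

theorem solA_symm (hπ : IsTracelessHook π) (i j l : Fin d) :
    solA k ε π i j l = solA k ε π j i l := by
  funext z
  simp only [solA, solX1, solX2, solX3, solX4, hπ.symm j i, hookM_symm _ j i, hookZ_symm _ j i,
    hookA_symm _ j i, hookS_symm (solBeta_symm hπ) j i]

theorem solA_young (hπ : IsTracelessHook π) (i j l : Fin d) (z : ℝ) :
    solA k ε π i j l z + solA k ε π i l j z + solA k ε π l j i z = 0 := by
  have h1 := hπ.young i j l
  have h2 := hookM_young (k := k) (divL k π) i j l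
  have h3 := hookZ_young (divL k π) i j l
  have h4 := hookA_young (k := k) (tensT_antisymm (k := k) π) i j l
  have h5 := hookS_young (k := k) (solBeta_symm (k := k) (ε := ε) hπ) i j l
  have e := fun i j l => congrFun (congrFun (congrFun
    (solA_expand (k := k) (ε := ε) (π := π) z) i) j) l
  simp only [e]
  linear_combination (besselF k ε z * (ε : ℂ) ^ 3) * h1
    + (-Complex.I / (2 * (‖k‖ : ℂ) ^ 2)
      * (besselH k ε z - (besselW (d / 2) (ε * ‖k‖) : ℂ) * besselF k ε z)) * h5
    + (solC d ε / (2 * (‖k‖ : ℂ) ^ 2) * ((z : ℂ) ^ 2 - (ε : ℂ) ^ 2 * besselF k ε z)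
      + (1 - besselF k ε z) / (‖k‖ : ℂ) ^ 2 * solC d ε
        * ((4 - d) / (‖k‖ : ℂ) ^ 2 - (ε : ℂ) ^ 2 / 2)) * h2
    + ((1 - besselF k ε z) / (‖k‖ : ℂ) ^ 2 * ((ε : ℂ) ^ 3 / 2)) * h4
    + ((1 - besselF k ε z) / (‖k‖ : ℂ) ^ 2 * (-2 * solC d ε)) * h3

theorem contDiffOn_solA (hk : k ≠ 0) (i j l : Fin d) :
    ContDiffOn ℝ 2 (solA k ε π i j l) (Ioi 0) :=
  ((((contDiffOn_besselF hk ε 2).mul contDiffOn_const).add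
    ((contDiffOn_besselH hk ε 2).mul contDiffOn_const)).add
    ((Complex.ofRealCLM.contDiff.pow 2).contDiffOn.mul contDiffOn_const)).add contDiffOn_const

theorem contDiffOn_solB (hk : k ≠ 0) (i j : Fin d) :
    ContDiffOn ℝ 2 (solB k ε π i j) (Ioi 0) :=
  Complex.ofRealCLM.contDiff.contDiffOn.mul
    (((contDiffOn_besselF hk ε 2).mul contDiffOn_const).add contDiffOn_const)

theorem isHookPair_sol {ε' : ℝ} (hk : k ≠ 0) (hπ : IsTracelessHook π) (hε : 0 ≤ ε') :
    IsHookPair ε' (solA k ε π) (solB k ε π) where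
  symm z _ i j l := congrFun (solA_symm hπ i j l) z
  young z _ i j l := solA_young hπ i j l z
  symmB z _ i j := congrFun (solB_symm hπ i j) z
  contDiffOn i j l := (contDiffOn_solA hk i j l).mono (Ioi_subset_Ioi hε)
  contDiffOnB i j := (contDiffOn_solB hk i j).mono (Ioi_subset_Ioi hε)

theorem isReduced_sol (hd : 3 ≤ d) (hk : k ≠ 0) (hπ : IsTracelessHook π) (hε : 0 < ε) :
    IsReduced k ε π (solA k ε π) (solB k ε π) where
  trFst_eq z _ l := solA_trace hd hπ hk l z
  sym_eq _ _ _ _ := rfl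
  divLst_eq z _ i j := by rw [divLst_eq_divB, divB_solA hd hπ hk hε]
  divFst_sub z _ i j := by
    rw [divFst_eq_divA, divFst_eq_divA, ← mul_sub, divA_solA_sub hd hπ hk]

theorem contract_solS (hπ : IsTracelessHook π) (hk : k ≠ 0) (i : Fin d) :
    contract k (fun m => solS k ε π m i) = -2 * Complex.I * solC d ε * divL k π i := by
  have hk' := norm_ne_zero' hk
  have h1 : (fun m => tensS k π m i) = tensS k π i := funext fun m => tensS_symm π m i
  simp only [solS, contract_mul_left, h1, hπ.contract_tensS]
  field_simp

theorem solB_trace (hπ : IsTracelessHook π) (z : ℝ) : ∑ i, solB k ε π i i z = 0 := by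
  simp only [solB, solS, ← Finset.mul_sum, Finset.sum_add_distrib, trace_solBeta hπ,
    hπ.trace_tensS]
  ring

theorem eulerD_solB (hk : k ≠ 0) (i j : Fin d) {z : ℝ} (hz : 0 < z) :
    eulerD (solB k ε π i j) z = z * ((besselH k ε z + (d - 1) * besselF k ε z) * solBeta k ε π i j
      + solS k ε π i j) := by
  have h1 : solB k ε π i j = fun z : ℝ => (z : ℂ) * (besselF k ε z * solBeta k ε π i j
      + besselH k ε z * 0 + (z : ℂ) ^ 2 * 0 + solS k ε π i j) := by
    funext z; simp [solB]
  have hF := (hasDerivAt_besselF hk ε hz).differentiableAt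
  have hH := (hasDerivAt_besselH hk ε hz).differentiableAt
  have hz1 := (hasDerivAt_ofReal z).differentiableAt
  rw [h1, eulerD_ofReal_mul ((((hF.mul_const _).fun_add (hH.mul_const _)).fun_add
    ((hz1.fun_pow 2).mul_const _)).add_const _), eulerD_profile hk ε _ _ _ _ hz]
  ring

theorem eulerD_eulerD_solB (hk : k ≠ 0) (i j : Fin d) {z : ℝ} (hz : 0 < z) :
    eulerD (eulerD (solB k ε π i j)) z
      = z * (((d + 2) * besselH k ε z
        + (d ^ 2 - 3 + (‖k‖ : ℂ) ^ 2 * (z : ℂ) ^ 2) * besselF k ε z) * solBeta k ε π i j + solS k ε π i j) := by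
  have h1 : EqOn (eulerD (solB k ε π i j)) (fun z : ℝ => (z : ℂ) *
      (besselF k ε z * ((d - 1) * solBeta k ε π i j)
      + besselH k ε z * solBeta k ε π i j + (z : ℂ) ^ 2 * 0 + solS k ε π i j)) (Ioi 0) := by
    intro z hz
    rw [eulerD_solB hk i j hz]; ring
  have hF := (hasDerivAt_besselF hk ε hz).differentiableAt
  have hH := (hasDerivAt_besselH hk ε hz).differentiableAt
  have hz1 := (hasDerivAt_ofReal z).differentiableAt
  rw [eulerD_congr h1 hz, eulerD_ofReal_mul ((((hF.mul_const _).fun_add (hH.mul_const _)).fun_add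
    ((hz1.fun_pow 2).mul_const _)).add_const _), eulerD_profile hk ε _ _ _ _ hz]
  ring

theorem eulerD_sq_sub (a b : ℂ) (z : ℝ) :
    eulerD (fun z : ℝ => a * ((z : ℂ) ^ 2 - b)) z = a * (2 * (z : ℂ) ^ 2) := by
  rw [eulerD_eq (f := fun z : ℝ => a * ((z : ℂ) ^ 2 - b))
    ((((hasDerivAt_ofReal z).pow 2).sub_const b).const_mul a)]
  push_cast
  ring

/-! ### Consequences of the reduced data for the field equations -/

namespace IsReduced

theorem trace_sym (hr : IsReduced k ε π A B) (hπ : IsTracelessHook π) (z : ℝ) (hz : ε < z) :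
    ∑ i, B i i z = 0 := by
  simp only [hr.sym_eq z hz, solB_trace hπ]

theorem eulerD_trFst (hr : IsReduced k ε π A B) {z : ℝ} (hz : ε < z) (l : Fin d) :
    eulerD (trFst A l) z = 2 * solC d ε * (z : ℂ) ^ 2 * divL k π l := by
  have h1 : EqOn (trFst A l)
      (fun z => (solC d ε * divL k π l) * ((z : ℂ) ^ 2 - (ε : ℂ) ^ 2)) (Ioi ε) := fun z hz => by
    rw [hr.trFst_eq z hz]; ring
  rw [eulerD_congr h1 hz, eulerD_sq_sub]
  ring

theorem eulerD_eulerD_trFst (hr : IsReduced k ε π A B) {z : ℝ} (hz : ε < z) (l : Fin d) :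
    eulerD (eulerD (trFst A l)) z = 4 * solC d ε * (z : ℂ) ^ 2 * divL k π l := by
  have h1 : EqOn (eulerD (trFst A l))
      (fun z => (2 * solC d ε * divL k π l) * ((z : ℂ) ^ 2 - 0)) (Ioi ε) := fun z hz => by
    rw [hr.eulerD_trFst hz]; ring
  rw [eulerD_congr h1 hz, eulerD_sq_sub]
  ring

theorem divSym_eq (hr : IsReduced k ε π A B) (hπ : IsTracelessHook π) (hk : k ≠ 0) {z : ℝ}
    (hz : ε < z) (i : Fin d) : divSym k B i z = 2 * solC d ε * (z : ℂ) ^ 2 * divL k π i := by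
  rw [divSym_eq_contract]
  simp only [hr.sym_eq z hz, solB, contract_mul_left, contract_add, contract_solBeta' hπ hk,
    contract_solS hπ hk]
  linear_combination (-2 * solC d ε * (z : ℂ) ^ 2 * divL k π i) * Complex.I_sq

theorem eulerD_divSym (hr : IsReduced k ε π A B) (hπ : IsTracelessHook π) (hk : k ≠ 0) {z : ℝ}
    (hz : ε < z) (i : Fin d) :
    eulerD (divSym k B i) z = 4 * solC d ε * (z : ℂ) ^ 2 * divL k π i := by
  have h1 : EqOn (divSym k B i)
      (fun z => (2 * solC d ε * divL k π i) * ((z : ℂ) ^ 2 - 0)) (Ioi ε) := fun z hz => by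
    rw [hr.divSym_eq hπ hk hz]; ring
  rw [eulerD_congr h1 hz, eulerD_sq_sub]
  ring

theorem eulerD_sym (hr : IsReduced k ε π A B) {z : ℝ} (hz : ε < z) (i j : Fin d) :
    eulerD (B i j) z = eulerD (solB k ε π i j) z :=
  eulerD_congr (fun z hz => hr.sym_eq z hz i j) hz

theorem eulerD_eulerD_sym (hr : IsReduced k ε π A B) {z : ℝ} (hz : ε < z) (i j : Fin d) :
    eulerD (eulerD (B i j)) z = eulerD (eulerD (solB k ε π i j)) z :=
  eulerD_congr (fun _ hz => hr.eulerD_sym hz i j) hz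

/-- Half the sum of the antisymmetric part, which is given, and of the symmetric part, which the
cyclic identity yields. The zero coefficient of `F` puts the result in profile form, so that
`eulerD_profile` applies. -/
theorem divFst_eq (hr : IsReduced k ε π A B) (h : IsHookPair ε A B) {z : ℝ} (hz : ε < z)
    (i j : Fin d) : divFst k A i j z = Complex.I * (z * (besselF k ε z * 0
      + besselH k ε z * (-(1 / 2) * Complex.I * solBeta k ε π i j)
      + (z : ℂ) ^ 2 * (solC d ε * (3 / 4 * tensY k π i j + 1 / 4 * tensS k π i j))
      + (1 / 2 * (ε : ℂ) ^ 3 * tensT k π i j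
        - (ε : ℂ) ^ 2 * (solC d ε * (3 / 4 * tensY k π i j + 1 / 4 * tensS k π i j))
        + 1 / 2 * Complex.I * (d - 2) * solS k ε π i j))) := by
  linear_combination 1 / 2 * hr.divFst_sub z hz i j + 1 / 2 * h.divFst_add (k := k) hz i j
    - 1 / 2 * hr.divLst_eq z hz i j

theorem eulerD_divFst (hr : IsReduced k ε π A B) (h : IsHookPair ε A B) (hk : k ≠ 0)
    (hε : 0 ≤ ε) {z : ℝ} (hz : ε < z)
    (i j : Fin d) : eulerD (divFst k A i j) z = divFst k A i j z
      + Complex.I * z * ((2 * besselH k ε z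
          + (2 * (d - 2) + (‖k‖ : ℂ) ^ 2 * (z : ℂ) ^ 2) * besselF k ε z)
          * (-(1 / 2) * Complex.I * solBeta k ε π i j)
        + 2 * (z : ℂ) ^ 2 * (solC d ε * (3 / 4 * tensY k π i j + 1 / 4 * tensS k π i j))) := by
  have hz0 : 0 < z := hε.trans_lt hz
  have hF := (hasDerivAt_besselF hk ε hz0).differentiableAt
  have hH := (hasDerivAt_besselH hk ε hz0).differentiableAt
  have hz1 := (hasDerivAt_ofReal z).differentiableAt
  rw [eulerD_congr (fun z hz => hr.divFst_eq h hz i j) hz, eulerD_const_mul, hr.divFst_eq h hz]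
  beta_reduce
  rw [eulerD_ofReal_mul ((((hF.mul_const _).fun_add (hH.mul_const _)).fun_add
    ((hz1.fun_pow 2).mul_const _)).add_const _), eulerD_profile hk ε _ _ _ _ hz0]
  ring

theorem frameEq_zzs (hr : IsReduced k ε π A B) (h : IsHookPair ε A B) (hπ : IsTracelessHook π)
    (hk : k ≠ 0) {z : ℝ} (hz : ε < z) (i : Fin d) :
    frameEq k (gaugeMode A B) 0 0 i.succ z = 0 := by
  rw [h.frameEq_zzs hz, hr.eulerD_divSym hπ hk hz, hr.divSym_eq hπ hk hz, hr.eulerD_trFst hz,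
    hr.eulerD_eulerD_trFst hz]
  ring

theorem frameEq_zsz (hr : IsReduced k ε π A B) (h : IsHookPair ε A B) (hπ : IsTracelessHook π)
    (hk : k ≠ 0) {z : ℝ} (hz : ε < z) (i : Fin d) :
    frameEq k (gaugeMode A B) 0 i.succ 0 z = 0 := by
  rw [h.frameEq_zsz (hr.trace_sym hπ) hz, hr.eulerD_divSym hπ hk hz, hr.divSym_eq hπ hk hz,
    hr.eulerD_trFst hz]
  ring

theorem frameEq_zss (hr : IsReduced k ε π A B) (h : IsHookPair ε A B) (hπ : IsTracelessHook π)
    (hk : k ≠ 0) (hε : 0 ≤ ε) {z : ℝ} (hz : ε < z) (i j : Fin d) :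
    frameEq k (gaugeMode A B) 0 i.succ j.succ z = 0 := by
  have hk' := norm_ne_zero' hk
  rw [h.frameEq_zss (hr.trace_sym hπ) hz, hr.divSym_eq hπ hk hz, hr.eulerD_trFst hz,
    hr.eulerD_divFst h hk hε hz, hr.eulerD_sym hz, eulerD_solB hk i j (hε.trans_lt hz),
    hr.sym_eq z hz]
  simp only [solB, solS, tensS, tensY]
  field_simp
  ring_nf
  simp only [Complex.I_sq]
  ring

theorem frameEq_ssz (hr : IsReduced k ε π A B) (h : IsHookPair ε A B) (hπ : IsTracelessHook π)
    (hk : k ≠ 0) (hε : 0 ≤ ε) {z : ℝ} (hz : ε < z) (i j : Fin d) :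
    frameEq k (gaugeMode A B) i.succ j.succ 0 z = 0 := by
  have hk' := norm_ne_zero' hk
  rw [h.frameEq_ssz (hr.trace_sym hπ) hz, hr.divSym_eq hπ hk hz, hr.divSym_eq hπ hk hz,
    hr.eulerD_eulerD_sym hz, hr.eulerD_sym hz, eulerD_solB hk i j (hε.trans_lt hz),
    eulerD_eulerD_solB hk i j (hε.trans_lt hz), hr.sym_eq z hz, hr.divLst_eq z hz,
    hr.trFst_eq z hz, hr.trFst_eq z hz]
  simp only [solB, solS, tensS]
  field_simp
  ring_nf
  simp only [Complex.I_sq, Complex.I_pow_three]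
  ring

/-- The pivot of both halves of the proof: the source depends only on the reduced data and is
exactly the one generated by the coefficients `solX2`, `solX3`, `solX4`, for whichever pair `A`, `B`
is considered. -/
theorem frameEq_sss (hr : IsReduced k ε π A B) (h : IsHookPair ε A B) (hπ : IsTracelessHook π)
    (hk : k ≠ 0) (hε : 0 ≤ ε) {z : ℝ} (hz : ε < z) (i j l : Fin d) :
    frameEq k (gaugeMode A B) i.succ j.succ l.succ z
      = eulerD (eulerD (A i j l)) z - d * eulerD (A i j l) z
        - (‖k‖ : ℂ) ^ 2 * (z : ℂ) ^ 2 * A i j l z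
        - (z : ℂ) ^ 2 * (2 * (‖k‖ : ℂ) ^ 2 * besselF k ε z * solX2 k ε π i j l
          + (4 - 2 * d - (‖k‖ : ℂ) ^ 2 * (z : ℂ) ^ 2) * solX3 k ε π i j l
          - (‖k‖ : ℂ) ^ 2 * solX4 k ε π i j l) := by
  have hk' := norm_ne_zero' hk
  rw [h.frameEq_sss (hr.trace_sym hπ) hz]
  simp only [hr.divSym_eq hπ hk hz, hr.eulerD_trFst hz,
    hr.eulerD_sym hz, eulerD_solB hk _ _ (hε.trans_lt hz),
    hr.sym_eq z hz, hr.divFst_eq h hz, hr.trFst_eq z hz]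
  simp only [solB, solS, solX2, solX3, solX4, tensS, tensY, hookS, hookM, hookZ, hookA]
  field_simp
  ring_nf
  simp only [Complex.I_sq, Complex.I_pow_three, Complex.I_pow_four]
  ring

theorem frameEq_sss_sol (hd : 3 ≤ d) (hπ : IsTracelessHook π)
    (hk : k ≠ 0) (hε : 0 < ε) {z : ℝ} (hz : ε < z) (i j l : Fin d) :
    frameEq k (gaugeMode (solA k ε π) (solB k ε π)) i.succ j.succ l.succ z = 0 := by
  rw [(isReduced_sol hd hk hπ hε).frameEq_sss (isHookPair_sol hk hπ hε.le) hπ hk hε.le hz]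
  have := bessel_operator_profile hk ε (solX1 k ε π i j l) (solX2 k ε π i j l)
    (solX3 k ε π i j l) (solX4 k ε π i j l) (hε.trans hz)
  rw [← this]
  exact sub_self _

end IsReduced

end Reduced

end HookAdS
end

noncomputable section

namespace HookAdS

open Set Filter Topology

variable {d : ℕ}

/-! ### Existence -/

section Existence

/-- The mode of a hook field in the radial gauge in terms of its frame components. -/
def coordMode (A : Fin d → Fin d → Fin d → ℝ → ℂ) (B : Fin d → Fin d → ℝ → ℂ) : Mode d :=
  fun μ ν ρ z => ((z : ℂ) ^ 3)⁻¹ * gaugeMode A B μ ν ρ z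

variable {k : EuclideanSpace ℝ (Fin d)} {ε : ℝ} {π : BTensor d}
  {A : Fin d → Fin d → Fin d → ℝ → ℂ} {B : Fin d → Fin d → ℝ → ℂ}

theorem planeWave_coordMode (k : EuclideanSpace ℝ (Fin d)) (A : Fin d → Fin d → Fin d → ℝ → ℂ)
    (B : Fin d → Fin d → ℝ → ℂ) (μ ν ρ : Fin (d + 1)) (x : Point d) :
    planeWave k (coordMode A B) μ ν ρ x = framed k 3 (gaugeMode A B μ ν ρ) x := by
  simp only [planeWave, coordMode, framed, wave]; ring

theorem gaugeMode_symm (hA : ∀ i j l, A i j l = A j i l) (hB : ∀ i j, B i j = B j i)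
    (μ ν ρ : Fin (d + 1)) : gaugeMode A B μ ν ρ = gaugeMode A B ν μ ρ := by
  induction μ using Fin.cases <;> induction ν using Fin.cases <;> induction ρ using Fin.cases <;>
    first
    | rfl
    | exact hA _ _ _
    | exact hB _ _

theorem gaugeMode_young {z : ℝ} (hA : ∀ i j l, A i j l z + A i l j z + A l j i z = 0)
    (hB : ∀ i j, B i j z = B j i z) (μ ν ρ : Fin (d + 1)) :
    gaugeMode A B μ ν ρ z + gaugeMode A B μ ρ ν z + gaugeMode A B ρ ν μ z = 0 := by
  induction μ using Fin.cases with
  | zero =>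
    induction ν using Fin.cases with
    | zero => induction ρ using Fin.cases <;> simp
    | succ j =>
      induction ρ using Fin.cases with
      | zero => simp
      | succ l => simp only [gaugeMode_zss, gaugeMode_ssz, hB l j]; ring
  | succ i =>
    induction ν using Fin.cases with
    | zero =>
      induction ρ using Fin.cases with
      | zero => simp
      | succ l => simp only [gaugeMode_szs, gaugeMode_ssz, hB l i]; ring
    | succ j =>
      induction ρ using Fin.cases with
      | zero => simp only [gaugeMode_zss, gaugeMode_szs, gaugeMode_ssz, hB j i]; ring
      | succ l => exact hA i j l

theorem gaugeMode_gauge {z : ℝ} (hB : ∀ i j, B i j z = B j i z) (μ ν : Fin (d + 1)) :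
    gaugeMode A B 0 μ ν z - gaugeMode A B 0 ν μ z = 0 := by
  induction μ using Fin.cases <;> induction ν using Fin.cases <;>
    simp [hB]

theorem IsHookPair.frameConstraint (h : IsHookPair ε A B) (hr : IsReduced k ε π A B)
    (hπ : IsTracelessHook π) (hk : k ≠ 0) {z : ℝ} (hε : 0 ≤ ε) (hz : ε < z)
    (μ ν : Fin (d + 1)) :
    2 * frameDivLast k (gaugeMode A B) μ ν z + frame1 k (frameTrace (gaugeMode A B)) μ ν z
      + frame1 k (frameTrace (gaugeMode A B)) ν μ z = 0 := by
  have htr := hr.trace_sym hπ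
  induction μ using Fin.cases with
  | zero =>
    induction ν using Fin.cases with
    | zero =>
      rw [frameDivLast_zz, frame1_trace_zz, htr z hz, eulerD_sum_eq_zero htr hz]; ring
    | succ j =>
      rw [h.frameDivLast_zs hz, frame1_trace_zs, frame1_trace_sz, htr z hz, hr.eulerD_trFst hz,
        hr.divSym_eq hπ hk hz]
      ring
  | succ i =>
    induction ν using Fin.cases with
    | zero =>
      rw [h.frameDivLast_sz hz, frame1_trace_zs, frame1_trace_sz, htr z hz, hr.eulerD_trFst hz,
        hr.divSym_eq hπ hk hz]
      ring
    | succ j =>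
      rw [h.frameDivLast_ss hz, frame1_trace_ss, frame1_trace_ss, htr z hz, hr.eulerD_sym hz,
        hr.divLst_eq z hz, hr.trFst_eq z hz, hr.trFst_eq z hz, hr.sym_eq z hz,
        eulerD_solB hk i j (hε.trans_lt hz)]
      simp only [solB, tensS]
      linear_combination (2 * z * besselH k ε z * solBeta k ε π i j
        - 2 * z * (d - 2) * solS k ε π i j) * Complex.I_sq

theorem IsReduced.frameConstraintScalar (hr : IsReduced k ε π A B) (hπ : IsTracelessHook π)
    {z : ℝ} (hz : ε < z) : ∑ α, frame1 k (frameTrace (gaugeMode A B)) α α z = 0 := by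
  have htr := hr.trace_sym hπ
  have h0 : ∑ i, (k i : ℂ) * divL k π i = 0 := hπ.contract_divL
  have h1 : ∀ i : Fin d, frame1 k (frameTrace (gaugeMode A B)) i.succ i.succ z
      = Complex.I * z * (solC d ε * ((z : ℂ) ^ 2 - (ε : ℂ) ^ 2)) * ((k i : ℂ) * divL k π i) :=
    fun i => by
      rw [frame1_trace_ss, htr z hz, hr.trFst_eq z hz]; ring
  rw [Fin.sum_univ_succ, frame1_trace_zz, eulerD_sum_eq_zero htr hz]
  simp only [h1, ← Finset.mul_sum, h0]
  ring

theorem frameEq_sol (hd : 3 ≤ d) (hk : k ≠ 0) (hπ : IsTracelessHook π) (hε : 0 < ε) {z : ℝ}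
    (hz : ε < z) (μ ν ρ : Fin (d + 1)) :
    frameEq k (gaugeMode (solA k ε π) (solB k ε π)) μ ν ρ z = 0 := by
  have h := isHookPair_sol (ε := ε) hk hπ hε.le
  have hr := isReduced_sol hd hk hπ hε
  have hs := frameEq_symm k (gaugeMode_symm (solA_symm (k := k) (ε := ε) hπ)
    (solB_symm (k := k) (ε := ε) hπ))
  induction μ using Fin.cases with
  | zero =>
    induction ν using Fin.cases with
    | zero =>
      induction ρ using Fin.cases with
      | zero => exact IsHookPair.frameEq_zzz (hr.trace_sym hπ) hz
      | succ l => exact hr.frameEq_zzs h hπ hk hz l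
    | succ j =>
      induction ρ using Fin.cases with
      | zero => exact hr.frameEq_zsz h hπ hk hz j
      | succ l => exact hr.frameEq_zss h hπ hk hε.le hz j l
  | succ i =>
    induction ν using Fin.cases with
    | zero =>
      rw [hs]
      induction ρ using Fin.cases with
      | zero => exact hr.frameEq_zsz h hπ hk hz i
      | succ l => exact hr.frameEq_zss h hπ hk hε.le hz i l
    | succ j =>
      induction ρ using Fin.cases with
      | zero => exact hr.frameEq_ssz h hπ hk hε.le hz i j
      | succ l => exact IsReduced.frameEq_sss_sol hd hπ hk hε hz i j l

theorem one_isLittleO_exp {η : ℝ} (hη : 0 < η) :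
    (fun _ : ℝ => (1 : ℝ)) =o[atTop] fun z : ℝ => Real.exp (η * z) := by
  simpa using isLittleO_pow_exp_pos_mul_atTop 0 hη

theorem inv_pow_isBigO_one (n : ℕ) :
    (fun z : ℝ => ((z : ℂ) ^ n)⁻¹) =O[atTop] fun _ : ℝ => (1 : ℝ) := by
  refine Asymptotics.IsBigO.of_bound 1 ?_
  filter_upwards [eventually_ge_atTop 1] with z hz
  rw [norm_inv, norm_pow, Complex.norm_real, Real.norm_of_nonneg (by linarith)]
  simpa using inv_le_one_of_one_le₀ (one_le_pow₀ hz)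

theorem pow_isLittleO_exp (n : ℕ) {η : ℝ} (hη : 0 < η) :
    (fun z : ℝ => (z : ℂ) ^ n) =o[atTop] fun z : ℝ => Real.exp (η * z) := by
  have h := isLittleO_pow_exp_pos_mul_atTop n hη
  have h2 : (fun z : ℝ => (z : ℂ) ^ n) = fun z : ℝ => ((z ^ n : ℝ) : ℂ) := by
    funext z; push_cast; rfl
  rw [h2]
  exact (Complex.isBigO_ofReal_left.2 (Asymptotics.isBigO_refl _ _)).trans_isLittleO h

/-- Half of the exponent absorbs the power and half the function. With `n = 3` it carries the growth
condition from coordinate to frame components. -/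
theorem pow_mul_isLittleO_exp (n : ℕ) {f : ℝ → ℂ}
    (hf : ∀ η : ℝ, 0 < η → f =o[atTop] fun z : ℝ => Real.exp (η * z)) {η : ℝ} (hη : 0 < η) :
    (fun z : ℝ => (z : ℂ) ^ n * f z) =o[atTop] fun z : ℝ => Real.exp (η * z) := by
  have h := (pow_isLittleO_exp n (half_pos hη)).mul (hf (η / 2) (half_pos hη))
  refine h.congr_right fun z => ?_
  rw [← Real.exp_add]; congr 1; ring

/-- `F` and `H` are bounded because `𝒦` is decreasing; the remaining terms are polynomial. -/
theorem profile_isLittleO (hk : k ≠ 0) (hε : 0 < ε) (c₁ c₂ c₃ c₄ : ℂ) {η : ℝ} (hη : 0 < η) :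
    (fun z : ℝ => besselF k ε z * c₁ + besselH k ε z * c₂ + (z : ℂ) ^ 2 * c₃ + c₄)
      =o[atTop] fun z : ℝ => Real.exp (η * z) := by
  have h1 : ∀ {f : ℝ → ℂ} (c : ℂ), f =O[atTop] (fun _ : ℝ => (1 : ℝ)) →
      (fun z => f z * c) =o[atTop] fun z : ℝ => Real.exp (η * z) := fun {f} c hf => by
    have : (fun z => f z * c) =O[atTop] fun _ : ℝ => (1 : ℝ) := by
      simp_rw [mul_comm _ c]; exact hf.const_mul_left c
    exact this.trans_isLittleO (one_isLittleO_exp hη)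
  have h2 : (fun z : ℝ => (z : ℂ) ^ 2 * c₃) =o[atTop] fun z : ℝ => Real.exp (η * z) := by
    simp_rw [mul_comm _ c₃]
    exact (pow_isLittleO_exp 2 hη).const_mul_left _
  have h3 : (fun _ : ℝ => c₄) =o[atTop] fun z : ℝ => Real.exp (η * z) :=
    (Asymptotics.isBigO_const_const _ one_ne_zero _).trans_isLittleO (one_isLittleO_exp hη)
  exact (((h1 _ (besselF_isBigO hk hε)).add (h1 _ (besselH_isBigO hk hε))).add h2).add h3

theorem solA_isLittleO (hk : k ≠ 0) (hε : 0 < ε) (i j l : Fin d) {η : ℝ} (hη : 0 < η) :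
    solA k ε π i j l =o[atTop] fun z : ℝ => Real.exp (η * z) :=
  profile_isLittleO hk hε _ _ _ _ hη

theorem solB_isLittleO (hk : k ≠ 0) (hε : 0 < ε) (i j : Fin d) {η : ℝ} (hη : 0 < η) :
    solB k ε π i j =o[atTop] fun z : ℝ => Real.exp (η * z) := by
  have h1 : (fun z => besselF k ε z * solBeta k ε π i j + solS k ε π i j)
      =O[atTop] fun _ : ℝ => (1 : ℝ) := by
    refine Asymptotics.IsBigO.add ?_ (Asymptotics.isBigO_const_const _ one_ne_zero _)
    simp_rw [mul_comm _ (solBeta k ε π i j)]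
    exact (besselF_isBigO hk hε).const_mul_left _
  have h2 := pow_mul_isLittleO_exp 1 (fun η hη => h1.trans_isLittleO (one_isLittleO_exp hη)) hη
  simp only [pow_one] at h2
  exact h2

theorem gaugeMode_isLittleO {η : ℝ}
    (hA : ∀ i j l, A i j l =o[atTop] fun z : ℝ => Real.exp (η * z))
    (hB : ∀ i j, B i j =o[atTop] fun z : ℝ => Real.exp (η * z)) (μ ν ρ : Fin (d + 1)) :
    gaugeMode A B μ ν ρ =o[atTop] fun z : ℝ => Real.exp (η * z) := by
  induction μ using Fin.cases <;> induction ν using Fin.cases <;> induction ρ using Fin.cases <;>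
    first
    | exact Asymptotics.isLittleO_zero _ _
    | exact (hB _ _).const_mul_left _
    | exact hB _ _
    | exact hA _ _ _

theorem isDirichletSolution_sol (hd : 3 ≤ d) (hk : k ≠ 0) (hπ : IsTracelessHook π) (hε : 0 < ε) :
    IsDirichletSolution ε k π (coordMode (solA k ε π) (solB k ε π)) where
  contDiffOn μ ν ρ := by
    refine ContDiffOn.mul ?_ ((isHookPair_sol hk hπ hε.le).contDiffOn_gaugeMode μ ν ρ)
    exact (Complex.ofRealCLM.contDiff.pow 3).contDiffOn.inv fun z hz =>
      pow_ne_zero 3 (Complex.ofReal_ne_zero.2 (hε.trans hz).ne')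
  continuousOn μ ν ρ := by
    have h := (isHookPair_sol (ε := ε) hk hπ le_rfl).contDiffOn_gaugeMode μ ν ρ
    have hsub : Ici ε ⊆ Ioi 0 := fun z hz => hε.trans_le hz
    refine ContinuousOn.mul ?_ (h.continuousOn.mono hsub)
    exact (Complex.continuous_ofReal.pow 3).continuousOn.inv₀ fun z hz =>
      pow_ne_zero 3 (Complex.ofReal_ne_zero.2 (hsub hz).ne')
  symm z _ μ ν ρ := by
    rw [coordMode, coordMode, gaugeMode_symm (solA_symm hπ) (solB_symm hπ) μ ν]
  young z _ μ ν ρ := by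
    have := gaugeMode_young (A := solA k ε π) (B := solB k ε π) (solA_young hπ · · · z)
      (fun i j => congrFun (solB_symm hπ i j) z) μ ν ρ
    simp only [coordMode]
    linear_combination ((z : ℂ) ^ 3)⁻¹ * this
  radialGauge z _ μ ν := by
    have := gaugeMode_gauge (A := solA k ε π) (B := solB k ε π)
      (fun i j => congrFun (solB_symm hπ i j) z) μ ν
    simp only [coordMode]
    linear_combination ((z : ℂ) ^ 3)⁻¹ * this
  field_eq x hx μ ν ρ := by
    rw [fieldEq_framed hε.le (fun μ ν ρ x _ => planeWave_coordMode k _ _ μ ν ρ x)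
      (isHookPair_sol hk hπ hε.le).contDiffOn_gaugeMode μ ν ρ x hx,
      framed_eq_zero_iff _ _ (hε.trans hx)]
    exact frameEq_sol hd hk hπ hε hx μ ν ρ
  constraint_tensor x hx μ ν := by
    rw [constraintTensor_framed hε.le (fun μ ν ρ x _ => planeWave_coordMode k _ _ μ ν ρ x)
      (isHookPair_sol hk hπ hε.le).contDiffOn_gaugeMode μ ν x hx,
      framed_eq_zero_iff _ _ (hε.trans hx)]
    exact (isHookPair_sol hk hπ hε.le).frameConstraint (isReduced_sol hd hk hπ hε) hπ hk hε.le hx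
      μ ν
  constraint_scalar x hx := by
    rw [constraintScalar_framed hε.le (fun μ ν ρ x _ => planeWave_coordMode k _ _ μ ν ρ x)
      (isHookPair_sol hk hπ hε.le).contDiffOn_gaugeMode x hx,
      framed_eq_zero_iff _ _ (hε.trans hx)]
    exact (isReduced_sol hd hk hπ hε).frameConstraintScalar hπ hx
  regular μ ν ρ η hη := by
    have h := (inv_pow_isBigO_one 3).mul_isLittleO (gaugeMode_isLittleO
      (fun i j l => solA_isLittleO (π := π) hk hε i j l hη)
      (fun i j => solB_isLittleO (π := π) hk hε i j hη) μ ν ρ)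
    simp only [one_mul] at h
    exact h
  boundary i j l := by
    have hε' : (ε : ℂ) ≠ 0 := Complex.ofReal_ne_zero.2 hε.ne'
    simp only [coordMode, gaugeMode_sss, solA_self hk hε]
    field_simp

end Existence

end HookAdS
end

noncomputable section

namespace HookAdS

open Set Filter Topology

variable {d : ℕ}

/-! ### Uniqueness -/

/-! ### First-order equations for `θ` on `[ε, ∞)` -/

section FirstOrder

variable {ε : ℝ}

theorem eq_of_eqOn_Ioi {f g : ℝ → ℂ} (hf : ContinuousOn f (Ici ε)) (hg : ContinuousOn g (Ici ε))
    (h : ∀ z, ε < z → f z = g z) {z : ℝ} (hz : ε ≤ z) : f z = g z :=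
  EqOn.of_subset_closure (s := Ioi ε) (fun z hz => h z hz) hf hg Ioi_subset_Ici_self
    (by rw [closure_Ioi]) hz

theorem sub_eq_of_eulerD_eq (hε : 0 < ε) {f g : ℝ → ℂ} (hf : ContinuousOn f (Ici ε))
    (hg : ContinuousOn g (Ici ε)) (hf' : ∀ z, ε < z → DifferentiableAt ℝ f z)
    (hg' : ∀ z, ε < z → DifferentiableAt ℝ g z) (h : ∀ z, ε < z → eulerD f z = eulerD g z)
    {z : ℝ} (hz : ε ≤ z) : f z - g z = f ε - g ε := by
  refine eq_of_hasDerivAt_zero (f := fun z => f z - g z) (hf.sub hg) (fun z hz => ?_) hz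
  refine ((hf' z hz).hasDerivAt.sub (hg' z hz).hasDerivAt).congr_deriv ?_
  have hz' : (z : ℂ) ≠ 0 := Complex.ofReal_ne_zero.2 (hε.trans hz).ne'
  have := h z hz
  rw [eulerD, eulerD] at this
  rw [mul_left_cancel₀ hz' this, sub_self]

theorem hasDerivAt_ofReal_pow (n : ℕ) (z : ℝ) :
    HasDerivAt (fun z : ℝ => (z : ℂ) ^ n) (n * (z : ℂ) ^ (n - 1)) z :=
  ((hasDerivAt_ofReal z).fun_pow n).congr_deriv (mul_one _)

theorem eq_pow_of_eulerD_eq (hε : 0 < ε) (n : ℕ) {f : ℝ → ℂ} (hf : ContinuousOn f (Ici ε))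
    (hf' : ∀ z, ε < z → DifferentiableAt ℝ f z) (h : ∀ z, ε < z → eulerD f z = n * f z)
    {z : ℝ} (hz : ε ≤ z) : f z = (z : ℂ) ^ n * (f ε / (ε : ℂ) ^ n) := by
  have h0 : ∀ z : ℝ, ε ≤ z → (z : ℂ) ≠ 0 := fun z hz =>
    Complex.ofReal_ne_zero.2 (hε.trans_le hz).ne'
  have h1 := eq_of_hasDerivAt_zero (f := fun z => f z / (z : ℂ) ^ n)
    (hf.div (Complex.continuous_ofReal.pow n).continuousOn fun z hz => pow_ne_zero n (h0 z hz))
    (fun z hz => ?_) hz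
  · have := h0 z hz
    field_simp at h1 ⊢
    exact h1
  · have hz' := h0 z hz.le
    refine ((hf' z hz).hasDerivAt.div (hasDerivAt_ofReal_pow n z)
      (pow_ne_zero n hz')).congr_deriv ?_
    have := h z hz
    rw [eulerD] at this
    rw [div_eq_zero_iff]
    left
    rcases n with _ | n
    · simp only [Nat.cast_zero, zero_mul, mul_eq_zero, hz', false_or] at this
      simp [this]
    · rw [Nat.add_sub_cancel, pow_succ]
      linear_combination (z : ℂ) ^ n * this

end FirstOrder

section Uniqueness

variable {k : EuclideanSpace ℝ (Fin d)} {ε : ℝ} {π : BTensor d}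
  {A : Fin d → Fin d → Fin d → ℝ → ℂ} {B : Fin d → Fin d → ℝ → ℂ}

theorem continuousOn_profile (hk : k ≠ 0) (hε : 0 < ε) (c₁ c₂ c₃ c₄ : ℂ) :
    ContinuousOn (fun z : ℝ => besselF k ε z * c₁ + besselH k ε z * c₂ + (z : ℂ) ^ 2 * c₃ + c₄)
      (Ici ε) := by
  have hs : Ici ε ⊆ Ioi 0 := fun z hz => hε.trans_le hz
  have h1 := (contDiffOn_besselF hk ε 2).continuousOn.mono hs
  have h2 := (contDiffOn_besselH hk ε 2).continuousOn.mono hs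
  have h3 := (Complex.continuous_ofReal.pow 2).continuousOn (s := Ici ε)
  exact (((h1.mul continuousOn_const).add (h2.mul continuousOn_const)).add
    (h3.mul continuousOn_const)).add continuousOn_const

theorem contDiffOn_profile (hk : k ≠ 0) (hε : 0 < ε) (c₁ c₂ c₃ c₄ : ℂ) :
    ContDiffOn ℝ 2
      (fun z : ℝ => besselF k ε z * c₁ + besselH k ε z * c₂ + (z : ℂ) ^ 2 * c₃ + c₄)
      (Ioi ε) := by
  have hs : Ioi ε ⊆ Ioi 0 := Ioi_subset_Ioi hε.le
  exact (((((contDiffOn_besselF hk ε 2).mono hs).mul contDiffOn_const).add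
    (((contDiffOn_besselH hk ε 2).mono hs).mul contDiffOn_const)).add
    ((Complex.ofRealCLM.contDiff.pow 2).contDiffOn.mul contDiffOn_const)).add contDiffOn_const

/-- Uniqueness of regular solutions of the inhomogeneous Bessel equation solved by a profile. -/
theorem eq_profile (hd : 1 ≤ d) (hk : k ≠ 0) (hε : 0 < ε) (c₁ c₂ c₃ c₄ : ℂ) {y : ℝ → ℂ}
    (hc : ContinuousOn y (Ici ε)) (hy : ContDiffOn ℝ 2 y (Ioi ε))
    (hode : ∀ z, ε < z →
      eulerD (eulerD y) z - d * eulerD y z - (‖k‖ : ℂ) ^ 2 * (z : ℂ) ^ 2 * y z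
        = (z : ℂ) ^ 2 * (2 * (‖k‖ : ℂ) ^ 2 * besselF k ε z * c₂
          + (4 - 2 * d - (‖k‖ : ℂ) ^ 2 * (z : ℂ) ^ 2) * c₃ - (‖k‖ : ℂ) ^ 2 * c₄))
    (h0 : y ε = besselF k ε ε * c₁ + besselH k ε ε * c₂ + (ε : ℂ) ^ 2 * c₃ + c₄)
    (hreg : ∀ η : ℝ, 0 < η → y =o[atTop] fun z : ℝ => Real.exp (η * z))
    {z : ℝ} (hz : ε ≤ z) :
    y z = besselF k ε z * c₁ + besselH k ε z * c₂ + (z : ℂ) ^ 2 * c₃ + c₄ := by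
  set p : ℝ → ℂ := fun z => besselF k ε z * c₁ + besselH k ε z * c₂ + (z : ℂ) ^ 2 * c₃ + c₄
    with hp
  have hpc : ContinuousOn p (Ici ε) := continuousOn_profile hk hε c₁ c₂ c₃ c₄
  have hp2 : ContDiffOn ℝ 2 p (Ioi ε) := contDiffOn_profile hk hε c₁ c₂ c₃ c₄
  have hE : ∀ z, ε < z → eulerD (fun z => y z - p z) z = eulerD y z - eulerD p z := fun z hz => by
    rw [eulerD, eulerD, eulerD, deriv_fun_sub (differentiableAt_of_contDiffOn hy hz)
      (differentiableAt_of_contDiffOn hp2 hz)]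
    ring
  refine sub_eq_zero.1 (bessel_eq_zero hd hε (norm_pos_iff.2 hk) (y := fun z => y z - p z)
    (hc.sub hpc) (hy.sub hp2) (fun z hz => ?_) (sub_eq_zero.2 h0)
    (fun η hη => (hreg η hη).sub (profile_isLittleO hk hε c₁ c₂ c₃ c₄ hη)) hz)
  have hEE : eulerD (eulerD fun z => y z - p z) z = eulerD (eulerD y) z - eulerD (eulerD p) z := by
    rw [eulerD_congr hE hz, eulerD, deriv_fun_sub (differentiableAt_eulerD hy hz)
      (differentiableAt_eulerD hp2 hz), eulerD, eulerD]
    ring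
  have h1 := bessel_operator_profile hk ε c₁ c₂ c₃ c₄ (hε.trans hz)
  rw [hEE, hE z hz]
  linear_combination hode z hz - h1

/-- The Dirichlet problem in terms of the components in the orthonormal frame. -/
structure IsFrameSolution (k : EuclideanSpace ℝ (Fin d)) (ε : ℝ) (π : BTensor d)
    (A : Fin d → Fin d → Fin d → ℝ → ℂ) (B : Fin d → Fin d → ℝ → ℂ) : Prop
    extends IsHookPair ε A B where
  continuousOn : ∀ i j l, ContinuousOn (A i j l) (Ici ε)
  continuousOnB : ∀ i j, ContinuousOn (B i j) (Ici ε)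
  regular : ∀ i j l, ∀ η : ℝ, 0 < η → A i j l =o[atTop] fun z : ℝ => Real.exp (η * z)
  regularB : ∀ i j, ∀ η : ℝ, 0 < η → B i j =o[atTop] fun z : ℝ => Real.exp (η * z)
  boundary : ∀ i j l, A i j l ε = (ε : ℂ) ^ 3 * π i j l
  frameEq_eq : ∀ z, ε < z → ∀ μ ν ρ, frameEq k (gaugeMode A B) μ ν ρ z = 0
  constraint : ∀ z, ε < z → ∀ μ ν, 2 * frameDivLast k (gaugeMode A B) μ ν z
    + frame1 k (frameTrace (gaugeMode A B)) μ ν z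
    + frame1 k (frameTrace (gaugeMode A B)) ν μ z = 0
  constraintScalar : ∀ z, ε < z → ∑ α, frame1 k (frameTrace (gaugeMode A B)) α α z = 0

/-! ### Triangular resolution of the equations satisfied by an arbitrary solution -/

namespace IsFrameSolution

theorem continuousOn_trFst (h : IsFrameSolution k ε π A B) (l : Fin d) :
    ContinuousOn (trFst A l) (Ici ε) :=
  continuousOn_finsetSum _ fun i _ => h.continuousOn i i l

theorem continuousOn_divA (h : IsFrameSolution k ε π A B) (i j : Fin d) :
    ContinuousOn (fun z => divA k (fun i j l => A i j l z) i j) (Ici ε) :=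
  continuousOn_finsetSum _ fun m _ => continuousOn_const.mul (h.continuousOn m i j)

theorem continuousOn_divB (h : IsFrameSolution k ε π A B) (i j : Fin d) :
    ContinuousOn (fun z => divB k (fun i j l => A i j l z) i j) (Ici ε) :=
  continuousOn_finsetSum _ fun m _ => continuousOn_const.mul (h.continuousOn i j m)

theorem continuousOn_divSym (h : IsFrameSolution k ε π A B) (i : Fin d) :
    ContinuousOn (divSym k B i) (Ici ε) :=
  continuousOn_finsetSum _ fun m _ =>
    (contDiffOn_wave (n := 0) k m).continuousOn.mul (h.continuousOnB m i)

theorem trFst_self (h : IsFrameSolution k ε π A B) (hπ : IsTracelessHook π) (l : Fin d) :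
    trFst A l ε = 0 := by
  simp only [trFst, h.boundary, ← Finset.mul_sum, hπ.traceless, mul_zero]

theorem wave_contract_trFst (h : IsFrameSolution k ε π A B) {z : ℝ} (hz : ε < z) :
    Complex.I * z * contract k (fun i => trFst A i z) = (d - 1) * ∑ i, B i i z := by
  have h1 := h.constraint z hz 0 0
  have h2 := h.constraintScalar z hz
  rw [frameDivLast_zz, frame1_trace_zz] at h1
  rw [Fin.sum_univ_succ, frame1_trace_zz] at h2
  have h3 : ∑ i : Fin d, frame1 k (frameTrace (gaugeMode A B)) i.succ i.succ z
      = Complex.I * z * contract k (fun i => trFst A i z) - d * ∑ i, B i i z := by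
    simp only [frame1_trace_ss, delta_self, Finset.sum_sub_distrib, contract, Finset.mul_sum,
      mul_assoc]
    simp [Finset.mul_sum]
  rw [h3] at h2
  linear_combination h2 - 1 / 2 * h1

/-- The `00` constraint reads `θ tr B = tr B`, so the trace is a multiple of `z`; the multiple
vanishes because at `ε` the trace of `A`, and with it `(d - 1) tr B`, is zero. -/
theorem sum_sym (h : IsFrameSolution k ε π A B) (hd : 3 ≤ d) (hε : 0 < ε)
    (hπ : IsTracelessHook π) {z : ℝ} (hz : ε ≤ z) : ∑ i, B i i z = 0 := by
  have hc : ContinuousOn (fun z => ∑ i, B i i z) (Ici ε) :=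
    continuousOn_finsetSum _ fun i _ => h.continuousOnB i i
  have h1 := eq_pow_of_eulerD_eq hε 1 hc
    (fun z hz => DifferentiableAt.fun_sum fun i _ =>
      differentiableAt_of_contDiffOn (h.contDiffOnB i i) hz)
    (fun z hz => by
      have := h.constraint z hz 0 0
      rw [frameDivLast_zz, frame1_trace_zz] at this
      push_cast
      linear_combination 1 / 2 * this) hz
  -- The constraints hold only for `z > ε`; continuity carries this consequence to the boundary.
  have h2 := eq_of_eqOn_Ioi (f := fun z : ℝ => Complex.I * z * contract k (fun i => trFst A i z))
    (g := fun z => (d - 1) * ∑ i, B i i z)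
    ((continuousOn_const.mul Complex.continuous_ofReal.continuousOn).mul
      (continuousOn_finsetSum _ fun m _ => continuousOn_const.mul (h.continuousOn_trFst m)))
    (continuousOn_const.mul hc) (fun z hz => h.wave_contract_trFst hz) le_rfl
  have hd1 : (d : ℂ) - 1 ≠ 0 := by rw [sub_ne_zero]; exact_mod_cast (by omega : d ≠ 1)
  have h3 : ∑ i, B i i ε = 0 := by
    simpa [h.trFst_self hπ, contract, hd1] using h2.symm
  rw [h1]
  simp [h3]

theorem eulerD_trFst (h : IsFrameSolution k ε π A B) (hd : 3 ≤ d) (hε : 0 < ε)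
    (hπ : IsTracelessHook π) {z : ℝ} (hz : ε < z) (i : Fin d) :
    eulerD (trFst A i) z = divSym k B i z := by
  have := h.constraint z hz 0 i.succ
  rw [h.frameDivLast_zs hz, frame1_trace_zs, frame1_trace_sz, h.sum_sym hd hε hπ hz.le] at this
  linear_combination this

/-- The coefficient of the quadratic part of the trace. -/
def traceCoeff (k : EuclideanSpace ℝ (Fin d)) (ε : ℝ) (B : Fin d → Fin d → ℝ → ℂ)
    (i : Fin d) : ℂ := divSym k B i ε / (2 * (ε : ℂ) ^ 2)

/-- Putting `θ tr A = div B` into the `00,i` equation lowers it to the first-order equation `θ div B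
= 2 div B`. -/
theorem divSym_eq (h : IsFrameSolution k ε π A B) (hd : 3 ≤ d) (hε : 0 < ε)
    (hπ : IsTracelessHook π) {z : ℝ} (hz : ε ≤ z) (i : Fin d) :
    divSym k B i z = 2 * traceCoeff k ε B i * (z : ℂ) ^ 2 := by
  rw [eq_pow_of_eulerD_eq hε 2 (h.continuousOn_divSym i)
    (fun z hz => differentiableAt_of_contDiffOn (h.contDiffOn_divSym i) hz) (fun z hz => ?_) hz,
    traceCoeff]
  · ring
  · have h1 := h.frameEq_eq z hz 0 0 i.succ
    rw [h.frameEq_zzs hz, eulerD_congr (fun z hz => h.eulerD_trFst hd hε hπ hz i) hz,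
      h.eulerD_trFst hd hε hπ hz] at h1
    push_cast
    linear_combination 1 / 2 * h1

theorem trFst_eq (h : IsFrameSolution k ε π A B) (hd : 3 ≤ d) (hε : 0 < ε)
    (hπ : IsTracelessHook π) {z : ℝ} (hz : ε ≤ z) (i : Fin d) :
    trFst A i z = traceCoeff k ε B i * ((z : ℂ) ^ 2 - (ε : ℂ) ^ 2) := by
  have h1 := sub_eq_of_eulerD_eq hε (h.continuousOn_trFst i)
    (g := fun z : ℝ => traceCoeff k ε B i * (z : ℂ) ^ 2)
    (continuousOn_const.mul (Complex.continuous_ofReal.pow 2).continuousOn)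
    (fun z hz => differentiableAt_of_contDiffOn (h.contDiffOn_trFst i) hz)
    (fun z _ => (hasDerivAt_ofReal_pow 2 z).differentiableAt.const_mul _) (fun z hz => ?_) hz
  · rw [h.trFst_self hπ] at h1
    linear_combination h1
  · rw [h.eulerD_trFst hd hε hπ hz, h.divSym_eq hd hε hπ hz.le, eulerD_const_mul]
    beta_reduce
    rw [eulerD_eq (hasDerivAt_ofReal_pow 2 z)]
    push_cast
    ring

theorem contract_traceCoeff (h : IsFrameSolution k ε π A B) (hd : 3 ≤ d) (hε : 0 < ε)
    (hπ : IsTracelessHook π) : contract k (traceCoeff k ε B) = 0 := by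
  -- Any point beyond `ε` would do: at `2ε` the factor `z² - ε² = 3 ε²` is nonzero, and `i z (z² -
  -- ε²)` becomes `6 i ε³`.
  have hz : ε < 2 * ε := by linarith
  have h1 := h.wave_contract_trFst hz
  have hε' : (ε : ℂ) ≠ 0 := Complex.ofReal_ne_zero.2 hε.ne'
  simp only [h.sum_sym hd hε hπ hz.le, h.trFst_eq hd hε hπ hz.le, contract_mul_right] at h1
  have h2 : (6 * Complex.I * (ε : ℂ) ^ 3) * contract k (traceCoeff k ε B) = 0 := by
    push_cast at h1
    linear_combination h1
  refine (mul_eq_zero.1 h2).resolve_left ?_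
  simp [hε', Complex.I_ne_zero]

theorem divLst_eq (h : IsFrameSolution k ε π A B) (hd : 3 ≤ d) (hε : 0 < ε)
    (hπ : IsTracelessHook π) {z : ℝ} (hz : ε < z) (i j : Fin d) :
    divLst k A i j z = -eulerD (B i j) z + (d - 1) * B i j z
      - 1 / 2 * (Complex.I * z * ((z : ℂ) ^ 2 - (ε : ℂ) ^ 2)
        * (k i * traceCoeff k ε B j + k j * traceCoeff k ε B i)) := by
  have h1 := h.constraint z hz i.succ j.succ
  rw [h.frameDivLast_ss hz, frame1_trace_ss, frame1_trace_ss, h.sum_sym hd hε hπ hz.le,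
    h.trFst_eq hd hε hπ hz.le, h.trFst_eq hd hε hπ hz.le] at h1
  linear_combination 1 / 2 * h1

/-- The power part of the symmetric component. -/
def symPower (k : EuclideanSpace ℝ (Fin d)) (ε : ℝ) (B : Fin d → Fin d → ℝ → ℂ)
    (i j : Fin d) : ℂ :=
  -2 * Complex.I / (‖k‖ : ℂ) ^ 2 * (k i * traceCoeff k ε B j + k j * traceCoeff k ε B i)

/-- The Bessel amplitude of the symmetric component. -/
def symAmplitude (k : EuclideanSpace ℝ (Fin d)) (ε : ℝ) (B : Fin d → Fin d → ℝ → ℂ)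
    (i j : Fin d) : ℂ := (ε : ℂ)⁻¹ * B i j ε - symPower k ε B i j

/-- After the last-index divergence is eliminated by the `ij` constraint, the trace terms cancel and
the `ij,0` equation has the coefficients `-(d + 2) θ + (d + 1)`. Division of `B` by `z` turns it
into the Bessel operator, and the source `z²` is matched by the constant `symPower`. -/
theorem inv_mul_sym_eq (h : IsFrameSolution k ε π A B) (hd : 3 ≤ d) (hε : 0 < ε)
    (hk : k ≠ 0) (hπ : IsTracelessHook π) {z : ℝ} (hz : ε ≤ z) (i j : Fin d) :
    (z : ℂ)⁻¹ * B i j z = besselF k ε z * symAmplitude k ε B i j + besselH k ε z * 0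
      + (z : ℂ) ^ 2 * 0 + symPower k ε B i j := by
  have h0 : ∀ z : ℝ, ε ≤ z → (z : ℂ) ≠ 0 := fun z hz =>
    Complex.ofReal_ne_zero.2 (hε.trans_le hz).ne'
  have hk' := norm_ne_zero' hk
  set y : ℝ → ℂ := fun z => (z : ℂ)⁻¹ * B i j z with hy
  have hy2 : ContDiffOn ℝ 2 y (Ioi ε) :=
    (Complex.ofRealCLM.contDiff.contDiffOn.inv fun z hz => h0 z (le_of_lt hz)).mul
      (h.contDiffOnB i j)
  have hB : ∀ z, ε < z → B i j z = z * y z := fun z hz => by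
    rw [hy]; exact (mul_inv_cancel_left₀ (h0 z hz.le) _).symm
  have hB1 : ∀ z, ε < z → eulerD (B i j) z = z * (y z + eulerD y z) := fun z hz => by
    rw [eulerD_congr hB hz, eulerD_ofReal_mul (differentiableAt_of_contDiffOn hy2 hz)]
  have hB2 : ∀ z, ε < z →
      eulerD (eulerD (B i j)) z = z * (y z + 2 * eulerD y z + eulerD (eulerD y) z) :=
    fun z hz => by
      rw [eulerD_congr hB1 hz, eulerD_ofReal_mul ((differentiableAt_of_contDiffOn hy2 hz).fun_add
        (differentiableAt_eulerD hy2 hz)), eulerD_add (differentiableAt_of_contDiffOn hy2 hz)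
        (differentiableAt_eulerD hy2 hz)]
      ring
  refine eq_profile (by omega) hk hε _ 0 0 _ (y := y)
    ((Complex.continuous_ofReal.continuousOn.inv₀ fun z hz => h0 z hz).mul (h.continuousOnB i j))
    hy2 (fun z hz => ?_) ?_ (fun η hη => ?_) hz
  · have h1 := h.frameEq_eq z hz i.succ j.succ 0
    rw [h.frameEq_ssz (fun z hz => h.sum_sym hd hε hπ hz.le) hz, h.divLst_eq hd hε hπ hz,
      h.divSym_eq hd hε hπ hz.le, h.divSym_eq hd hε hπ hz.le, h.trFst_eq hd hε hπ hz.le,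
      h.trFst_eq hd hε hπ hz.le, hB2 z hz, hB1 z hz, hB z hz] at h1
    have hp : (‖k‖ : ℂ) ^ 2 * symPower k ε B i j
        = -2 * Complex.I * (k i * traceCoeff k ε B j + k j * traceCoeff k ε B i) := by
      rw [symPower]; field_simp
    refine mul_left_cancel₀ (h0 z hz.le) ?_
    linear_combination h1 + (z : ℂ) ^ 3 * hp
  · rw [besselF_self hk hε, symAmplitude, hy]; ring
  · have hi : (fun z : ℝ => (z : ℂ)⁻¹) =O[atTop] fun _ : ℝ => (1 : ℝ) := by
      simpa using inv_pow_isBigO_one 1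
    have := hi.mul_isLittleO (h.regularB i j η hη)
    simp only [one_mul] at this
    exact this

theorem sym_eq_profile (h : IsFrameSolution k ε π A B) (hd : 3 ≤ d) (hε : 0 < ε)
    (hk : k ≠ 0) (hπ : IsTracelessHook π) {z : ℝ} (hz : ε ≤ z) (i j : Fin d) :
    B i j z = z * (besselF k ε z * symAmplitude k ε B i j + besselH k ε z * 0
      + (z : ℂ) ^ 2 * 0 + symPower k ε B i j) := by
  rw [← h.inv_mul_sym_eq hd hε hk hπ hz,
    mul_inv_cancel_left₀ (Complex.ofReal_ne_zero.2 (hε.trans_le hz).ne')]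

theorem divB_eq (h : IsFrameSolution k ε π A B) (hd : 3 ≤ d) (hε : 0 < ε)
    (hk : k ≠ 0) (hπ : IsTracelessHook π) {z : ℝ} (hz : ε ≤ z) (i j : Fin d) :
    Complex.I * divB k (fun i j l => A i j l z) i j
      = besselF k ε z * 0 + besselH k ε z * -symAmplitude k ε B i j
        + (z : ℂ) ^ 2 * (-(1 / 2) * Complex.I
          * (k i * traceCoeff k ε B j + k j * traceCoeff k ε B i))
        + ((d - 2) * symPower k ε B i j + 1 / 2 * Complex.I * (ε : ℂ) ^ 2
          * (k i * traceCoeff k ε B j + k j * traceCoeff k ε B i)) := by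
  refine eq_of_eqOn_Ioi (f := fun z => Complex.I * divB k (fun i j l => A i j l z) i j)
    (continuousOn_const.mul (h.continuousOn_divB i j)) (continuousOn_profile hk hε _ _ _ _)
    (fun z hz => ?_) hz
  have hz0 := hε.trans hz
  have hz' : (z : ℂ) ≠ 0 := Complex.ofReal_ne_zero.2 hz0.ne'
  have h1 := h.divLst_eq hd hε hπ hz i j
  rw [divLst_eq_divB, eulerD_congr (fun z hz => h.sym_eq_profile hd hε hk hπ (le_of_lt hz) i j) hz,
    eulerD_ofReal_mul (differentiableAt_of_contDiffOn (contDiffOn_profile hk hε _ _ _ _) hz),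
    eulerD_profile hk ε _ _ _ _ hz0, h.sym_eq_profile hd hε hk hπ hz.le] at h1
  refine mul_left_cancel₀ hz' ?_
  linear_combination h1

theorem contract_symPower (h : IsFrameSolution k ε π A B) (hd : 3 ≤ d) (hε : 0 < ε)
    (hk : k ≠ 0) (hπ : IsTracelessHook π) (i : Fin d) :
    contract k (fun m => symPower k ε B m i) = -2 * Complex.I * traceCoeff k ε B i := by
  have hk' := norm_ne_zero' hk
  simp only [symPower, contract_mul_left, contract_add, contract_mul_right, contract_self,
    h.contract_traceCoeff hd hε hπ]
  field_simp
  ring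

/-- At `z = ε` the power part alone already accounts for the whole divergence of `B`. -/
theorem contract_symAmplitude (h : IsFrameSolution k ε π A B) (hd : 3 ≤ d) (hε : 0 < ε)
    (hk : k ≠ 0) (hπ : IsTracelessHook π) (i : Fin d) :
    contract k (fun m => symAmplitude k ε B m i) = 0 := by
  have hε' : (ε : ℂ) ≠ 0 := Complex.ofReal_ne_zero.2 hε.ne'
  have h1 := h.divSym_eq hd hε hπ le_rfl i
  rw [divSym_eq_contract] at h1
  simp only [h.sym_eq_profile hd hε hk hπ le_rfl, contract_mul_left, contract_add,
    besselF_self hk hε, h.contract_symPower hd hε hk hπ, mul_zero, add_zero] at h1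
  have h2 : Complex.I * (ε : ℂ) ^ 2 * contract k (fun m => symAmplitude k ε B m i) = 0 := by
    linear_combination h1 + 2 * traceCoeff k ε B i * (ε : ℂ) ^ 2 * Complex.I_sq
  exact (mul_eq_zero.1 h2).resolve_left (by simp [hε', Complex.I_ne_zero])

theorem divB_boundary (h : IsFrameSolution k ε π A B) (hd : 3 ≤ d) (hε : 0 < ε)
    (hk : k ≠ 0) (hπ : IsTracelessHook π) (i j : Fin d) :
    Complex.I * (ε : ℂ) ^ 3 * divB k π i j
      = -(besselW (d / 2) (ε * ‖k‖) : ℂ) * symAmplitude k ε B i j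
        + (d - 2) * symPower k ε B i j := by
  have h1 := h.divB_eq hd hε hk hπ le_rfl i j
  simp only [h.boundary, divB_mul, besselH_eq hk ε hε, besselF_self hk hε] at h1
  linear_combination h1

/-- Contraction of the boundary relation with `k` removes the transverse amplitude `β`, leaving
`-(i/2) ε³ L = -2 i (d - 2) c`. This is the origin of the constant `ε³ / (4 (d - 2))`. -/
theorem traceCoeff_eq (h : IsFrameSolution k ε π A B) (hd : 3 ≤ d) (hε : 0 < ε)
    (hk : k ≠ 0) (hπ : IsTracelessHook π) (i : Fin d) :
    traceCoeff k ε B i = solC d ε * divL k π i := by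
  have hd' := cast_sub_two_ne_zero hd
  have h1 := congrArg (contract k) (funext fun m => h.divB_boundary hd hε hk hπ m i)
  simp only [contract_add, contract_mul_left, hπ.contract_divB',
    h.contract_symAmplitude hd hε hk hπ, h.contract_symPower hd hε hk hπ] at h1
  rw [solC, div_mul_eq_mul_div, eq_div_iff (mul_ne_zero (by norm_num) hd')]
  refine mul_left_cancel₀ Complex.I_ne_zero ?_
  linear_combination 2 * h1

theorem symPower_eq (h : IsFrameSolution k ε π A B) (hd : 3 ≤ d) (hε : 0 < ε)
    (hk : k ≠ 0) (hπ : IsTracelessHook π) (i j : Fin d) :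
    symPower k ε B i j = solS k ε π i j := by
  simp only [symPower, h.traceCoeff_eq hd hε hk hπ, solS, tensS]
  ring

/-- With `s` known, the boundary relation is solved for `β`, which requires `W(εk) ≠ 0`. -/
theorem symAmplitude_eq (h : IsFrameSolution k ε π A B) (hd : 3 ≤ d) (hε : 0 < ε)
    (hk : k ≠ 0) (hπ : IsTracelessHook π) (i j : Fin d) :
    symAmplitude k ε B i j = solBeta k ε π i j := by
  have hd' := cast_sub_two_ne_zero hd
  have hk' := norm_ne_zero' hk
  have hW := besselW_ne_zero hd hk hε
  have h1 := h.divB_boundary hd hε hk hπ i j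
  rw [h.symPower_eq hd hε hk hπ] at h1
  have h2 : ((d : ℂ) - 2) * solS k ε π i j
      = -Complex.I * (ε : ℂ) ^ 3 * (1 / (2 * (‖k‖ : ℂ) ^ 2) * tensS k π i j) := by
    rw [solS, solC]; field_simp; ring
  rw [solBeta, div_mul_eq_mul_div, eq_div_iff hW]
  linear_combination h1 + h2

theorem sym_eq (h : IsFrameSolution k ε π A B) (hd : 3 ≤ d) (hε : 0 < ε)
    (hk : k ≠ 0) (hπ : IsTracelessHook π) {z : ℝ} (hz : ε ≤ z) (i j : Fin d) :
    B i j z = solB k ε π i j z := by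
  rw [h.sym_eq_profile hd hε hk hπ hz, h.symAmplitude_eq hd hε hk hπ, h.symPower_eq hd hε hk hπ,
    solB]
  ring

theorem differentiableAt_divA (h : IsFrameSolution k ε π A B) {z : ℝ} (hz : ε < z)
    (i j : Fin d) : DifferentiableAt ℝ (fun z => divA k (fun i j l => A i j l z) i j) z :=
  DifferentiableAt.fun_sum fun m _ =>
    (differentiableAt_of_contDiffOn (h.contDiffOn m i j) hz).const_mul _

/-- In the antisymmetric part of the `0i,j` equation every term in `B` itself cancels, leaving `θ`
of the divergence equal to `3 c z² Y`, with `c = solC d ε`; integration starts from the value at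
`ε`. -/
theorem divA_sub (h : IsFrameSolution k ε π A B) (hd : 3 ≤ d) (hε : 0 < ε)
    (hk : k ≠ 0) (hπ : IsTracelessHook π) {z : ℝ} (hz : ε ≤ z) (i j : Fin d) :
    divA k (fun i j l => A i j l z) i j - divA k (fun i j l => A i j l z) j i
      = (ε : ℂ) ^ 3 * tensT k π i j
        + 3 / 2 * solC d ε * ((z : ℂ) ^ 2 - (ε : ℂ) ^ 2) * tensY k π i j := by
  have htr : ∀ z, ε < z → ∑ i, B i i z = 0 := fun z hz => h.sum_sym hd hε hπ hz.le
  have hE : ∀ z, ε < z → ∀ i j, eulerD (divFst k A i j) z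
      = Complex.I * z * (divA k (fun i j l => A i j l z) i j
        + eulerD (fun z => divA k (fun i j l => A i j l z) i j) z) := fun z hz i j => by
    have e : divFst k A i j
        = fun z : ℝ => Complex.I * ((z : ℂ) * divA k (fun i j l => A i j l z) i j) :=
      funext fun z => by rw [divFst_eq_divA, mul_assoc]
    rw [e, eulerD_const_mul]
    beta_reduce
    rw [eulerD_ofReal_mul (h.differentiableAt_divA hz i j)]
    ring
  have hB : ∀ z, ε < z → eulerD (B j i) z = eulerD (B i j) z := fun z hz =>
    eulerD_congr (fun z hz => h.symmB z hz j i) hz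
  have h1 := sub_eq_of_eulerD_eq hε
    (f := fun z => divA k (fun i j l => A i j l z) i j + -1 * divA k (fun i j l => A i j l z) j i)
    (g := fun z : ℝ => 3 / 2 * solC d ε * tensY k π i j * (z : ℂ) ^ 2)
    ((h.continuousOn_divA i j).add (continuousOn_const.mul (h.continuousOn_divA j i)))
    (continuousOn_const.mul (Complex.continuous_ofReal.pow 2).continuousOn)
    (fun z hz => (h.differentiableAt_divA hz i j).add
      ((h.differentiableAt_divA hz j i).const_mul _))
    (fun z _ => (hasDerivAt_ofReal_pow 2 z).differentiableAt.const_mul _) (fun z hz => ?_) hz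
  · simp only [h.boundary, divA_mul] at h1
    rw [tensT]
    linear_combination h1
  · have h2 := h.frameEq_eq z hz 0 i.succ j.succ
    have h3 := h.frameEq_eq z hz 0 j.succ i.succ
    rw [h.frameEq_zss htr hz, hE z hz, divFst_eq_divA, h.divSym_eq hd hε hπ hz.le,
      h.eulerD_trFst hd hε hπ hz, h.divSym_eq hd hε hπ hz.le, h.traceCoeff_eq hd hε hk hπ] at h2 h3
    rw [hB z hz, h.symmB z hz j i] at h3
    rw [eulerD_add (h.differentiableAt_divA hz i j) ((h.differentiableAt_divA hz j i).const_mul _),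
      eulerD_const_mul, eulerD_const_mul]
    beta_reduce
    rw [eulerD_eq (hasDerivAt_ofReal_pow 2 z)]
    have hz' : (z : ℂ) ≠ 0 := Complex.ofReal_ne_zero.2 (hε.trans hz).ne'
    refine mul_left_cancel₀ (mul_ne_zero Complex.I_ne_zero hz') ?_
    rw [tensY]
    push_cast
    linear_combination h3 - h2

theorem isReduced (h : IsFrameSolution k ε π A B) (hd : 3 ≤ d) (hε : 0 < ε)
    (hk : k ≠ 0) (hπ : IsTracelessHook π) : IsReduced k ε π A B where
  trFst_eq z hz l := by rw [h.trFst_eq hd hε hπ hz.le, h.traceCoeff_eq hd hε hk hπ]; ring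
  sym_eq z hz i j := h.sym_eq hd hε hk hπ hz.le i j
  divLst_eq z hz i j := by
    have h1 := h.divB_eq hd hε hk hπ hz.le i j
    rw [h.symAmplitude_eq hd hε hk hπ, h.symPower_eq hd hε hk hπ, h.traceCoeff_eq hd hε hk hπ,
      h.traceCoeff_eq hd hε hk hπ] at h1
    rw [divLst_eq_divB, tensS]
    linear_combination (z : ℂ) * h1 - z * (besselH k ε z * solBeta k ε π i j
      - (d - 2) * solS k ε π i j) * Complex.I_sq
  divFst_sub z hz i j := by
    rw [divFst_eq_divA, divFst_eq_divA, ← mul_sub, h.divA_sub hd hε hk hπ hz.le]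

/-- Each component solves the same inhomogeneous Bessel equation, with the same boundary value, as
the explicit one, and neither grows exponentially. -/
theorem hook_eq (h : IsFrameSolution k ε π A B) (hd : 3 ≤ d) (hε : 0 < ε)
    (hk : k ≠ 0) (hπ : IsTracelessHook π) {z : ℝ} (hz : ε ≤ z) (i j l : Fin d) :
    A i j l z = solA k ε π i j l z := by
  refine eq_profile (by omega) hk hε _ _ _ _ (h.continuousOn i j l) (h.contDiffOn i j l)
    (fun z hz => ?_) ?_ (h.regular i j l) hz
  · have h1 := (h.isReduced hd hε hk hπ).frameEq_sss h.toIsHookPair hπ hk hε.le hz i j l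
    rw [h.frameEq_eq z hz] at h1
    linear_combination -h1
  · rw [h.boundary, ← solA_self hk hε, solA]

end IsFrameSolution

theorem IsDirichletSolution.eq_coordMode {Φ : Mode d} (h : IsDirichletSolution ε k π Φ)
    (hε : 0 < ε) {z : ℝ} (hz : ε ≤ z) (μ ν ρ : Fin (d + 1)) :
    Φ μ ν ρ z = coordMode (fun i j l z => (z : ℂ) ^ 3 * Φ i.succ j.succ l.succ z)
      (fun i j z => (z : ℂ) ^ 3 * Φ i.succ j.succ 0 z) μ ν ρ z := by
  have hz' : (z : ℂ) ≠ 0 := Complex.ofReal_ne_zero.2 (hε.trans_le hz).ne'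
  have hs := h.symm z hz
  have hy := h.young z hz
  have hg := h.radialGauge z hz
  -- By symmetry and the gauge condition the three terms of the cyclic identity coincide, so each
  -- vanishes. With one normal index, two of the three coincide, hence the factor `-1/2` in the next
  -- step.
  have hzz : ∀ ρ, Φ 0 0 ρ z = 0 := fun ρ => by
    linear_combination 1 / 3 * (hy 0 0 ρ - hs ρ 0 0) + 2 / 3 * hg 0 ρ
  have hzs : ∀ i j, Φ 0 i j z = -(1 / 2) * Φ i j 0 z := fun i j => by
    linear_combination 1 / 2 * (hy i j 0 - hs i 0 j + hg i j)
  have hzsz : ∀ ρ, Φ 0 ρ 0 z = 0 := fun ρ => by rw [← sub_eq_zero.1 (hg 0 ρ), hzz]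
  rw [coordMode]
  induction μ using Fin.cases with
  | zero =>
    induction ν using Fin.cases with
    | zero => rw [hzz, gaugeMode_zz]; simp
    | succ j =>
      induction ρ using Fin.cases with
      | zero => rw [hzsz, gaugeMode_zsz]; simp
      | succ l => rw [hzs, gaugeMode_zss]; field_simp
  | succ i =>
    induction ν using Fin.cases with
    | zero =>
      rw [hs]
      induction ρ using Fin.cases with
      | zero => rw [hzsz, gaugeMode_szz]; simp
      | succ l => rw [hzs, gaugeMode_szs]; field_simp
    | succ j =>
      induction ρ using Fin.cases with
      | zero => rw [gaugeMode_ssz]; field_simp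
      | succ l => rw [gaugeMode_sss]; field_simp

theorem IsDirichletSolution.isFrameSolution {Φ : Mode d} (h : IsDirichletSolution ε k π Φ)
    (hε : 0 < ε) : IsFrameSolution k ε π
      (fun i j l z => (z : ℂ) ^ 3 * Φ i.succ j.succ l.succ z)
      (fun i j z => (z : ℂ) ^ 3 * Φ i.succ j.succ 0 z) := by
  have hp : IsHookPair ε (fun i j l z => (z : ℂ) ^ 3 * Φ i.succ j.succ l.succ z)
      (fun i j z => (z : ℂ) ^ 3 * Φ i.succ j.succ 0 z) :=
    { symm := fun z hz i j l => by rw [h.symm z hz.le]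
      young := fun z hz i j l => by rw [← mul_add, ← mul_add, h.young z hz.le, mul_zero]
      symmB := fun z hz i j => by rw [h.symm z hz.le]
      contDiffOn := fun i j l =>
        (Complex.ofRealCLM.contDiff.pow 3).contDiffOn.mul (h.contDiffOn _ _ _)
      contDiffOnB := fun i j =>
        (Complex.ofRealCLM.contDiff.pow 3).contDiffOn.mul (h.contDiffOn _ _ _) }
  have hφ : ∀ μ ν ρ (x : Point d), ε < x 0 → planeWave k Φ μ ν ρ x
      = framed k 3 (gaugeMode (fun i j l z => (z : ℂ) ^ 3 * Φ i.succ j.succ l.succ z)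
        (fun i j z => (z : ℂ) ^ 3 * Φ i.succ j.succ 0 z) μ ν ρ) x := fun μ ν ρ x hx => by
    rw [← planeWave_coordMode, planeWave, planeWave, h.eq_coordMode hε hx.le]
  exact
    { toIsHookPair := hp
      continuousOn := fun i j l =>
        (Complex.continuous_ofReal.pow 3).continuousOn.mul (h.continuousOn _ _ _)
      continuousOnB := fun i j =>
        (Complex.continuous_ofReal.pow 3).continuousOn.mul (h.continuousOn _ _ _)
      regular := fun i j l η hη => pow_mul_isLittleO_exp 3 (h.regular _ _ _) hη
      regularB := fun i j η hη => pow_mul_isLittleO_exp 3 (h.regular _ _ _) hη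
      boundary := fun i j l => by rw [h.boundary]
      frameEq_eq := fun z hz μ ν ρ => by
        -- Any point at height `z` serves, since the wave factor is invertible; the constant one is
        -- chosen.
        have h1 := h.field_eq (fun _ => z) hz μ ν ρ
        rwa [fieldEq_framed hε.le hφ hp.contDiffOn_gaugeMode μ ν ρ _ hz,
          framed_eq_zero_iff _ _ (hε.trans hz)] at h1
      constraint := fun z hz μ ν => by
        have h1 := h.constraint_tensor (fun _ => z) hz μ ν
        rwa [constraintTensor_framed hε.le hφ hp.contDiffOn_gaugeMode μ ν _ hz,
          framed_eq_zero_iff _ _ (hε.trans hz)] at h1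
      constraintScalar := fun z hz => by
        have h1 := h.constraint_scalar (fun _ => z) hz
        rwa [constraintScalar_framed hε.le hφ hp.contDiffOn_gaugeMode _ hz,
          framed_eq_zero_iff _ _ (hε.trans hz)] at h1 }

theorem IsDirichletSolution.eq_sol {Φ : Mode d} (h : IsDirichletSolution ε k π Φ) (hd : 3 ≤ d)
    (hε : 0 < ε) (hk : k ≠ 0) (hπ : IsTracelessHook π) {z : ℝ} (hz : ε ≤ z)
    (μ ν ρ : Fin (d + 1)) : Φ μ ν ρ z = coordMode (solA k ε π) (solB k ε π) μ ν ρ z := by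
  have hf := h.isFrameSolution hε
  rw [h.eq_coordMode hε hz, coordMode, coordMode]
  congr 1
  have hA := fun i j l => hf.hook_eq hd hε hk hπ hz i j l
  have hB := fun i j => hf.sym_eq hd hε hk hπ hz i j
  induction μ using Fin.cases <;> induction ν using Fin.cases <;> induction ρ using Fin.cases <;>
    first
    | rfl
    | exact hA _ _ _
    | exact hB _ _
    | exact congrArg (-(1 / 2 : ℂ) * ·) (hB _ _)

end Uniqueness

end HookAdS
end

noncomputable section

namespace HookAdS

open Set Filter Topology

variable {d : ℕ}

/-! ### The components of the solution -/

section Explicit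

variable {k : EuclideanSpace ℝ (Fin d)} {ε : ℝ} {π : BTensor d}

theorem contract_tensY (hπ : IsTracelessHook π) (i : Fin d) :
    contract k (fun m => tensY k π m i) = (‖k‖ : ℂ) ^ 2 * divL k π i := by
  simp only [tensY, contract_sub, contract_mul_left, contract_mul_right, contract_self,
    hπ.contract_divL]
  ring

theorem divA_solA_add (hπ : IsTracelessHook π) (i j : Fin d) (z : ℝ) :
    divA k (fun i j l => solA k ε π i j l z) i j + divA k (fun i j l => solA k ε π i j l z) j i
      = -divB k (fun i j l => solA k ε π i j l z) i j := by
  rw [divA, divA, divB, ← Finset.sum_add_distrib, ← Finset.sum_neg_distrib]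
  refine Finset.sum_congr rfl fun m _ => ?_
  have h1 := solA_young (k := k) (ε := ε) hπ i j m z
  have h2 := congrFun (solA_symm (k := k) (ε := ε) hπ i m j) z
  linear_combination (k m : ℂ) * (h1 - h2)

theorem four_mul_solC (hd : 3 ≤ d) (ε : ℝ) : 4 * ((d : ℂ) - 2) * solC d ε = (ε : ℂ) ^ 3 := by
  have := cast_sub_two_ne_zero hd
  rw [solC]; field_simp

theorem divL_solA (hd : 3 ≤ d) (hπ : IsTracelessHook π) (hk : k ≠ 0) (hε : 0 < ε) (j : Fin d)
    (z : ℝ) : divL k (fun i j l => solA k ε π i j l z) j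
      = (4 * ((d : ℂ) - 2) + (‖k‖ : ℂ) ^ 2 * ((z : ℂ) ^ 2 - (ε : ℂ) ^ 2)) * solC d ε
        * divL k π j := by
  have hA : ∀ m, divA k (fun i j l => solA k ε π i j l z) m j
      = 1 / 2 * ((ε : ℂ) ^ 3 * tensT k π m j
        + 3 / 2 * solC d ε * ((z : ℂ) ^ 2 - (ε : ℂ) ^ 2) * tensY k π m j
        - (Complex.I * besselH k ε z * solBeta k ε π m j
          - Complex.I * (d - 2) * solS k ε π m j
          - 1 / 2 * solC d ε * ((z : ℂ) ^ 2 - (ε : ℂ) ^ 2) * tensS k π m j)) := fun m => by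
    rw [← divA_solA_sub hd hπ hk, ← divB_solA hd hπ hk hε]
    linear_combination 1 / 2 * divA_solA_add (k := k) (ε := ε) hπ m j z
  have hS : (fun m => tensS k π m j) = tensS k π j := funext fun m => tensS_symm π m j
  rw [divL_eq]
  simp only [hA, contract_mul_left, contract_add, contract_sub, hπ.contract_tensT,
    contract_tensY hπ, contract_solBeta' hπ hk, contract_solS hπ hk, hS, hπ.contract_tensS]
  rw [← four_mul_solC hd ε]
  linear_combination (-(1 / 2) * ((d : ℂ) - 2) * 2 * solC d ε * divL k π j) * Complex.I_sq

theorem auxX_solA (hd : 3 ≤ d) (hπ : IsTracelessHook π) (hk : k ≠ 0) (hε : 0 < ε) (l : Fin d)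
    (z : ℝ) : auxX k (fun i j l => solA k ε π i j l z) l
      = -(4 * ((d : ℂ) - 2) * solC d ε / (‖k‖ : ℂ) ^ 2) * divL k π l := by
  have hk' := norm_ne_zero' hk
  simp only [auxX_eq, divL_solA hd hπ hk hε, solA_trace hd hπ hk, contract_mul_left,
    hπ.contract_divL]
  field_simp
  ring

/-- The definition of the transverse traceless part is solved for the tensor itself: the double
divergence and the auxiliary vector are known multiples of `L`, which produce the `M` and `Z` terms.
-/
theorem solA_eq_longitudinal (hd : 3 ≤ d) (hπ : IsTracelessHook π) (hk : k ≠ 0) (hε : 0 < ε)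
    (i j l : Fin d) (z : ℝ) : solA k ε π i j l z
      = besselF k ε z * (ε : ℂ) ^ 3 * hookTT k π i j l
        + 1 / (‖k‖ : ℂ) ^ 2 * longitudinal k (fun i j l => solA k ε π i j l z) i j l
        - solC d ε / (2 * (‖k‖ : ℂ) ^ 2) * ((z : ℂ) ^ 2 - (ε : ℂ) ^ 2
          + 4 * ((d : ℂ) - 3) / (‖k‖ : ℂ) ^ 2) * tensM3 k π i j l
        - 2 * solC d ε / (‖k‖ : ℂ) ^ 2 * tensZ k π i j l := by
  have hk' := norm_ne_zero' hk
  have hd' := cast_sub_two_ne_zero hd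
  have h := hookTT_solA (ε := ε) hd hπ hk i j l z
  simp only [hookTT, divL_solA hd hπ hk hε, auxX_solA hd hπ hk hε] at h
  simp only [hookTT, longitudinal, tensM3, tensZ]
  simp only [proj] at h ⊢
  rw [← sub_eq_zero] at h ⊢
  rw [← h]
  field_simp
  ring

theorem hookPart_sol (z : ℝ) : hookPart (coordMode (solA k ε π) (solB k ε π)) z
    = fun i j l => ((z : ℂ) ^ 3)⁻¹ * solA k ε π i j l z := rfl

theorem scalarTrace_sol (hπ : IsTracelessHook π) (z : ℝ) :
    scalarTrace (coordMode (solA k ε π) (solB k ε π)) z = 0 := by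
  simp only [scalarTrace, symPart, coordMode, gaugeMode_ssz, ← Finset.mul_sum, solB_trace hπ,
    mul_zero]

theorem vecTrace_sol (hd : 3 ≤ d) (hπ : IsTracelessHook π) (hk : k ≠ 0) {z : ℝ} (hz : 0 < z)
    (l : Fin d) : vecTrace (coordMode (solA k ε π) (solB k ε π)) z l
      = (ε : ℂ) ^ 3 / (4 * ((d : ℂ) - 2)) * (1 / (z : ℂ) - (ε : ℂ) ^ 2 / (z : ℂ) ^ 3)
          * divL k π l := by
  have hz' : (z : ℂ) ≠ 0 := Complex.ofReal_ne_zero.2 hz.ne'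
  simp only [vecTrace, hookPart_sol, ← Finset.mul_sum, solA_trace hd hπ hk, solC]
  field_simp

theorem symPart_sol (hd : 3 ≤ d) (hk : k ≠ 0) (hε : 0 < ε) {z : ℝ}
    (hz : 0 < z) (i j : Fin d) : symPart (coordMode (solA k ε π) (solB k ε π)) z i j
      = -Complex.I * ((ε : ℂ) / z) ^ 2 * ((ε : ℂ) / (besselW (d / 2) (ε * ‖k‖) : ℂ))
            * ((calK (d / 2) (z * ‖k‖) : ℂ) / (calK (d / 2) (ε * ‖k‖) : ℂ))
            * (divB k π i j + 1 / (2 * (‖k‖ : ℂ) ^ 2) * tensS k π i j)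
          - Complex.I * (ε : ℂ) / (2 * ((d : ℂ) - 2)) * ((ε : ℂ) / z) ^ 2
            * (1 / (‖k‖ : ℂ) ^ 2) * tensS k π i j := by
  have hz' : (z : ℂ) ≠ 0 := Complex.ofReal_ne_zero.2 hz.ne'
  have hk' := norm_ne_zero' hk
  have hd' := cast_sub_two_ne_zero hd
  have hW := besselW_ne_zero hd hk hε
  simp only [symPart, coordMode, gaugeMode_ssz, solB, solBeta, solS, solC]
  rw [← besselF]
  field_simp
  ring

theorem divB_sol (hd : 3 ≤ d) (hπ : IsTracelessHook π) (hk : k ≠ 0) (hε : 0 < ε) {z : ℝ}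
    (hz : 0 < z) (i j : Fin d) :
    divB k (hookPart (coordMode (solA k ε π) (solB k ε π)) z) i j
      = 1 / 2 * ((ε : ℂ) / z) ^ 3
            * ((besselW (d / 2) (z * ‖k‖) : ℂ) / (besselW (d / 2) (ε * ‖k‖) : ℂ))
            * ((calK (d / 2) (z * ‖k‖) : ℂ) / (calK (d / 2) (ε * ‖k‖) : ℂ)) * tensM2 k π i j
          - (ε : ℂ) ^ 3 / (4 * ((d : ℂ) - 2))
            * (2 * ((d : ℂ) - 2) / ((z : ℂ) ^ 3 * (‖k‖ : ℂ) ^ 2)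
                - (ε : ℂ) ^ 2 / (2 * (z : ℂ) ^ 3) + 1 / (2 * (z : ℂ)))
            * tensS k π i j := by
  have hz' : (z : ℂ) ≠ 0 := Complex.ofReal_ne_zero.2 hz.ne'
  have hk' := norm_ne_zero' hk
  have hd' := cast_sub_two_ne_zero hd
  have hW := besselW_ne_zero hd hk hε
  rw [hookPart_sol, divB_mul, divB_solA hd hπ hk hε, besselH_eq hk ε hz]
  simp only [solBeta, solS, solC, tensM2]
  rw [← besselF]
  field_simp
  ring_nf
  simp only [Complex.I_sq]
  ring

theorem divA_sol_sub (hd : 3 ≤ d) (hπ : IsTracelessHook π) (hk : k ≠ 0) {z : ℝ}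
    (hz : 0 < z) (i j : Fin d) :
    divA k (hookPart (coordMode (solA k ε π) (solB k ε π)) z) i j
      - divA k (hookPart (coordMode (solA k ε π) (solB k ε π)) z) j i
      = ((ε : ℂ) / z) ^ 3 * tensT k π i j
          + 3 / 2 * ((ε : ℂ) ^ 3 / (4 * ((d : ℂ) - 2)))
            * (1 / (z : ℂ) - (ε : ℂ) ^ 2 / (z : ℂ) ^ 3) * tensY k π i j := by
  have hz' : (z : ℂ) ≠ 0 := Complex.ofReal_ne_zero.2 hz.ne'
  have hd' := cast_sub_two_ne_zero hd
  rw [hookPart_sol, divA_mul, divA_mul, ← mul_sub, divA_solA_sub hd hπ hk, solC]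
  field_simp

theorem divA_sol (hπ : IsTracelessHook π) (z : ℝ) (i j : Fin d) :
    divA k (hookPart (coordMode (solA k ε π) (solB k ε π)) z) i j
      = 1 / 2 * (divA k (hookPart (coordMode (solA k ε π) (solB k ε π)) z) i j
          - divA k (hookPart (coordMode (solA k ε π) (solB k ε π)) z) j i)
        - 1 / 2 * divB k (hookPart (coordMode (solA k ε π) (solB k ε π)) z) i j := by
  simp only [hookPart_sol, divA_mul, divB_mul]
  linear_combination 1 / 2 * ((z : ℂ) ^ 3)⁻¹ * divA_solA_add (k := k) (ε := ε) hπ i j z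

theorem hookTT_sol (hd : 3 ≤ d) (hπ : IsTracelessHook π) (hk : k ≠ 0) (z : ℝ)
    (i j l : Fin d) : hookTT k (hookPart (coordMode (solA k ε π) (solB k ε π)) z) i j l
      = ((ε : ℂ) / z) ^ 3 * ((calK (d / 2) (z * ‖k‖) : ℂ) / (calK (d / 2) (ε * ‖k‖) : ℂ))
          * hookTT k π i j l := by
  rw [hookPart_sol, hookTT_mul, hookTT_solA hd hπ hk, ← besselF]
  ring

theorem hookPart_sol_eq (hd : 3 ≤ d) (hπ : IsTracelessHook π) (hk : k ≠ 0) (hε : 0 < ε) {z : ℝ}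
    (hz : 0 < z) (i j l : Fin d) :
    hookPart (coordMode (solA k ε π) (solB k ε π)) z i j l
      = ((ε : ℂ) / z) ^ 3 * ((calK (d / 2) (z * ‖k‖) : ℂ) / (calK (d / 2) (ε * ‖k‖) : ℂ))
            * hookTT k π i j l
          + 1 / (‖k‖ : ℂ) ^ 2 *
            ((k i : ℂ) * divA k (hookPart (coordMode (solA k ε π) (solB k ε π)) z) j l
              + (k j : ℂ) * divA k (hookPart (coordMode (solA k ε π) (solB k ε π)) z) i l
              + (k l : ℂ) * divB k (hookPart (coordMode (solA k ε π) (solB k ε π)) z) i j)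
          - (ε : ℂ) ^ 3 / (4 * ((d : ℂ) - 2)) / (2 * (‖k‖ : ℂ) ^ 2)
            * (1 / (z : ℂ) + 1 / (z : ℂ) ^ 3
                * (4 * ((d : ℂ) - 3) / (‖k‖ : ℂ) ^ 2 - (ε : ℂ) ^ 2))
            * tensM3 k π i j l
          - 2 / (z : ℂ) ^ 3 * ((ε : ℂ) ^ 3 / (4 * ((d : ℂ) - 2))) / (‖k‖ : ℂ) ^ 2
            * tensZ k π i j l := by
  have hz' : (z : ℂ) ≠ 0 := Complex.ofReal_ne_zero.2 hz.ne'
  have hz3 : ((z : ℂ) ^ 3)⁻¹ * (z : ℂ) ^ 2 = 1 / z := by field_simp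
  simp only [hookPart_sol, divA_mul, divB_mul]
  rw [solA_eq_longitudinal hd hπ hk hε, ← besselF, ← solC, longitudinal]
  linear_combination (-(solC d ε / (2 * (‖k‖ : ℂ) ^ 2) * tensM3 k π i j l)) * hz3

/-! ### The limit of vanishing cutoff -/

theorem tendsto_besselW_cutoff (hd : 3 ≤ d) (hk : k ≠ 0) :
    Tendsto (fun ε : ℝ => (besselW (d / 2) (ε * ‖k‖) : ℂ)) (𝓝[>] 0) (𝓝 (2 - d)) := by
  have hd' : (3 : ℝ) ≤ d := by exact_mod_cast hd
  have h1 : Tendsto (fun ε : ℝ => ε * ‖k‖) (𝓝[>] 0) (𝓝[>] 0) := by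
    refine tendsto_nhdsWithin_iff.2 ⟨?_, ?_⟩
    · have : Tendsto (fun ε : ℝ => ε * ‖k‖) (𝓝 0) (𝓝 (0 * ‖k‖)) := tendsto_id.mul_const _
      rw [zero_mul] at this
      exact this.mono_left nhdsWithin_le_nhds
    · filter_upwards [self_mem_nhdsWithin] with ε hε using mul_pos hε (norm_pos_iff.2 hk)
  have h2 := (tendsto_besselW_zero (ν := d / 2) (by linarith)).comp h1
  have h3 := (Complex.continuous_ofReal.tendsto _).comp h2
  have e : ((2 - 2 * ((d : ℝ) / 2) : ℝ) : ℂ) = 2 - d := by push_cast; ring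
  rwa [e] at h3

/-- At `z = ε` both profile ratios equal `1`, so the component is `ε` times an expression depending
on `ε` only through `W(εk)`. -/
theorem symPart_sol_cutoff_isLittleO (hd : 3 ≤ d) (hk : k ≠ 0) (i j : Fin d) :
    (fun ε : ℝ => symPart (coordMode (solA k ε π) (solB k ε π)) ε i j
      - Complex.I * (ε : ℂ) / ((d : ℂ) - 2) * divB k π i j) =o[𝓝[>] 0] fun ε : ℝ => ε := by
  have hk' := norm_ne_zero' hk
  have hd' := cast_sub_two_ne_zero hd
  have hd2 : (2 : ℂ) - d ≠ 0 := by rw [← neg_sub]; exact neg_ne_zero.2 hd'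
  set g : ℝ → ℂ := fun ε => -Complex.I / (besselW (d / 2) (ε * ‖k‖) : ℂ)
      * (divB k π i j + 1 / (2 * (‖k‖ : ℂ) ^ 2) * tensS k π i j)
    - Complex.I / (2 * ((d : ℂ) - 2)) * (1 / (‖k‖ : ℂ) ^ 2) * tensS k π i j
    - Complex.I / ((d : ℂ) - 2) * divB k π i j with hg
  have hlim : Tendsto g (𝓝[>] 0) (𝓝 0) := by
    have h1 := ((((tendsto_const_nhds (x := -Complex.I)).div (tendsto_besselW_cutoff hd hk)
      hd2).mul_const (divB k π i j + 1 / (2 * (‖k‖ : ℂ) ^ 2) * tensS k π i j)).sub_const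
      (Complex.I / (2 * ((d : ℂ) - 2)) * (1 / (‖k‖ : ℂ) ^ 2) * tensS k π i j)).sub_const
      (Complex.I / ((d : ℂ) - 2) * divB k π i j)
    -- With `W → 2 - d` the two contributions of `S` cancel and the rest is the claimed leading
    -- term.
    have e : -Complex.I / (2 - d) * (divB k π i j + 1 / (2 * (‖k‖ : ℂ) ^ 2) * tensS k π i j)
        - Complex.I / (2 * ((d : ℂ) - 2)) * (1 / (‖k‖ : ℂ) ^ 2) * tensS k π i j
        - Complex.I / ((d : ℂ) - 2) * divB k π i j = 0 := by
      rw [show (2 : ℂ) - d = -((d : ℂ) - 2) by ring]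
      field_simp
      ring
    rwa [e] at h1
  have ho := ((Asymptotics.isLittleO_one_iff ℝ).2 hlim).mul_isBigO
    (Complex.isBigO_ofReal_left.2 (Asymptotics.isBigO_refl (fun ε : ℝ => ε) (𝓝[>] 0)))
  refine ho.congr' ?_ (Eventually.of_forall fun ε => one_mul ε)
  filter_upwards [self_mem_nhdsWithin] with ε hε
  have hε' : (ε : ℂ) ≠ 0 := Complex.ofReal_ne_zero.2 (ne_of_gt hε)
  rw [symPart_sol hd hk hε hε, div_self hε', div_self (ofReal_calK_ne_zero hk _ hε), hg]
  ring

end Explicit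

end HookAdS
end

/-! ### Assembly of the main theorem -/

open HookAdS in
theorem mainTheorem1 (d : ℕ) (hd : 3 ≤ d) (k : EuclideanSpace ℝ (Fin d)) (hk : k ≠ 0)
    (π : BTensor d) (hπ : IsTracelessHook π) :
    -- existence and uniqueness
    (∀ ε : ℝ, 0 < ε → ∃ Φ : Mode d, IsDirichletSolution ε k π Φ ∧
      ∀ Ψ : Mode d, IsDirichletSolution ε k π Ψ →
        ∀ μ ν ρ, Set.EqOn (Ψ μ ν ρ) (Φ μ ν ρ) (Set.Ici ε)) ∧
    -- the tensor structure multiplying the Bessel ratio is transverse and traceless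
    ((∀ i j l, hookTT k π i j l = hookTT k π j i l) ∧
      (∀ i j l, hookTT k π i j l + hookTT k π i l j + hookTT k π l j i = 0) ∧
      (∀ j l, divA k (hookTT k π) j l = 0) ∧ (∀ i j, divB k (hookTT k π) i j = 0) ∧
      (∀ l, ∑ i, hookTT k π i i l = 0)) ∧
    -- the components of the solution
    (∀ ε : ℝ, 0 < ε → ∀ Φ : Mode d, IsDirichletSolution ε k π Φ → ∀ z : ℝ, ε ≤ z →
      scalarTrace Φ z = 0 ∧
      (∀ i, vecTrace Φ z i =
        (ε : ℂ) ^ 3 / (4 * ((d : ℂ) - 2)) * (1 / (z : ℂ) - (ε : ℂ) ^ 2 / (z : ℂ) ^ 3)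
          * divL k π i) ∧
      (∀ i j, symPart Φ z i j =
        -Complex.I * ((ε : ℂ) / z) ^ 2 * ((ε : ℂ) / (besselW (d / 2) (ε * ‖k‖) : ℂ))
            * ((calK (d / 2) (z * ‖k‖) : ℂ) / (calK (d / 2) (ε * ‖k‖) : ℂ))
            * (divB k π i j + 1 / (2 * (‖k‖ : ℂ) ^ 2) * tensS k π i j)
          - Complex.I * (ε : ℂ) / (2 * ((d : ℂ) - 2)) * ((ε : ℂ) / z) ^ 2
            * (1 / (‖k‖ : ℂ) ^ 2) * tensS k π i j) ∧
      (∀ i j l, hookPart Φ z i j l =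
        ((ε : ℂ) / z) ^ 3 * ((calK (d / 2) (z * ‖k‖) : ℂ) / (calK (d / 2) (ε * ‖k‖) : ℂ))
            * hookTT k π i j l
          + 1 / (‖k‖ : ℂ) ^ 2 *
            ((k i : ℂ) * divA k (hookPart Φ z) j l + (k j : ℂ) * divA k (hookPart Φ z) i l
              + (k l : ℂ) * divB k (hookPart Φ z) i j)
          - (ε : ℂ) ^ 3 / (4 * ((d : ℂ) - 2)) / (2 * (‖k‖ : ℂ) ^ 2)
            * (1 / (z : ℂ) + 1 / (z : ℂ) ^ 3
                * (4 * ((d : ℂ) - 3) / (‖k‖ : ℂ) ^ 2 - (ε : ℂ) ^ 2))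
            * tensM3 k π i j l
          - 2 / (z : ℂ) ^ 3 * ((ε : ℂ) ^ 3 / (4 * ((d : ℂ) - 2))) / (‖k‖ : ℂ) ^ 2
            * tensZ k π i j l) ∧
      (∀ i j, divB k (hookPart Φ z) i j =
        1 / 2 * ((ε : ℂ) / z) ^ 3
            * ((besselW (d / 2) (z * ‖k‖) : ℂ) / (besselW (d / 2) (ε * ‖k‖) : ℂ))
            * ((calK (d / 2) (z * ‖k‖) : ℂ) / (calK (d / 2) (ε * ‖k‖) : ℂ)) * tensM2 k π i j
          - (ε : ℂ) ^ 3 / (4 * ((d : ℂ) - 2))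
            * (2 * ((d : ℂ) - 2) / ((z : ℂ) ^ 3 * (‖k‖ : ℂ) ^ 2)
                - (ε : ℂ) ^ 2 / (2 * (z : ℂ) ^ 3) + 1 / (2 * (z : ℂ)))
            * tensS k π i j) ∧
      (∀ i j, divA k (hookPart Φ z) i j - divA k (hookPart Φ z) j i =
        ((ε : ℂ) / z) ^ 3 * tensT k π i j
          + 3 / 2 * ((ε : ℂ) ^ 3 / (4 * ((d : ℂ) - 2)))
            * (1 / (z : ℂ) - (ε : ℂ) ^ 2 / (z : ℂ) ^ 3) * tensY k π i j) ∧
      (∀ i j, divA k (hookPart Φ z) i j =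
        1 / 2 * (divA k (hookPart Φ z) i j - divA k (hookPart Φ z) j i)
          - 1 / 2 * divB k (hookPart Φ z) i j) ∧
      (∀ i j l, hookTT k (hookPart Φ z) i j l =
        ((ε : ℂ) / z) ^ 3 * ((calK (d / 2) (z * ‖k‖) : ℂ) / (calK (d / 2) (ε * ‖k‖) : ℂ))
          * hookTT k π i j l)) ∧
    -- behaviour at the boundary as the cutoff is removed
    (∀ Φ : ℝ → Mode d, (∀ ε : ℝ, 0 < ε → IsDirichletSolution ε k π (Φ ε)) →
      (∀ ε : ℝ, 0 < ε → scalarTrace (Φ ε) ε = 0 ∧ (∀ i, vecTrace (Φ ε) ε i = 0) ∧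
        hookPart (Φ ε) ε = π) ∧
      (∀ i j, Filter.Tendsto (fun ε : ℝ => symPart (Φ ε) ε i j)
        (nhdsWithin 0 (Set.Ioi 0)) (nhds 0)) ∧
      (∀ i j, (fun ε : ℝ => symPart (Φ ε) ε i j
          - Complex.I * (ε : ℂ) / ((d : ℂ) - 2) * divB k π i j)
        =o[nhdsWithin 0 (Set.Ioi 0)] (fun ε : ℝ => ε))) := by
  have hd2 := cast_sub_two_ne_zero hd
  -- By uniqueness every claim about a solution may be checked on the explicit one.
  have hsol : ∀ ε : ℝ, 0 < ε → ∀ Φ : Mode d, IsDirichletSolution ε k π Φ → ∀ z : ℝ, ε ≤ z →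
      hookPart Φ z = hookPart (coordMode (solA k ε π) (solB k ε π)) z ∧
      symPart Φ z = symPart (coordMode (solA k ε π) (solB k ε π)) z := fun ε hε Φ hΦ z hz => by
    have h := hΦ.eq_sol hd hε hk hπ hz
    exact ⟨funext fun i => funext fun j => funext fun l => h _ _ _,
      funext fun i => funext fun j => h _ _ _⟩
  have hcut : ∀ Φ : ℝ → Mode d, (∀ ε : ℝ, 0 < ε → IsDirichletSolution ε k π (Φ ε)) → ∀ i j,
      (fun ε : ℝ => symPart (Φ ε) ε i j - Complex.I * (ε : ℂ) / ((d : ℂ) - 2) * divB k π i j)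
        =o[nhdsWithin 0 (Set.Ioi 0)] (fun ε : ℝ => ε) := fun Φ hΦ i j => by
    refine (symPart_sol_cutoff_isLittleO (π := π) hd hk i j).congr' ?_
      (Filter.Eventually.of_forall fun _ => rfl)
    filter_upwards [self_mem_nhdsWithin] with ε hε
    rw [(hsol ε hε _ (hΦ ε hε) ε le_rfl).2]
  refine ⟨fun ε hε => ⟨_, isDirichletSolution_sol hd hk hπ hε,
      fun Ψ hΨ μ ν ρ z hz => hΨ.eq_sol hd hε hk hπ hz μ ν ρ⟩,
    ⟨hπ.hookTT_symm, hπ.hookTT_young, hπ.divA_hookTT hk hd2, hπ.divB_hookTT hk hd2,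
      hπ.trace_hookTT hk hd2⟩, fun ε hε Φ hΦ z hz => ?_, fun Φ hΦ => ⟨fun ε hε => ?_, fun i j => ?_,
      hcut Φ hΦ⟩⟩
  · obtain ⟨hA, hB⟩ := hsol ε hε Φ hΦ z hz
    have hz0 := hε.trans_le hz
    simp only [scalarTrace, vecTrace, hA, hB]
    exact ⟨scalarTrace_sol hπ z, vecTrace_sol hd hπ hk hz0, symPart_sol hd hk hε hz0,
      hookPart_sol_eq hd hπ hk hε hz0, divB_sol hd hπ hk hε hz0, divA_sol_sub hd hπ hk hz0,
      divA_sol hπ z, hookTT_sol hd hπ hk z⟩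
  · obtain ⟨hA, hB⟩ := hsol ε hε _ (hΦ ε hε) ε le_rfl
    have hε' : (ε : ℂ) ≠ 0 := Complex.ofReal_ne_zero.2 hε.ne'
    have hT : hookPart (Φ ε) ε = π :=
      funext fun i => funext fun j => funext fun l => (hΦ ε hε).boundary i j l
    refine ⟨?_, fun l => ?_, hT⟩
    · simp only [scalarTrace, hB]
      exact scalarTrace_sol hπ ε
    · rw [vecTrace, hT, hπ.traceless]
  · have hid : Filter.Tendsto (fun ε : ℝ => ε) (nhdsWithin 0 (Set.Ioi 0)) (nhds 0) :=
      nhdsWithin_le_nhds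
    have h1 := (hcut Φ hΦ i j).isBigO.trans_tendsto hid
    have h2 : Filter.Tendsto (fun ε : ℝ => Complex.I * (ε : ℂ) / ((d : ℂ) - 2) * divB k π i j)
        (nhdsWithin 0 (Set.Ioi 0)) (nhds 0) := by
      have hc : Continuous fun ε : ℝ => Complex.I * (ε : ℂ) / ((d : ℂ) - 2) * divB k π i j := by
        fun_prop
      have := hc.tendsto 0
      simp only [Complex.ofReal_zero, mul_zero, zero_div, zero_mul] at this
      exact this.mono_left nhdsWithin_le_nhds
    simpa using h1.add h2
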